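/- There are a real RAM program and an absolute constant $C$ such that the following holds. Let $P$ be a convex polygon in the plane with $n\ge 3$ vertices, stored in order along the boundary in an array, let $\alpha,\beta>0$ be angles with $\alpha+\beta<\pi$, and let $0<\varepsilon<1$. Call a nondegenerate triangle with corners $p,q,r$ in counterclockwise order an $(\alpha,\beta)$-triangle if $\angle rpq=\alpha$ and $\angle pqr=\beta$; it is inscribed in $P$ if it is contained in the closed region bounded by $P$, and its position and orientation are otherwise arbitrary. Then a maximum-area $(\alpha,\beta)$-triangle inscribed in $P$ exists, and on input $(P,\alpha,\beta,\varepsilon)$ the program outputs the corners of an $(\alpha,\beta)$-triangle inscribed in $P$ whose area is at least $(1-\varepsilon)$ times this maximum, after at most $C\,(\varepsilon^{-1/2}\log n+\varepsilon^{-1})$ steps. Here the real RAM works with exact real numbers, performs $+,-,\times,/$ and comparisons of reals, memory accesses, and additions, subtractions, halvings and comparisons of integers in one step each; each of the angles $\alpha,\beta$ is given to it by its cosine and its sine. -/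

import Mathlib

open scoped EuclideanGeometry

noncomputable section

/-! A real RAM, programmed by structured programs. -/

namespace RealRAM

/-- The memory: countably many integer arrays and countably many real arrays. An array is named
by a number that is fixed in the program text; its cells are addressed by computed indices.
(Any one program names only finitely many arrays.) -/
structure State where
  int : ℕ → ℕ → ℕ
  real : ℕ → ℕ → ℝ

/-- Integer expressions: constants, array access, and addition, (truncated) subtraction,
halving. -/
inductive IExp where
  | const (k : ℕ)
  | get (a : ℕ) (i : IExp)
  | add (e f : IExp)
  | sub (e f : IExp)
  | half (e : IExp)

def IExp.eval (s : State) : IExp → ℕ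
  | .const k => k
  | .get a i => s.int a (i.eval s)
  | .add e f => e.eval s + f.eval s
  | .sub e f => e.eval s - f.eval s
  | .half e => e.eval s / 2

/-- Every constant, memory access and operation costs one step. -/
def IExp.cost : IExp → ℕ
  | .const _ => 1
  | .get _ i => i.cost + 1
  | .add e f => e.cost + f.cost + 1
  | .sub e f => e.cost + f.cost + 1
  | .half e => e.cost + 1

/-- Real expressions: rational constants, array access, and the four exact field operations.
There is no rounding, no root and no transcendental operation. -/
inductive RExp where
  | const (c : ℚ)
  | get (a : ℕ) (i : IExp)
  | add (e f : RExp)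
  | sub (e f : RExp)
  | mul (e f : RExp)
  | div (e f : RExp)

def RExp.eval (s : State) : RExp → ℝ
  | .const c => (c : ℝ)
  | .get a i => s.real a (i.eval s)
  | .add e f => e.eval s + f.eval s
  | .sub e f => e.eval s - f.eval s
  | .mul e f => e.eval s * f.eval s
  | .div e f => e.eval s / f.eval s

def RExp.cost : RExp → ℕ
  | .const _ => 1
  | .get _ i => i.cost + 1
  | .add e f => e.cost + f.cost + 1
  | .sub e f => e.cost + f.cost + 1
  | .mul e f => e.cost + f.cost + 1
  | .div e f => e.cost + f.cost + 1

/-- Tests: comparisons of integers and exact comparisons of reals. -/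
inductive BExp where
  | ilt (e f : IExp)
  | rlt (e f : RExp)
  | not (b : BExp)
  | and (b c : BExp)

def BExp.holds (s : State) : BExp → Prop
  | .ilt e f => e.eval s < f.eval s
  | .rlt e f => e.eval s < f.eval s
  | .not b => ¬ b.holds s
  | .and b c => b.holds s ∧ c.holds s

def BExp.cost : BExp → ℕ
  | .ilt e f => e.cost + f.cost + 1
  | .rlt e f => e.cost + f.cost + 1
  | .not b => b.cost + 1
  | .and b c => b.cost + c.cost + 1

/-- Programs: assignments to a cell `a[i]` of an integer or real array, composition,
conditionals and while-loops. -/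
inductive Program where
  | skip
  | setI (a : ℕ) (i e : IExp)
  | setR (a : ℕ) (i : IExp) (e : RExp)
  | seq (c d : Program)
  | ite (b : BExp) (c d : Program)
  | loop (b : BExp) (c : Program)

def State.setInt (s : State) (a i k : ℕ) : State :=
  { s with int := Function.update s.int a (Function.update (s.int a) i k) }

def State.setReal (s : State) (a i : ℕ) (x : ℝ) : State :=
  { s with real := Function.update s.real a (Function.update (s.real a) i x) }

/-- `Runs c s s' t`: started in memory `s`, the program `c` halts in memory `s'` after exactly
`t` steps. -/
inductive Runs : Program → State → State → ℕ → Prop where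
  | skip (s : State) : Runs .skip s s 1
  | setI (a : ℕ) (i e : IExp) (s : State) :
      Runs (.setI a i e) s (s.setInt a (i.eval s) (e.eval s)) (i.cost + e.cost + 1)
  | setR (a : ℕ) (i : IExp) (e : RExp) (s : State) :
      Runs (.setR a i e) s (s.setReal a (i.eval s) (e.eval s)) (i.cost + e.cost + 1)
  | seq {c d : Program} {s s₁ s₂ : State} {t u : ℕ} :
      Runs c s s₁ t → Runs d s₁ s₂ u → Runs (.seq c d) s s₂ (t + u)
  | iteTrue {b : BExp} {c d : Program} {s s₁ : State} {t : ℕ} :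
      b.holds s → Runs c s s₁ t → Runs (.ite b c d) s s₁ (b.cost + 1 + t)
  | iteFalse {b : BExp} {c d : Program} {s s₁ : State} {t : ℕ} :
      ¬ b.holds s → Runs d s s₁ t → Runs (.ite b c d) s s₁ (b.cost + 1 + t)
  | loopTrue {b : BExp} {c : Program} {s s₁ s₂ : State} {t u : ℕ} :
      b.holds s → Runs c s s₁ t → Runs (.loop b c) s₁ s₂ u →
      Runs (.loop b c) s s₂ (b.cost + 1 + t + u)
  | loopFalse {b : BExp} {c : Program} {s : State} :
      ¬ b.holds s → Runs (.loop b c) s s (b.cost + 1)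

end RealRAM

/-! Triangles in convex polygons. -/

abbrev Plane : Type := EuclideanSpace ℝ (Fin 2)

/-- Twice the signed area of the triangle `pqr`; positive iff `p, q, r` is counterclockwise. -/
def cross (p q r : Plane) : ℝ :=
  (q 0 - p 0) * (r 1 - p 1) - (q 1 - p 1) * (r 0 - p 0)

/-- The area of the triangle `pqr`. -/
def triangleArea (p q r : Plane) : ℝ := |cross p q r| / 2

/-- `v 0, …, v (n-1)` are the vertices of a (strictly) convex polygon, listed in order along its
boundary, counterclockwise or clockwise. -/
def IsConvexPolygon {n : ℕ} (v : Fin n → Plane) : Prop :=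
  3 ≤ n ∧ ((∀ i j k : Fin n, i < j → j < k → 0 < cross (v i) (v j) (v k)) ∨
    (∀ i j k : Fin n, i < j → j < k → cross (v i) (v j) (v k) < 0))

/-- The closed region bounded by the convex polygon with vertices `v`. -/
def polygonRegion {n : ℕ} (v : Fin n → Plane) : Set Plane := convexHull ℝ (Set.range v)

/-- `pqr` is a (nondegenerate) triangle with corners in counterclockwise order, angle `α` at `p`
and angle `β` at `q`. -/
def IsABTriangle (α β : ℝ) (p q r : Plane) : Prop :=
  0 < cross p q r ∧ ∠ r p q = α ∧ ∠ p q r = β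

/-- `pqr` is an `(α, β)`-triangle contained in the region `K`. -/
def IsInscribedABTriangle (K : Set Plane) (α β : ℝ) (p q r : Plane) : Prop :=
  IsABTriangle α β p q r ∧ convexHull ℝ {p, q, r} ⊆ K

/-- The areas of all `(α, β)`-triangles inscribed in `K`. -/
def inscribedAreas (K : Set Plane) (α β : ℝ) : Set ℝ :=
  {A | ∃ p q r : Plane, IsInscribedABTriangle K α β p q r ∧ triangleArea p q r = A}

/-- The initial memory. The integer cell `0[0]` holds `n`; the real arrays `0` and `1` hold the
`x`- and `y`-coordinates of the vertices; the real array `2` holds `ε` and the two angles, each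
given by its cosine and sine. All other cells hold zero. -/
def inputState {n : ℕ} (v : Fin n → Plane) (α β ε : ℝ) : RealRAM.State where
  int
    | 0, 0 => n
    | _, _ => 0
  real
    | 0, i => if h : i < n then v ⟨i, h⟩ 0 else 0
    | 1, i => if h : i < n then v ⟨i, h⟩ 1 else 0
    | 2, 0 => ε
    | 2, 1 => Real.cos α
    | 2, 2 => Real.sin α
    | 2, 3 => Real.cos β
    | 2, 4 => Real.sin β
    | _, _ => 0

/-- The output: corner number `k` of the triangle is read off from cell `k` of the real arrays
`3` (`x`-coordinate) and `4` (`y`-coordinate). -/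
def outputCorner (s : RealRAM.State) (k : ℕ) : Plane := !₂[s.real 3 k, s.real 4 k]

end

set_option linter.unusedSimpArgs false

noncomputable section

/-! ### A Hoare calculus with time bounds for the structured programs -/

namespace RealRAM

/-! The polygon is replaced by the hull of O(ε^{-1/2}) of its vertices that contains a copy of it
scaled by 1 - ε/2, and the maximum is found exactly in that smaller polygon. Scaling costs a factor
(1 - ε/2)² ≥ 1 - ε in area. Selecting the vertices takes O(ε^{-1/2}) bisections of O(log n) steps,
and the exact search in a K-gon takes O(K²) = O(1/ε) steps.

Sparsification. Let m be a vertex farthest from the edge joining the last vertex to vertex 0, and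
let L and R be vertices farthest from the diagonal 0m on its two sides. An affine functional is
unimodal along the relevant parts of the boundary (`no_valley`), so bisection for a local maximum
finds them. They cut the boundary into four chains, each monotone in the distances from that edge
and from that diagonal; scaled, each nontrivial chain runs from corner to corner of a unit box
(`BoxChain`). Vertex 0 or vertex m lies beyond a further corner of the box, so a chord with total
coordinate increase X sees the polygon extend inwards by at least X/2 (`ConvexChain.le_opposite`),
in units of normalized cross products. The vertices skipped by the chord stick out by at most X²
times the change Δ of slope, measured as a share in [0, 1]. Requiring X² + Δ² ≤ ε/4 makes this at
most Xε/8 (`ConvexChain.dist_le`). Hence the homothety of ratio 1 - ε/2 about the midpoint of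
vertices 0 and m maps the polygon into the hull of the kept vertices (`CCW.homothety_mem`). A greedy
choice of chords keeps few vertices, because coordinate sum plus slope is a potential of total
variation at most 3 that any piece violating the requirement increases by at least √ε/2.

Exact search. With corners read as complex numbers, the angles say that r - p = (a + bi)(q - p) for
constants a and b > 0 (`isABTriangle_iff`). So a triangle is a pair (p, w), containment is linear in
(p, w), and the area is a multiple of |w|². Strict convexity of |w|² gives a maximum triangle with a
corner at a vertex of the polygon (`exists_max_triangle`). For a fixed vertex and a fixed role of
that corner, w and (a + bi)w each lie in a wedge of the fan triangulation from the vertex.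
Multiplication by a + bi turns by a fixed angle, so two monotone pointers meet all relevant pairs of
wedges in O(K) moves (`CCW.covered_succ_left`, `CCW.covered_succ_right`). For one pair of wedges the
admissible w form a polygon cut out by six linear inequalities, on which |w|² is largest at an
intersection of two boundary lines (`Lin.exists_meet_ge`); all 36 ordered pairs of lines are tried.
Cyclic relabelling of the corners handles the other two roles. -/

/-- Started in `s`, the program `c` halts within `T` steps in a memory satisfying `Q`. -/
def Halts (c : Program) (s : State) (T : ℕ) (Q : State → Prop) : Prop :=
  ∃ s' t, Runs c s s' t ∧ t ≤ T ∧ Q s'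

theorem Halts.mono {c : Program} {s : State} {T U : ℕ} {Q R : State → Prop}
    (h : Halts c s T Q) (hT : T ≤ U) (hQ : ∀ s', Q s' → R s') : Halts c s U R := by
  obtain ⟨s', t, hr, ht, hq⟩ := h
  exact ⟨s', t, hr, ht.trans hT, hQ _ hq⟩

theorem Halts.seq {c d : Program} {s : State} {T U : ℕ} {Q : State → Prop}
    (h : Halts c s T (fun s₁ => Halts d s₁ U Q)) : Halts (.seq c d) s (T + U) Q := by
  obtain ⟨s₁, t, hr, ht, s₂, u, hr', hu, hq⟩ := h
  exact ⟨s₂, t + u, hr.seq hr', by omega, hq⟩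

theorem Halts.ite {b : BExp} {c d : Program} {s : State} {T U : ℕ} {Q : State → Prop}
    (hc : b.holds s → Halts c s T Q) (hd : ¬ b.holds s → Halts d s U Q) :
    Halts (.ite b c d) s (b.cost + 1 + (T + U)) Q := by
  by_cases hb : b.holds s
  · obtain ⟨s', t, hr, ht, hq⟩ := hc hb
    exact ⟨s', _, .iteTrue hb hr, by omega, hq⟩
  · obtain ⟨s', t, hr, ht, hq⟩ := hd hb
    exact ⟨s', _, .iteFalse hb hr, by omega, hq⟩

/-- A loop with invariant `Inv` and variant `μ`. -/
theorem Halts.loop {b : BExp} {c : Program} (Inv : State → Prop) (μ : State → ℕ) {T : ℕ}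
    (hstep : ∀ s, Inv s → b.holds s → Halts c s T (fun s' => Inv s' ∧ μ s' < μ s))
    {s : State} (hs : Inv s) {N : ℕ} (hN : μ s ≤ N) :
    Halts (.loop b c) s ((N + 1) * (T + b.cost + 1)) (fun s' => Inv s' ∧ ¬ b.holds s') := by
  induction N generalizing s with
  | zero =>
    by_cases hb : b.holds s
    · obtain ⟨s', t, -, -, -, h⟩ := hstep s hs hb
      omega
    · exact ⟨s, _, .loopFalse hb, by omega, hs, hb⟩
  | succ N ih =>
    by_cases hb : b.holds s
    · obtain ⟨s', t, hr, ht, hi, hμ⟩ := hstep s hs hb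
      obtain ⟨s'', u, hr', hu, hq⟩ := ih hi (by omega)
      refine ⟨s'', _, .loopTrue hb hr hr', ?_, hq⟩
      calc b.cost + 1 + t + u ≤ (T + b.cost + 1) + (N + 1) * (T + b.cost + 1) := by omega
        _ = (N + 1 + 1) * (T + b.cost + 1) := by ring
    · refine ⟨s, _, .loopFalse hb, ?_, hs, hb⟩
      calc b.cost + 1 ≤ T + b.cost + 1 := by omega
        _ ≤ (N + 1 + 1) * (T + b.cost + 1) := Nat.le_mul_of_pos_left _ (by omega)

/-! ### Which arrays a program writes to -/

def Program.WritesInt : Program → ℕ → Prop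
  | .skip, _ => False
  | .setI a _ _, k => k = a
  | .setR _ _ _, _ => False
  | .seq c d, k => c.WritesInt k ∨ d.WritesInt k
  | .ite _ c d, k => c.WritesInt k ∨ d.WritesInt k
  | .loop _ c, k => c.WritesInt k

def Program.WritesReal : Program → ℕ → Prop
  | .skip, _ => False
  | .setI _ _ _, _ => False
  | .setR a _ _, k => k = a
  | .seq c d, k => c.WritesReal k ∨ d.WritesReal k
  | .ite _ c d, k => c.WritesReal k ∨ d.WritesReal k
  | .loop _ c, k => c.WritesReal k

theorem Runs.int_eq {c : Program} {s s' : State} {t : ℕ} (h : Runs c s s' t) {k : ℕ}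
    (hk : ¬ c.WritesInt k) : s'.int k = s.int k := by
  induction h with
  | skip | setR | loopFalse => rfl
  | setI a i e s => simp [State.setInt, Function.update_of_ne (show k ≠ a from hk)]
  | seq _ _ ih₁ ih₂ =>
    simp only [Program.WritesInt, not_or] at hk
    rw [ih₂ hk.2, ih₁ hk.1]
  | iteTrue _ _ ih =>
    simp only [Program.WritesInt, not_or] at hk
    exact ih hk.1
  | iteFalse _ _ ih =>
    simp only [Program.WritesInt, not_or] at hk
    exact ih hk.2
  | loopTrue _ _ _ ih₁ ih₂ => rw [ih₂ hk, ih₁ hk]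

theorem Runs.real_eq {c : Program} {s s' : State} {t : ℕ} (h : Runs c s s' t) {k : ℕ}
    (hk : ¬ c.WritesReal k) : s'.real k = s.real k := by
  induction h with
  | skip | setI | loopFalse => rfl
  | setR a i e s => simp [State.setReal, Function.update_of_ne (show k ≠ a from hk)]
  | seq _ _ ih₁ ih₂ =>
    simp only [Program.WritesReal, not_or] at hk
    rw [ih₂ hk.2, ih₁ hk.1]
  | iteTrue _ _ ih =>
    simp only [Program.WritesReal, not_or] at hk
    exact ih hk.1
  | iteFalse _ _ ih =>
    simp only [Program.WritesReal, not_or] at hk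
    exact ih hk.2
  | loopTrue _ _ _ ih₁ ih₂ => rw [ih₂ hk, ih₁ hk]

/-- `s'` agrees with `s` on the arrays that `c` does not write to. -/
def Frame (c : Program) (s s' : State) : Prop :=
  (∀ k, ¬ c.WritesInt k → s'.int k = s.int k) ∧ ∀ k, ¬ c.WritesReal k → s'.real k = s.real k

theorem Frame.int {c : Program} {s s' : State} (h : Frame c s s') (k : ℕ)
    (hk : ¬ c.WritesInt k) : s'.int k = s.int k := h.1 k hk

theorem Frame.real {c : Program} {s s' : State} (h : Frame c s s') (k : ℕ)
    (hk : ¬ c.WritesReal k) : s'.real k = s.real k := h.2 k hk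

/-- The frame rule: which arrays stay fixed is read off from the program text, so the specification
of a subprogram need not mention the arrays it leaves alone. -/
theorem Halts.frame {c : Program} {s : State} {T : ℕ} {Q : State → Prop} (h : Halts c s T Q) :
    Halts c s T (fun s' => Q s' ∧ Frame c s s') := by
  obtain ⟨s', t, hr, ht, hq⟩ := h
  exact ⟨s', t, hr, ht, hq, fun _ => hr.int_eq, fun _ => hr.real_eq⟩

/-! ### Loop-free programs -/

def Program.LoopFree : Program → Prop
  | .seq c d => c.LoopFree ∧ d.LoopFree
  | .ite _ c d => c.LoopFree ∧ d.LoopFree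
  | .loop _ _ => False
  | _ => True

/-- A bound for the running time of a loop-free program. -/
def Program.bound : Program → ℕ
  | .skip => 1
  | .setI _ i e => i.cost + e.cost + 1
  | .setR _ i e => i.cost + e.cost + 1
  | .seq c d => c.bound + d.bound
  | .ite b c d => b.cost + 1 + (c.bound + d.bound)
  | .loop _ _ => 0

open Classical in
/-- The effect of a loop-free program. -/
def Program.exec : Program → State → State
  | .skip, s => s
  | .setI a i e, s => s.setInt a (i.eval s) (e.eval s)
  | .setR a i e, s => s.setReal a (i.eval s) (e.eval s)
  | .seq c d, s => d.exec (c.exec s)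
  | .ite b c d, s => if b.holds s then c.exec s else d.exec s
  | .loop _ _, s => s

theorem Program.LoopFree.halts {c : Program} (h : c.LoopFree) {s : State} {Q : State → Prop}
    (hQ : Q (c.exec s)) : Halts c s c.bound Q := by
  induction c generalizing s Q with
  | skip => exact ⟨_, _, .skip s, le_rfl, hQ⟩
  | setI a i e => exact ⟨_, _, .setI a i e s, le_rfl, hQ⟩
  | setR a i e => exact ⟨_, _, .setR a i e s, le_rfl, hQ⟩
  | seq c d ihc ihd => exact Halts.seq (ihc h.1 (ihd h.2 hQ))
  | ite b c d ihc ihd =>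
    refine Halts.ite (fun hb => ihc h.1 ?_) (fun hb => ihd h.2 ?_)
    · simpa [Program.exec, hb] using hQ
    · simpa [Program.exec, hb] using hQ
  | loop => exact h.elim

/-! ### Reading memory after an assignment -/

@[simp] theorem State.setInt_real (s : State) (a i k : ℕ) : (s.setInt a i k).real = s.real := rfl

theorem State.setInt_int (s : State) (a i k b j : ℕ) :
    (s.setInt a i k).int b j = if b = a ∧ j = i then k else s.int b j := by
  by_cases h : b = a <;> by_cases h' : j = i <;>
    simp [State.setInt, Function.update_apply, h, h']

theorem State.setReal_real (s : State) (a i b j : ℕ) (x : ℝ) :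
    (s.setReal a i x).real b j = if b = a ∧ j = i then x else s.real b j := by
  by_cases h : b = a <;> by_cases h' : j = i <;>
    simp [State.setReal, Function.update_apply, h, h']

/-! ### Scalars: cell `0` of an array -/

def ivar (a : ℕ) : IExp := .get a (.const 0)
def rvar (a : ℕ) : RExp := .get a (.const 0)
def setIvar (a : ℕ) (e : IExp) : Program := .setI a (.const 0) e
def setRvar (a : ℕ) (e : RExp) : Program := .setR a (.const 0) e

@[simp] theorem eval_ivar (s : State) (a : ℕ) : (ivar a).eval s = s.int a 0 := rfl
@[simp] theorem eval_rvar (s : State) (a : ℕ) : (rvar a).eval s = s.real a 0 := rfl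
@[simp] theorem exec_setIvar (s : State) (a : ℕ) (e : IExp) :
    (setIvar a e).exec s = s.setInt a 0 (e.eval s) := rfl
@[simp] theorem exec_setRvar (s : State) (a : ℕ) (e : RExp) :
    (setRvar a e).exec s = s.setReal a 0 (e.eval s) := rfl
@[simp] theorem loopFree_setIvar (a : ℕ) (e : IExp) : (setIvar a e).LoopFree := trivial
@[simp] theorem loopFree_setRvar (a : ℕ) (e : RExp) : (setRvar a e).LoopFree := trivial
@[simp] theorem writesInt_setIvar (a k : ℕ) (e : IExp) :
    (setIvar a e).WritesInt k ↔ k = a := Iff.rfl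
@[simp] theorem writesReal_setIvar (a k : ℕ) (e : IExp) :
    (setIvar a e).WritesReal k ↔ False := Iff.rfl

@[simp] theorem eval_const (s : State) (k : ℕ) : (IExp.const k).eval s = k := rfl
@[simp] theorem eval_get (s : State) (a : ℕ) (i : IExp) :
    (IExp.get a i).eval s = s.int a (i.eval s) := rfl
@[simp] theorem eval_add (s : State) (e f : IExp) :
    (IExp.add e f).eval s = e.eval s + f.eval s := rfl
@[simp] theorem eval_sub (s : State) (e f : IExp) :
    (IExp.sub e f).eval s = e.eval s - f.eval s := rfl
@[simp] theorem eval_half (s : State) (e : IExp) : (IExp.half e).eval s = e.eval s / 2 := rfl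
@[simp] theorem reval_const (s : State) (c : ℚ) : (RExp.const c).eval s = c := rfl
@[simp] theorem reval_get (s : State) (a : ℕ) (i : IExp) :
    (RExp.get a i).eval s = s.real a (i.eval s) := rfl
@[simp] theorem reval_add (s : State) (e f : RExp) :
    (RExp.add e f).eval s = e.eval s + f.eval s := rfl
@[simp] theorem reval_sub (s : State) (e f : RExp) :
    (RExp.sub e f).eval s = e.eval s - f.eval s := rfl
@[simp] theorem reval_mul (s : State) (e f : RExp) :
    (RExp.mul e f).eval s = e.eval s * f.eval s := rfl
@[simp] theorem reval_div (s : State) (e f : RExp) :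
    (RExp.div e f).eval s = e.eval s / f.eval s := rfl
@[simp] theorem holds_ilt (s : State) (e f : IExp) :
    (BExp.ilt e f).holds s ↔ e.eval s < f.eval s := Iff.rfl
@[simp] theorem holds_rlt (s : State) (e f : RExp) :
    (BExp.rlt e f).holds s ↔ e.eval s < f.eval s := Iff.rfl
@[simp] theorem holds_not (s : State) (b : BExp) : (BExp.not b).holds s ↔ ¬ b.holds s := Iff.rfl
@[simp] theorem holds_and (s : State) (b c : BExp) :
    (BExp.and b c).holds s ↔ b.holds s ∧ c.holds s := Iff.rfl

/-! ### Points, and bisection -/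

/-- The point with given coordinate expressions. -/
structure PExp where
  x : RExp
  y : RExp

def PExp.eval (s : State) (p : PExp) : Plane := !₂[p.x.eval s, p.y.eval s]

def crossExp (p q r : PExp) : RExp :=
  .sub (.mul (.sub q.x p.x) (.sub r.y p.y)) (.mul (.sub q.y p.y) (.sub r.x p.x))

@[simp] theorem eval_crossExp (s : State) (p q r : PExp) :
    (crossExp p q r).eval s = cross (p.eval s) (q.eval s) (r.eval s) := by
  simp [crossExp, cross, PExp.eval]

/-- Bisection: the integer variables `lo` and `hi` bracket the result, `mid` is the variable that
the test `b` refers to. -/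
def bisect (lo hi mid : ℕ) (b : BExp) : Program :=
  .loop (.ilt (.const 1) (.sub (ivar hi) (ivar lo)))
    (.seq (setIvar mid (.add (ivar lo) (.half (.sub (ivar hi) (ivar lo)))))
      (.ite b (setIvar lo (ivar mid)) (setIvar hi (ivar mid))))

/-- The predicate `p` need not be monotone: bisection keeps `p` true at the lower end and false at
the upper end, except where an end is still the initial one. That is all a search for a local
maximum needs. The constant depends only on the program and is chosen before memory, predicate and
range. -/
theorem exists_bisect_halts {lo hi mid : ℕ} (h₁ : lo ≠ hi) (h₂ : lo ≠ mid) (h₃ : hi ≠ mid)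
    (b : BExp) :
    ∃ C : ℕ, ∀ (s : State) (p : ℕ → Prop),
      (∀ s', Frame (bisect lo hi mid b) s s' → (b.holds s' ↔ p (s'.int mid 0))) →
      s.int lo 0 < s.int hi 0 →
      ∀ N, s.int hi 0 - s.int lo 0 ≤ N →
      Halts (bisect lo hi mid b) s (C * (Nat.clog 2 N + 1)) (fun s' =>
        s'.int hi 0 = s'.int lo 0 + 1 ∧ s.int lo 0 ≤ s'.int lo 0 ∧ s'.int hi 0 ≤ s.int hi 0 ∧
        (s'.int lo 0 = s.int lo 0 ∨ p (s'.int lo 0)) ∧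
        (s'.int hi 0 = s.int hi 0 ∨ ¬ p (s'.int hi 0))) := by
  set body : Program := .seq (setIvar mid (.add (ivar lo) (.half (.sub (ivar hi) (ivar lo)))))
      (.ite b (setIvar lo (ivar mid)) (setIvar hi (ivar mid))) with hbody
  refine ⟨body.bound + (BExp.ilt (.const 1) (.sub (ivar hi) (ivar lo))).cost + 1,
    fun s p hb hlt N hN => ?_⟩
  have hfree : body.LoopFree := ⟨trivial, trivial, trivial⟩
  have key := Halts.loop (b := .ilt (.const 1) (.sub (ivar hi) (ivar lo))) (c := body)
    (T := body.bound)
    (fun s' => Frame (bisect lo hi mid b) s s' ∧ s'.int lo 0 < s'.int hi 0 ∧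
      s.int lo 0 ≤ s'.int lo 0 ∧ s'.int hi 0 ≤ s.int hi 0 ∧
        (s'.int lo 0 = s.int lo 0 ∨ p (s'.int lo 0)) ∧
        (s'.int hi 0 = s.int hi 0 ∨ ¬ p (s'.int hi 0)))
    (fun s' => Nat.clog 2 (s'.int hi 0 - s'.int lo 0)) ?_ (s := s)
    ⟨⟨fun _ _ => rfl, fun _ _ => rfl⟩, hlt, le_rfl, le_rfl, .inl rfl, .inl rfl⟩
    (N := Nat.clog 2 N) (Nat.clog_mono_right 2 hN)
  · refine Halts.mono key (by rw [mul_comm]) ?_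
    rintro s' ⟨⟨-, h1, h2, h3, h4, h5⟩, h6⟩
    simp at h6
    exact ⟨by omega, h2, h3, h4, h5⟩
  · rintro s' ⟨hf, h1, h2, h3, h4, h5⟩ h6
    simp at h6
    have := (hfree.halts (s := s') (Q := fun s'' => s'' = body.exec s') rfl).frame
    refine this.mono le_rfl ?_
    rintro s'' ⟨rfl, hf'⟩
    have hfr : Frame (bisect lo hi mid b) s (body.exec s') :=
      ⟨fun k hk => (hf'.1 k hk).trans (hf.1 k hk), fun k hk => (hf'.2 k hk).trans (hf.2 k hk)⟩
    set M := s'.int lo 0 + (s'.int hi 0 - s'.int lo 0) / 2 with hM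
    have hfm : Frame (bisect lo hi mid b) s (s'.setInt mid 0 M) := by
      refine ⟨fun k hk => ?_, fun k hk => hf.2 k hk⟩
      rw [← hf.1 k hk]
      have hne : k ≠ mid := by
        rintro rfl
        exact hk (.inl rfl)
      simp [State.setInt, hne]
    have hbm := hb _ hfm
    simp only [State.setInt_int, true_and, and_self, if_true] at hbm
    -- Either remaining part has at most half the length, rounded up, and this is the recursion of
    -- `Nat.clog 2`; it makes `Nat.clog 2` of the length a variant.
    have hclog : ∀ d, d ≤ (s'.int hi 0 - s'.int lo 0 + 1) / 2 →
        Nat.clog 2 d < Nat.clog 2 (s'.int hi 0 - s'.int lo 0) := by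
      intro d hd
      rw [Nat.clog_of_two_le (b := 2) (n := s'.int hi 0 - s'.int lo 0) (by norm_num) (by omega)]
      exact Nat.lt_succ_of_le (Nat.clog_mono_right 2 hd)
    by_cases hp : p M
    · have hex : body.exec s' = (s'.setInt mid 0 M).setInt lo 0 M := by
        simp [hbody, Program.exec, ← hM, hbm.2 hp, State.setInt_int]
      refine ⟨⟨hfr, ?_⟩, ?_⟩
      · rw [hex]
        simp only [State.setInt_int, h1, h₁, h₁.symm, h₂, h₃, h₂.symm, h₃.symm, true_and,
          and_self, if_true, false_and, if_false]
        exact ⟨by omega, by omega, h3, .inr hp, h5⟩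
      · rw [hex]
        simp only [State.setInt_int, h1, h₁, h₁.symm, h₂, h₃, h₂.symm, h₃.symm, true_and,
          and_self, if_true, false_and, if_false]
        exact hclog _ (by omega)
    · have hex : body.exec s' = (s'.setInt mid 0 M).setInt hi 0 M := by
        simp [hbody, Program.exec, ← hM, hbm, hp, State.setInt_int]
      refine ⟨⟨hfr, ?_⟩, ?_⟩
      · rw [hex]
        simp only [State.setInt_int, h1, h₁, h₁.symm, h₂, h₃, h₂.symm, h₃.symm, true_and,
          and_self, if_true, false_and, if_false]
        exact ⟨by omega, h2, by omega, h4, .inr hp⟩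
      · rw [hex]
        simp only [State.setInt_int, h1, h₁, h₁.symm, h₂, h₃, h₂.symm, h₃.symm, true_and,
          and_self, if_true, false_and, if_false]
        exact hclog _ (by omega)

end RealRAM

/-! ### Convex polygons as sequences of points -/

theorem cross_rotate (p q r : Plane) : cross q r p = cross p q r := by
  simp only [cross]; ring

theorem cross_swap (p q r : Plane) : cross q p r = -cross p q r := by
  simp only [cross]; ring

@[simp] theorem cross_self_right (p q : Plane) : cross p q q = 0 := by
  simp only [cross]; ring

@[simp] theorem cross_self_outer (p q : Plane) : cross p q p = 0 := by
  simp only [cross]; ring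

theorem cross_combo (p q x y : Plane) {s t : ℝ} (h : s + t = 1) :
    cross p q (s • x + t • y) = s * cross p q x + t * cross p q y := by
  obtain rfl : t = 1 - s := by linarith
  simp only [cross, PiLp.add_apply, PiLp.smul_apply, smul_eq_mul]; ring

theorem convex_le_cross (p q : Plane) (k : ℝ) : Convex ℝ {x | k ≤ cross p q x} := by
  intro x hx y hy s t hs ht hst
  simp only [Set.mem_ofPred_eq] at *
  rw [cross_combo _ _ _ _ hst]
  calc k = s * k + t * k := by rw [← add_mul, hst, one_mul]
    _ ≤ _ := by gcongr

theorem plane_ext {x y : Plane} (h₀ : x 0 = y 0) (h₁ : x 1 = y 1) : x = y := by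
  ext i
  fin_cases i
  · exact h₀
  · exact h₁

/-- The barycentric coordinates of `x` in the triangle `c u v` are the signed areas of the three
subtriangles divided by the whole. -/
theorem Convex.mem_of_cross {Q : Set Plane} (hQ : Convex ℝ Q) {c u v x : Plane} (hc : c ∈ Q)
    (hu : u ∈ Q) (hv : v ∈ Q) (h : 0 < cross c u v) (h₁ : 0 ≤ cross c u x)
    (h₂ : 0 ≤ cross v c x) (h₃ : 0 ≤ cross u v x) : x ∈ Q := by
  have hsum : cross u v x + cross v c x + cross c u x = cross c u v := by
    simp only [cross]; ring
  have hne := h.ne'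
  have key : x = (cross u v x / cross c u v) • c + (cross v c x / cross c u v) • u
      + (cross c u x / cross c u v) • v := by
    apply plane_ext <;>
    · simp only [PiLp.add_apply, PiLp.smul_apply, smul_eq_mul]
      field_simp
      simp only [cross]
      ring
  rw [key]
  have := hQ.sum_mem (t := (Finset.univ : Finset (Fin 3)))
    (w := ![cross u v x / cross c u v, cross v c x / cross c u v, cross c u x / cross c u v])
    (z := ![c, u, v]) ?_ ?_ ?_
  · simpa [Fin.sum_univ_three] using this
  · intro i _
    fin_cases i <;> simp <;> positivity
  · simp [Fin.sum_univ_three, ← add_div, hsum, hne]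
  · intro i _
    fin_cases i <;> simpa

/-- The first `K` points of `S` are the vertices of a strictly convex polygon in counterclockwise
order. -/
def CCW (S : ℕ → Plane) (K : ℕ) : Prop :=
  ∀ i j k, i < j → j < k → k < K → 0 < cross (S i) (S j) (S k)

/-- The convex hull of the first `K` points of `S`. -/
def hull (S : ℕ → Plane) (K : ℕ) : Set Plane := convexHull ℝ (S '' Set.Iio K)

theorem convex_hull' (S : ℕ → Plane) (K : ℕ) : Convex ℝ (hull S K) := convex_convexHull ℝ _

theorem mem_hull {S : ℕ → Plane} {K i : ℕ} (hi : i < K) : S i ∈ hull S K :=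
  subset_convexHull ℝ _ ⟨i, hi, rfl⟩

theorem hull_subset {S : ℕ → Plane} {K : ℕ} {Q : Set Plane} (hQ : Convex ℝ Q)
    (h : ∀ i < K, S i ∈ Q) : hull S K ⊆ Q := by
  unfold hull
  refine hQ.convexHull_subset_iff.2 ?_
  rintro _ ⟨i, hi, rfl⟩
  exact h i hi

theorem isCompact_hull (S : ℕ → Plane) (K : ℕ) : IsCompact (hull S K) :=
  Set.Finite.isCompact_convexHull (𝕜 := ℝ) ((Set.finite_Iio K).image S)

theorem CCW.cross_edge_nonneg {S : ℕ → Plane} {K : ℕ} (h : CCW S K) {i : ℕ} (hi : i + 1 < K)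
    {x : Plane} (hx : x ∈ hull S K) : 0 ≤ cross (S i) (S (i + 1)) x := by
  refine hull_subset (convex_le_cross _ _ 0) (fun k hk => ?_) hx
  simp only [Set.mem_ofPred_eq]
  rcases lt_trichotomy k i with hki | rfl | hki
  · rw [cross_rotate]
    exact (h k i (i + 1) hki (by omega) hi).le
  · simp
  · rcases Nat.lt_or_ge (i + 1) k with h' | h'
    · exact (h i (i + 1) k (by omega) h' hk).le
    · obtain rfl : k = i + 1 := by omega
      simp

theorem CCW.cross_closing_nonneg {S : ℕ → Plane} {K : ℕ} (h : CCW S K)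
    {x : Plane} (hx : x ∈ hull S K) : 0 ≤ cross (S (K - 1)) (S 0) x := by
  refine hull_subset (convex_le_cross _ _ 0) (fun k hk => ?_) hx
  simp only [Set.mem_ofPred_eq]
  rcases Nat.eq_zero_or_pos k with rfl | h0
  · simp
  rcases Nat.lt_or_ge k (K - 1) with h' | h'
  · have := h 0 k (K - 1) h0 h' (by omega)
    rw [← cross_rotate, ← cross_rotate] at this
    exact this.le
  · obtain rfl : k = K - 1 := by omega
    simp

/-- Every point in the wedge at `S 0` lies in one of the wedges of the fan triangulation. -/
theorem exists_fan_wedge {S : ℕ → Plane} {K : ℕ} (hK : 3 ≤ K) {x : Plane}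
    (h₁ : 0 ≤ cross (S 0) (S 1) x) (h₂ : 0 ≤ cross (S (K - 1)) (S 0) x) :
    ∃ j, 1 ≤ j ∧ j + 1 < K ∧ 0 ≤ cross (S 0) (S j) x ∧ cross (S 0) (S (j + 1)) x ≤ 0 := by
  -- A discrete intermediate value argument: `cross (S 0) (S j) x` starts nonnegative at `j = 1` and
  -- ends nonpositive at `j = K - 1`.
  by_contra! hcon
  have : ∀ j, 1 ≤ j → j + 1 < K → 0 < cross (S 0) (S (j + 1)) x := by
    intro j hj
    induction j, hj using Nat.le_induction with
    | base => exact fun hlt => hcon 1 le_rfl hlt h₁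
    | succ j hj ih => exact fun hlt => hcon _ (by omega) hlt (ih (by omega)).le
  have h3 := this (K - 2) (by omega) (by omega)
  rw [show K - 2 + 1 = K - 1 by omega] at h3
  rw [cross_swap] at h₂
  linarith

theorem CCW.mem_hull_of_fan {S : ℕ → Plane} {K : ℕ} (h : CCW S K) {x : Plane} {j : ℕ}
    (hj : 1 ≤ j) (hjK : j + 1 < K) (h₁ : 0 ≤ cross (S 0) (S j) x)
    (h₂ : cross (S 0) (S (j + 1)) x ≤ 0) (h₃ : 0 ≤ cross (S j) (S (j + 1)) x) :
    x ∈ hull S K := by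
  refine (convex_hull' S K).mem_of_cross (mem_hull (i := 0) (by omega)) (mem_hull (i := j)
    (by omega)) (mem_hull hjK) (h 0 j (j + 1) (by omega) (by omega) hjK) h₁ ?_ h₃
  rw [cross_swap]
  linarith

/-- The point falls into one wedge of the fan at `S 0`, and the edge that closes this wedge cuts off
a triangle of the fan. -/
theorem CCW.mem_hull_of_edges {S : ℕ → Plane} {K : ℕ} (h : CCW S K) (hK : 3 ≤ K) {x : Plane}
    (h₁ : ∀ i, i + 1 < K → 0 ≤ cross (S i) (S (i + 1)) x)
    (h₂ : 0 ≤ cross (S (K - 1)) (S 0) x) : x ∈ hull S K := by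
  obtain ⟨j, hj, hjK, h3, h4⟩ := exists_fan_wedge hK (h₁ 0 (by omega)) h₂
  exact h.mem_hull_of_fan hj hjK h3 h4 (h₁ j hjK)

theorem CCW.comp {S : ℕ → Plane} {K n : ℕ} (h : CCW S n) {κ : ℕ → ℕ}
    (hκ : ∀ i j, i < j → j < K → κ i < κ j) (hn : ∀ i < K, κ i < n) :
    CCW (fun i => S (κ i)) K :=
  fun i j k hij hjk hk => h _ _ _ (hκ i j hij (by omega)) (hκ j k hjk hk) (hn k hk)

/-- A cyclic shift of a convex polygon, in a sequence that repeats the vertices. -/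
theorem CCW.shift {S : ℕ → Plane} {K : ℕ} (h : CCW S K) (hper : ∀ i < K, S (i + K) = S i)
    {d : ℕ} (hd : d < K) : CCW (fun i => S (d + i)) K := by
  have hS : ∀ i < K, ¬ d + i < K → S (d + i) = S (d + i - K) := by
    intro i hi hlt
    rw [← hper (d + i - K) (by omega)]
    congr 1
    omega
  intro i j k hij hjk hk
  show 0 < cross (S (d + i)) (S (d + j)) (S (d + k))
  by_cases h1 : d + k < K
  · exact h _ _ _ (by omega) (by omega) h1
  rw [hS k hk h1]
  by_cases h2 : d + j < K
  · have := h (d + k - K) (d + i) (d + j) (by omega) (by omega) h2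
    rwa [← cross_rotate] at this
  rw [hS j (by omega) h2]
  by_cases h3 : d + i < K
  · have := h (d + j - K) (d + k - K) (d + i) (by omega) (by omega) h3
    rwa [← cross_rotate, ← cross_rotate] at this
  rw [hS i (by omega) h3]
  exact h _ _ _ (by omega) (by omega) (by omega)

theorem hull_shift {S : ℕ → Plane} {K : ℕ} (hper : ∀ i < K, S (i + K) = S i)
    {d : ℕ} (hd : d < K) : hull (fun i => S (d + i)) K = hull S K := by
  apply Set.Subset.antisymm
  · refine hull_subset (convex_hull' _ _) fun i hi => ?_
    by_cases h : d + i < K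
    · exact mem_hull h
    · show S (d + i) ∈ _
      rw [show d + i = (d + i - K) + K by omega, hper _ (by omega)]
      exact mem_hull (by omega)
  · refine hull_subset (convex_hull' _ _) fun i hi => ?_
    by_cases h : d ≤ i
    · have := mem_hull (S := fun i => S (d + i)) (K := K) (i := i - d) (by omega)
      simpa [h] using this
    · have := mem_hull (S := fun i => S (d + i)) (K := K) (i := i + K - d) (by omega)
      rwa [show d + (i + K - d) = i + K by omega, hper i hi] at this

/-! ### Triangles of a given shape -/

/-- Multiplication of a vector by the complex number `a + bi`. -/
def cmul (a b : ℝ) (w : Plane) : Plane := !₂[a * w 0 - b * w 1, b * w 0 + a * w 1]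

@[simp] theorem cmul_zero' (a b : ℝ) (w : Plane) : cmul a b w 0 = a * w 0 - b * w 1 := rfl
@[simp] theorem cmul_one' (a b : ℝ) (w : Plane) : cmul a b w 1 = b * w 0 + a * w 1 := rfl

/-- The square of the length. -/
def nsq (w : Plane) : ℝ := w 0 ^ 2 + w 1 ^ 2

theorem nsq_nonneg (w : Plane) : 0 ≤ nsq w := by
  unfold nsq; positivity

theorem nsq_pos {w : Plane} (h : w ≠ 0) : 0 < nsq w := by
  by_contra hc
  unfold nsq at hc
  apply h
  apply plane_ext <;> simp <;> nlinarith [sq_nonneg (w 0), sq_nonneg (w 1)]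

/-- The parallelogram law serves as strict convexity: if `nsq` is at most `nsq w` at both `w + d`
and `w - d`, then `d = 0`. Both extremality arguments rest on this. -/
theorem nsq_add_nsq_sub (w d : Plane) : nsq (w + d) + nsq (w - d) = 2 * nsq w + 2 * nsq d := by
  simp only [nsq, PiLp.add_apply, PiLp.sub_apply]; ring

theorem cross_cmul (a b : ℝ) (p w : Plane) : cross p (p + w) (p + cmul a b w) = b * nsq w := by
  simp only [cross, PiLp.add_apply, cmul_zero', cmul_one', nsq]; ring

/-- A point of a convex set that is not extreme is the midpoint of a segment in the set. -/
theorem exists_ne_zero_of_not_mem_extremePoints {Q : Set Plane} (hQ : Convex ℝ Q) {x : Plane}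
    (hx : x ∈ Q) (h : x ∉ Q.extremePoints ℝ) :
    ∃ d : Plane, d ≠ 0 ∧ ∀ τ : ℝ, |τ| ≤ 1 → x + τ • d ∈ Q := by
  rw [mem_extremePoints_iff_left] at h
  push Not at h
  obtain ⟨y, hy, z, hz, ⟨s, t, hs, ht, hst, rfl⟩, hne⟩ := h hx
  have hyz : y ≠ z := by
    rintro rfl
    apply hne
    rw [← add_smul, hst, one_smul]
  refine ⟨(s * t) • (z - y), smul_ne_zero (by positivity) (sub_ne_zero.2 hyz.symm),
    fun τ hτ => ?_⟩
  have : s • y + t • z + τ • (s * t) • (z - y) = (s * (1 - τ * t)) • y + (t * (1 + τ * s)) • z := by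
    module
  rw [this]
  rw [abs_le] at hτ
  apply hQ hy hz
  · apply mul_nonneg hs.le
    nlinarith
  · apply mul_nonneg ht.le
    nlinarith
  · linear_combination hst

/-- Three vectors in the plane are linearly dependent, with bounded coefficients. -/
theorem exists_dependency (A B C : Plane) (hC : C ≠ 0) :
    ∃ r s t : ℝ, (r ≠ 0 ∨ s ≠ 0) ∧ |r| ≤ 1 ∧ |s| ≤ 1 ∧ |t| ≤ 1 ∧
      r • A + s • B + t • C = 0 := by
  have key : ∃ r s t : ℝ, (r ≠ 0 ∨ s ≠ 0) ∧ r • A + s • B + t • C = 0 := by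
    -- If `B` and `C` are parallel, they satisfy a relation in which `B` has coefficient |C|² ≠ 0;
    -- otherwise Cramer's rule gives `A` the nonzero coefficient det(B, C). The relation is
    -- afterwards shrunk to bound its coefficients by 1.
    by_cases h : B 0 * C 1 - B 1 * C 0 = 0
    · refine ⟨0, nsq C, -(B 0 * C 0 + B 1 * C 1), .inr (nsq_pos hC).ne', ?_⟩
      apply plane_ext
      · simp [nsq]
        linear_combination C 1 * h
      · simp [nsq]
        linear_combination -C 0 * h
    · refine ⟨B 0 * C 1 - B 1 * C 0, C 0 * A 1 - C 1 * A 0, A 0 * B 1 - A 1 * B 0, .inl h, ?_⟩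
      apply plane_ext <;> simp <;> ring
  obtain ⟨r, s, t, hne, h⟩ := key
  have hpos : 0 < 1 + |r| + |s| + |t| := by positivity
  have hb : ∀ x, |x| ≤ 1 + |r| + |s| + |t| → |(1 + |r| + |s| + |t|)⁻¹ * x| ≤ 1 := by
    intro x hx
    rw [abs_mul, abs_inv, abs_of_pos hpos, inv_mul_le_iff₀ hpos]
    linarith
  refine ⟨(1 + |r| + |s| + |t|)⁻¹ * r, (1 + |r| + |s| + |t|)⁻¹ * s, (1 + |r| + |s| + |t|)⁻¹ * t,
    ?_, hb _ ?_, hb _ ?_, hb _ ?_, ?_⟩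
  · rcases hne with h | h
    · exact .inl (mul_ne_zero (by positivity) h)
    · exact .inr (mul_ne_zero (by positivity) h)
  · linarith [abs_nonneg s, abs_nonneg t]
  · linarith [abs_nonneg r, abs_nonneg t]
  · linarith [abs_nonneg s, abs_nonneg r]
  · rw [mul_smul, mul_smul, mul_smul, ← smul_add, ← smul_add, h, smul_zero]

theorem continuous_cmul (a b : ℝ) : Continuous (cmul a b) := by
  unfold cmul
  fun_prop

theorem continuous_nsq : Continuous nsq := by
  unfold nsq
  fun_prop

/-- Among the triangles `p, p + w, p + (a + bi) w` in a convex polygon there is a largest one that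
has a corner at a vertex of the polygon. -/
theorem exists_max_triangle (S : ℕ → Plane) {K : ℕ} (hK : 0 < K) (a b : ℝ) :
    ∃ p w : Plane, p ∈ hull S K ∧ p + w ∈ hull S K ∧ p + cmul a b w ∈ hull S K ∧
      (∃ i < K, p = S i ∨ p + w = S i ∨ p + cmul a b w = S i) ∧
      ∀ p' w' : Plane, p' ∈ hull S K → p' + w' ∈ hull S K → p' + cmul a b w' ∈ hull S K →
        nsq w' ≤ nsq w := by
  set Q := hull S K with hQdef
  have hQ : Convex ℝ Q := convex_hull' S K
  have hQc : IsCompact Q := isCompact_hull S K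
  have hext : ∀ x ∈ Q.extremePoints ℝ, ∃ i < K, x = S i := by
    intro x hx
    obtain ⟨i, hi, rfl⟩ := extremePoints_convexHull_subset hx
    exact ⟨i, hi, rfl⟩
  set T : Set (Plane × Plane) := {z | z.1 ∈ Q ∧ z.1 + z.2 ∈ Q ∧ z.1 + cmul a b z.2 ∈ Q} with hT
  have hcm := continuous_cmul a b
  have hTc : IsCompact T := by
    -- Passing from (p, w) to the pair of corners (p, p + w) turns `T` into a closed subset of `Q ×ˢ
    -- Q`.
    have : T = (fun y : Plane × Plane => (y.1, y.2 - y.1)) ''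
        ((Q ×ˢ Q) ∩ {y | y.1 + cmul a b (y.2 - y.1) ∈ Q}) := by
      ext ⟨p, w⟩
      constructor
      · rintro ⟨h1, h2, h3⟩
        exact ⟨(p, p + w), ⟨⟨h1, h2⟩, by simpa using h3⟩, by simp⟩
      · rintro ⟨⟨x, y⟩, ⟨⟨h1, h2⟩, h3⟩, h4⟩
        simp only [Prod.mk.injEq] at h4
        obtain ⟨rfl, rfl⟩ := h4
        exact ⟨h1, by simpa using h2, h3⟩
    rw [this]
    refine IsCompact.image (IsCompact.inter_right (hQc.prod hQc) ?_) (by fun_prop)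
    exact hQc.isClosed.preimage (f := fun y : Plane × Plane => y.1 + cmul a b (y.2 - y.1))
      (by fun_prop)
  have hTne : T.Nonempty := by
    have h0 : S 0 ∈ Q := mem_hull hK
    have : cmul a b 0 = 0 := by apply plane_ext <;> simp
    exact ⟨(S 0, 0), h0, by simpa using h0, by simpa [this] using h0⟩
  have hf : Continuous (fun z : Plane × Plane => nsq z.2) := continuous_nsq.comp continuous_snd
  obtain ⟨z₁, hz₁, hmax⟩ := hTc.exists_isMaxOn hTne hf.continuousOn
  set M : Set (Plane × Plane) := T ∩ {z | nsq z.2 = nsq z₁.2} with hM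
  have hMc : IsCompact M := hTc.inter_right (isClosed_eq hf continuous_const)
  -- Extreme points of the set of maximizers exist by compactness alone; this set need not be
  -- convex.
  obtain ⟨⟨p, w⟩, hz⟩ := hMc.extremePoints_nonempty ⟨z₁, hz₁, rfl⟩
  obtain ⟨⟨hp, hq, hr⟩, hw⟩ := hz.1
  simp only [Set.mem_ofPred_eq] at hp hq hr hw
  have hmax' : ∀ p' w' : Plane, (p', w') ∈ T → nsq w' ≤ nsq w := by
    intro p' w' h'
    rw [hw]
    exact hmax h'
  refine ⟨p, w, hp, hq, hr, ?_, fun p' w' h1 h2 h3 => hmax' p' w' ⟨h1, h2, h3⟩⟩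
  by_contra! hcon
  obtain ⟨d₁, hd₁, h₁⟩ := exists_ne_zero_of_not_mem_extremePoints hQ hp
    (fun h => by obtain ⟨i, hi, h⟩ := hext _ h; exact (hcon i hi).1 h)
  obtain ⟨d₂, hd₂, h₂⟩ := exists_ne_zero_of_not_mem_extremePoints hQ hq
    (fun h => by obtain ⟨i, hi, h⟩ := hext _ h; exact (hcon i hi).2.1 h)
  obtain ⟨d₃, hd₃, h₃⟩ := exists_ne_zero_of_not_mem_extremePoints hQ hr
    (fun h => by obtain ⟨i, hi, h⟩ := hext _ h; exact (hcon i hi).2.2 h)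
  -- If no corner is a vertex, the corners can move both ways along d₁, d₂, d₃. Moving them with
  -- speeds r, s, t preserves the shape iff r d₁ + (a + bi)(s d₂ - r d₁) = t d₃, which is the
  -- dependency sought.
  obtain ⟨r, s, t, hne, hr1, hs1, ht1, hdep⟩ :=
    exists_dependency (d₁ - cmul a b d₁) (cmul a b d₂) (-d₃) (neg_ne_zero.2 hd₃)
  set dw : Plane := s • d₂ - r • d₁ with hdw
  have hr' : r • d₁ + cmul a b dw = t • d₃ := by
    have e₀ := congrArg (fun v : Plane => v 0) hdep
    have e₁ := congrArg (fun v : Plane => v 1) hdep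
    simp at e₀ e₁
    apply plane_ext
    · simp [hdw]; linarith
    · simp [hdw]; linarith
  have hmem : ∀ σ : ℝ, |σ| ≤ 1 → (p + σ • r • d₁, w + σ • dw) ∈ T := by
    intro σ hσ
    have hb : ∀ x : ℝ, |x| ≤ 1 → |σ * x| ≤ 1 := fun x hx => by
      rw [abs_mul]
      exact mul_le_one₀ hσ (abs_nonneg _) hx
    refine ⟨?_, ?_, ?_⟩
    · rw [smul_smul]
      exact h₁ _ (hb r hr1)
    · have : p + σ • r • d₁ + (w + σ • dw) = p + w + (σ * s) • d₂ := by rw [hdw]; module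
      simp only [this]
      exact h₂ _ (hb s hs1)
    · have e : cmul a b (w + σ • dw) = cmul a b w + σ • cmul a b dw := by
        apply plane_ext <;> simp <;> ring
      have : p + σ • r • d₁ + cmul a b (w + σ • dw) = p + cmul a b w + (σ * t) • d₃ := by
        rw [e, mul_smul, ← hr']; module
      simp only [this]
      exact h₃ _ (hb t ht1)
  have hplus := hmem 1 (by simp)
  have hminus := hmem (-1) (by simp)
  have hpar := nsq_add_nsq_sub w dw
  have hm1 := hmax' _ _ hplus
  have hm2 := hmax' _ _ hminus
  rw [one_smul] at hm1
  rw [neg_one_smul, ← sub_eq_add_neg] at hm2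
  -- Maximality in both directions forces the motion to be a translation; then (p, w) is the
  -- midpoint of two maximizers, and extremality forces r = 0 and s = 0.
  have hdw0 : dw = 0 := by
    by_contra hc
    linarith [nsq_pos hc]
  have hM1 : (p + (1 : ℝ) • r • d₁, w + (1 : ℝ) • dw) ∈ M := ⟨hplus, by simp [hdw0, hw]⟩
  have hM2 : (p + (-1 : ℝ) • r • d₁, w + (-1 : ℝ) • dw) ∈ M := ⟨hminus, by simp [hdw0, hw]⟩
  have := (mem_extremePoints_iff_left.1 hz).2 _ hM1 _ hM2
    ⟨1 / 2, 1 / 2, by norm_num, by norm_num, by norm_num, by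
      ext1 <;> simp <;> module⟩
  have hd0 : r • d₁ = 0 := by
    simpa using congrArg Prod.fst this
  have hr0 : r = 0 := (smul_eq_zero.1 hd0).resolve_right hd₁
  have hs0 : s = 0 := by
    rw [hdw, hd0, sub_zero] at hdw0
    exact (smul_eq_zero.1 hdw0).resolve_right hd₂
  exact hne.elim (fun h => h hr0) (fun h => h hs0)

/-- A convex polygon contains a nondegenerate triangle of any shape. -/
theorem CCW.exists_triangle {S : ℕ → Plane} {K : ℕ} (h : CCW S K) (hK : 3 ≤ K) (a b : ℝ) :
    ∃ p w : Plane, w ≠ 0 ∧ p ∈ hull S K ∧ p + w ∈ hull S K ∧ p + cmul a b w ∈ hull S K := by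
  have hpos := h 0 1 2 (by norm_num) (by norm_num) hK
  set u := S 1 - S 0 with hu
  set v := S 2 - S 0 with hv
  set D := cross (S 0) (S 1) (S 2) with hD
  have hD' : D = u 0 * v 1 - u 1 * v 0 := by simp [hD, cross, hu, hv]
  have hmem : ∀ x y : ℝ, 0 ≤ x → 0 ≤ y → x + y ≤ 1 → S 0 + (x • u + y • v) ∈ hull S K := by
    intro x y hx hy hxy
    refine (convex_hull' S K).mem_of_cross (mem_hull (i := 0) (by omega)) (mem_hull (i := 1)
      (by omega)) (mem_hull (i := 2) (by omega)) hpos ?_ ?_ ?_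
    · have : cross (S 0) (S 1) (S 0 + (x • u + y • v)) = y * D := by
        simp [hD, cross, hu, hv]; ring
      rw [this]; positivity
    · have : cross (S 2) (S 0) (S 0 + (x • u + y • v)) = x * D := by
        simp [hD, cross, hu, hv]; ring
      rw [this]; positivity
    · have : cross (S 1) (S 2) (S 0 + (x • u + y • v)) = (1 - x - y) * D := by
        simp [hD, cross, hu, hv]; ring
      rw [this]
      exact mul_nonneg (by linarith) hpos.le
  set l := (cmul a b u 0 * v 1 - cmul a b u 1 * v 0) / D with hl
  set k := (u 0 * cmul a b u 1 - u 1 * cmul a b u 0) / D with hk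
  have hlk : cmul a b u = l • u + k • v := by
    have hne := hpos.ne'
    apply plane_ext
    · simp only [PiLp.add_apply, PiLp.smul_apply, smul_eq_mul, hl, hk]
      field_simp
      rw [hD']; ring
    · simp only [PiLp.add_apply, PiLp.smul_apply, smul_eq_mul, hl, hk]
      field_simp
      rw [hD']; ring
  -- Scaled by τ, both side vectors have coordinates at most 1/8 in the frame `u`, `v`. Starting at
  -- the point with coordinates (1/4, 1/4), they stay inside the triangle `S 0`, `S 1`, `S 2`.
  set τ : ℝ := (8 * (1 + |l| + |k|))⁻¹ with hτ
  have hτ0 : 0 < τ := by positivity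
  have hτ1 : τ * (1 + |l| + |k|) = 1 / 8 := by rw [hτ]; field_simp
  have e1 : τ ≤ 1 / 8 := by nlinarith [mul_nonneg hτ0.le (abs_nonneg l), mul_nonneg hτ0.le (abs_nonneg k)]
  have bound : ∀ x, |x| ≤ 1 + |l| + |k| → |τ * x| ≤ 1 / 8 := by
    intro x hx
    rw [abs_mul, abs_of_pos hτ0, ← hτ1]
    gcongr
  have hu0 : u ≠ 0 := by
    intro h0
    rw [h0] at hD'
    simp at hD'
    linarith
  have b1 := abs_le.1 (bound l (by linarith [abs_nonneg k]))
  have b2 := abs_le.1 (bound k (by linarith [abs_nonneg l]))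
  refine ⟨S 0 + ((1 / 4 : ℝ) • u + (1 / 4 : ℝ) • v), τ • u, smul_ne_zero hτ0.ne' hu0, ?_, ?_, ?_⟩
  · exact hmem _ _ (by norm_num) (by norm_num) (by norm_num)
  · have : S 0 + ((1 / 4 : ℝ) • u + (1 / 4 : ℝ) • v) + τ • u =
        S 0 + ((1 / 4 + τ) • u + (1 / 4 : ℝ) • v) := by module
    rw [this]
    exact hmem _ _ (by linarith) (by norm_num) (by linarith)
  · have e : cmul a b (τ • u) = τ • cmul a b u := by
      apply plane_ext <;> simp <;> ring
    have : S 0 + ((1 / 4 : ℝ) • u + (1 / 4 : ℝ) • v) + cmul a b (τ • u) =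
        S 0 + ((1 / 4 + τ * l) • u + (1 / 4 + τ * k) • v) := by
      rw [e, hlk]; module
    rw [this]
    exact hmem _ _ (by linarith) (by linarith) (by linarith)

/-! ### Triangles with given angles -/

def det (x y : Plane) : ℝ := x 0 * y 1 - x 1 * y 0

theorem inner_plane (x y : Plane) : inner ℝ x y = x 0 * y 0 + x 1 * y 1 := by
  simp [PiLp.inner_apply, Fin.sum_univ_two]
  ring

theorem norm_sq_plane (x : Plane) : ‖x‖ ^ 2 = x 0 ^ 2 + x 1 ^ 2 := by
  rw [EuclideanSpace.norm_sq_eq]; simp [Fin.sum_univ_two]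

/-- Determinant and inner product are ‖x‖‖y‖ times the sine and cosine of the angle, so fixing the
angle means fixing their ratio. Positivity of the determinant excludes the opposite direction. In
this form the condition is polynomial in the coordinates. -/
theorem angle_eq_iff {x y : Plane} (h : 0 < det x y) {θ : ℝ} (h₀ : 0 < θ) (h₁ : θ < Real.pi) :
    InnerProductGeometry.angle x y = θ ↔
      det x y * Real.cos θ = (x 0 * y 0 + x 1 * y 1) * Real.sin θ := by
  have hs := Real.sin_pos_of_pos_of_lt_pi h₀ h₁
  have hx := norm_sq_plane x
  have hy := norm_sq_plane y
  have hcos := InnerProductGeometry.cos_angle_mul_norm_mul_norm x y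
  rw [inner_plane] at hcos
  have hlag : (‖x‖ * ‖y‖) ^ 2 = (x 0 * y 0 + x 1 * y 1) ^ 2 + det x y ^ 2 := by
    rw [mul_pow, hx, hy, det]; ring
  have htrig := Real.sin_sq_add_cos_sq θ
  have hn : 0 ≤ ‖x‖ * ‖y‖ := by positivity
  constructor
  · rintro hθ
    rw [hθ] at hcos
    have : det x y = ‖x‖ * ‖y‖ * Real.sin θ := by
      refine (pow_left_inj₀ h.le (by positivity) (two_ne_zero)).1 ?_
      rw [← hcos] at hlag
      linear_combination -hlag - (‖x‖ * ‖y‖) ^ 2 * htrig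
    rw [this, ← hcos]; ring
  · intro he
    have hρ : det x y / Real.sin θ = ‖x‖ * ‖y‖ := by
      refine (pow_left_inj₀ (by positivity) hn (two_ne_zero)).1 ?_
      rw [hlag, div_pow, div_eq_iff (by positivity)]
      linear_combination (-det x y ^ 2) * htrig +
        (det x y * Real.cos θ + (x 0 * y 0 + x 1 * y 1) * Real.sin θ) * he
    have hpos : 0 < ‖x‖ * ‖y‖ := hρ ▸ div_pos h hs
    apply Real.injOn_cos ⟨InnerProductGeometry.angle_nonneg _ _,
      InnerProductGeometry.angle_le_pi _ _⟩ ⟨h₀.le, h₁.le⟩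
    have h2 : ‖x‖ * ‖y‖ * Real.cos θ = x 0 * y 0 + x 1 * y 1 := by
      rw [← hρ]; field_simp; linear_combination he
    have h3 : (‖x‖ * ‖y‖) * Real.cos (InnerProductGeometry.angle x y) =
      (‖x‖ * ‖y‖) * Real.cos θ := by rw [h2, ← hcos]; ring
    exact mul_left_cancel₀ hpos.ne' h3

/-- A triangle has angles `α` and `β` iff the side `pr` is obtained from the side `pq` by
multiplication with a certain complex number. -/
theorem isABTriangle_iff {α β : ℝ} (hα : 0 < α) (hβ : 0 < β) (hαβ : α + β < Real.pi)
    {p q r : Plane} {σ a b : ℝ} (hσ : σ = Real.sin α * Real.cos β + Real.cos α * Real.sin β)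
    (ha : a = Real.cos α * Real.sin β / σ) (hb : b = Real.sin α * Real.sin β / σ) :
    IsABTriangle α β p q r ↔ 0 < cross p q r ∧ r = p + cmul a b (q - p) := by
  unfold IsABTriangle
  refine and_congr_right fun hc => ?_
  have hsα := Real.sin_pos_of_pos_of_lt_pi hα (by linarith)
  have hsβ := Real.sin_pos_of_pos_of_lt_pi hβ (by linarith)
  have hσ0 : 0 < σ := by
    rw [hσ, ← Real.sin_add]
    exact Real.sin_pos_of_pos_of_lt_pi (by linarith) hαβ
  have e1 : EuclideanGeometry.angle r p q = InnerProductGeometry.angle (q - p) (r - p) := by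
    rw [InnerProductGeometry.angle_comm]; rfl
  have e2 : EuclideanGeometry.angle p q r = InnerProductGeometry.angle (r - q) (p - q) := by
    rw [InnerProductGeometry.angle_comm]; rfl
  have d1 : det (q - p) (r - p) = cross p q r := by simp [det, cross]
  have d2 : det (r - q) (p - q) = cross p q r := by simp [det, cross]; ring
  rw [e1, e2, angle_eq_iff (d1 ▸ hc) hα (by linarith), angle_eq_iff (d2 ▸ hc) hβ (by linarith),
    d1, d2]
  set D := cross p q r with hD
  have hDe : D = (q 0 - p 0) * (r 1 - p 1) - (q 1 - p 1) * (r 0 - p 0) := rfl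
  simp only [PiLp.sub_apply]
  set N := (q 0 - p 0) ^ 2 + (q 1 - p 1) ^ 2 with hN
  have hN0 : 0 < N := by
    by_contra hcon
    have h0 : q 0 - p 0 = 0 := by nlinarith [sq_nonneg (q 0 - p 0), sq_nonneg (q 1 - p 1)]
    have h1 : q 1 - p 1 = 0 := by nlinarith [sq_nonneg (q 0 - p 0), sq_nonneg (q 1 - p 1)]
    rw [hDe, h0, h1] at hc
    simp at hc
  constructor
  · rintro ⟨h1, h2⟩
    -- The inner products in the two angle equations add up to `N`; weighting the equations by sin β
    -- and sin α therefore gives D σ = N sin α sin β.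
    have hDb : D = N * b := by
      rw [hb, mul_div_assoc', eq_div_iff hσ0.ne', hσ]
      linear_combination Real.sin β * h1 + Real.sin α * h2
    have hIa : (q 0 - p 0) * (r 0 - p 0) + (q 1 - p 1) * (r 1 - p 1) = N * a := by
      apply mul_right_cancel₀ hsα.ne'
      rw [← h1, hDb, ha, hb]; ring
    apply plane_ext
    · simp only [PiLp.add_apply, cmul_zero', PiLp.sub_apply]
      apply mul_left_cancel₀ hN0.ne'
      linear_combination (q 0 - p 0) * hIa - (q 1 - p 1) * hDb + (q 1 - p 1) * hDe + (r 0 - p 0) * hN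
    · simp only [PiLp.add_apply, cmul_one', PiLp.sub_apply]
      apply mul_left_cancel₀ hN0.ne'
      linear_combination (q 1 - p 1) * hIa + (q 0 - p 0) * hDb - (q 0 - p 0) * hDe + (r 1 - p 1) * hN
  · intro hr
    have r0 : r 0 = p 0 + (a * (q 0 - p 0) - b * (q 1 - p 1)) := by
      conv_lhs => rw [hr]
      simp
    have r1 : r 1 = p 1 + (b * (q 0 - p 0) + a * (q 1 - p 1)) := by
      conv_lhs => rw [hr]
      simp
    have h1 : b * Real.cos α = a * Real.sin α := by rw [ha, hb]; ring
    have h2 : b * Real.cos β = (1 - a) * Real.sin β := by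
      rw [ha, hb]; field_simp; rw [hσ]; ring
    have hDb : D = N * b := by rw [hDe, r0, r1, hN]; ring
    refine ⟨?_, ?_⟩
    · rw [hDb, r0, r1]
      linear_combination N * h1
    · rw [hDb, r0, r1]
      linear_combination N * h2

/-- Relabelling the corners cyclically. -/
theorem cmul_cycle {a b : ℝ} (hb : 0 < b) {p q r : Plane} :
    r = p + cmul a b (q - p) ↔
      p = q + cmul ((1 - a) / ((1 - a) ^ 2 + b ^ 2)) (b / ((1 - a) ^ 2 + b ^ 2)) (r - q) := by
  -- With z = a + bi, r - q = (z - 1)(q - p), hence p - q = (r - q)/(1 - z); the new shape is the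
  -- complex number 1/(1 - z), written with real denominator.
  have hD : (1 - a) ^ 2 + b ^ 2 ≠ 0 := by positivity
  constructor
  · rintro rfl
    apply plane_ext <;> simp <;> field_simp <;> ring
  · intro h
    have e₀ := congrArg (fun v : Plane => v 0) h
    have e₁ := congrArg (fun v : Plane => v 1) h
    simp at e₀ e₁
    field_simp at e₀ e₁
    apply plane_ext
    · simp
      apply mul_left_cancel₀ hD
      linear_combination (a - 1) * e₀ - b * e₁
    · simp
      apply mul_left_cancel₀ hD
      linear_combination b * e₀ + (a - 1) * e₁

/-! ### The farthest point of a planar polytope -/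

/-- The linear inequality `A x + B y + E ≥ 0`. -/
structure Lin where
  A : ℝ
  B : ℝ
  E : ℝ

def Lin.val (g : Lin) (w : Plane) : ℝ := g.A * w 0 + g.B * w 1 + g.E

/-- The common boundary point of two half-planes. -/
def Lin.meet (g h : Lin) : Plane :=
  !₂[(g.B * h.E - h.B * g.E) / (g.A * h.B - h.A * g.B),
    (h.A * g.E - g.A * h.E) / (g.A * h.B - h.A * g.B)]

theorem Lin.continuous_val (g : Lin) : Continuous g.val := by
  unfold Lin.val
  fun_prop

theorem Lin.eq_meet {g h : Lin} {w : Plane} (hg : g.val w = 0) (hh : h.val w = 0)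
    (hne : g.A * h.B - h.A * g.B ≠ 0) : w = g.meet h := by
  unfold Lin.val at hg hh
  apply plane_ext
  · simp only [Lin.meet, PiLp.toLp_apply, Matrix.cons_val_zero]
    rw [eq_div_iff hne]
    linear_combination h.B * hg - g.B * hh
  · simp only [Lin.meet, PiLp.toLp_apply, Matrix.cons_val_one, Matrix.cons_val_fin_one]
    rw [eq_div_iff hne]
    linear_combination g.A * hh - h.A * hg

/-- A maximizer of the strictly convex function `nsq` is a vertex of the region: if the constraints
tight there were all parallel, one could move both ways along them and the parallelogram law would
give a larger value. -/
theorem Lin.exists_meet_ge {ι : Type*} [Finite ι] (g : ι → Lin)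
    (hG : IsCompact {w | ∀ i, 0 ≤ (g i).val w}) {w : Plane} (hw : ∀ i, 0 ≤ (g i).val w) :
    ∃ i k, (∀ l, 0 ≤ (g l).val ((g i).meet (g k))) ∧ nsq w ≤ nsq ((g i).meet (g k)) := by
  obtain ⟨z, hz, hmax⟩ := hG.exists_isMaxOn ⟨w, hw⟩ continuous_nsq.continuousOn
  by_cases hdet : ∃ i k, (g i).val z = 0 ∧ (g k).val z = 0 ∧
      (g i).A * (g k).B - (g k).A * (g i).B ≠ 0
  · obtain ⟨i, k, h1, h2, h3⟩ := hdet
    rw [Lin.eq_meet h1 h2 h3] at hz hmax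
    exact ⟨i, k, hz, hmax hw⟩
  exfalso
  push Not at hdet
  -- Some tight constraint with nonzero normal supplies the direction of its boundary line, to which
  -- every other tight constraint is parallel; if there is none, any direction will do.
  obtain ⟨d, hd, hdt⟩ : ∃ d : Plane, d ≠ 0 ∧ ∀ i, (g i).val z = 0 →
      (g i).A * d 0 + (g i).B * d 1 = 0 := by
    by_cases h : ∃ i, (g i).val z = 0 ∧ ((g i).A ≠ 0 ∨ (g i).B ≠ 0)
    · obtain ⟨i, hi, hne⟩ := h
      refine ⟨!₂[-(g i).B, (g i).A], ?_, fun k hk => ?_⟩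
      · intro h0
        have e₀ := congrArg (fun v : Plane => v 0) h0
        have e₁ := congrArg (fun v : Plane => v 1) h0
        simp at e₀ e₁
        exact hne.elim (fun h => h e₁) (fun h => h e₀)
      · have := hdet i k hi hk
        simp
        linarith
    · push Not at h
      refine ⟨!₂[1, 0], ?_, fun k hk => ?_⟩
      · intro h0
        have e₀ := congrArg (fun v : Plane => v 0) h0
        simp at e₀
      · simp [(h k hk).1]
  have hev : ∀ᶠ τ : ℝ in nhds 0, ∀ i, 0 ≤ (g i).val (z + τ • d) := by
    rw [Filter.eventually_all]
    intro i
    have hval : ∀ τ : ℝ, (g i).val (z + τ • d) =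
        (g i).val z + τ * ((g i).A * d 0 + (g i).B * d 1) := by
      intro τ
      simp [Lin.val]; ring
    rcases (hz i).eq_or_lt with h | h
    · refine Filter.Eventually.of_forall fun τ => ?_
      rw [hval, hdt i h.symm, ← h]
      simp
    · have hc : Continuous fun τ : ℝ => (g i).val (z + τ • d) :=
        (g i).continuous_val.comp (by fun_prop)
      have := hc.continuousAt (x := 0)
      have h0 : 0 < (g i).val (z + (0 : ℝ) • d) := by simpa using h
      exact (this.eventually (lt_mem_nhds h0)).mono fun _ h => h.le
  obtain ⟨ε, hε, hball⟩ := Metric.eventually_nhds_iff.1 hev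
  have m1 := hmax (hball (y := ε / 2) (by simp [abs_of_pos hε]; linarith))
  have m2 := hmax (hball (y := -(ε / 2)) (by simp [abs_of_pos hε]; linarith))
  have hpar := nsq_add_nsq_sub z ((ε / 2) • d)
  have hpos := nsq_pos (smul_ne_zero (half_pos hε).ne' hd)
  simp only [Set.mem_ofPred_eq] at m1 m2
  rw [neg_smul, ← sub_eq_add_neg] at m2
  linarith

/-- The wedge with apex `c` cut off by the line `pq`, as a set of vectors from `c`. -/
def wedgeLin (c p q : Plane) : Fin 3 → Lin :=
  ![⟨-(p 1 - c 1), p 0 - c 0, 0⟩, ⟨q 1 - c 1, -(q 0 - c 0), 0⟩,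
    ⟨-(q 1 - p 1), q 0 - p 0, cross p q c⟩]

theorem wedgeLin_nonneg {c p q w : Plane} : (∀ i, 0 ≤ (wedgeLin c p q i).val w) ↔
    0 ≤ cross c p (c + w) ∧ cross c q (c + w) ≤ 0 ∧ 0 ≤ cross p q (c + w) := by
  have h0 : (wedgeLin c p q 0).val w = cross c p (c + w) := by
    simp [wedgeLin, Lin.val, cross]; ring
  have h1 : (wedgeLin c p q 1).val w = -cross c q (c + w) := by
    simp [wedgeLin, Lin.val, cross]; ring
  have h2 : (wedgeLin c p q 2).val w = cross p q (c + w) := by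
    simp [wedgeLin, Lin.val, cross]; ring
  constructor
  · intro h
    exact ⟨h0 ▸ h 0, by linarith [h1 ▸ h 1], h2 ▸ h 2⟩
  · rintro ⟨g0, g1, g2⟩ i
    fin_cases i
    · simpa [h0] using g0
    · simpa [h1] using g1
    · simpa [h2] using g2

/-- The condition `g (cmul a b w) ≥ 0` on `w`. -/
def Lin.comp (g : Lin) (a b : ℝ) : Lin := ⟨g.A * a + g.B * b, g.B * a - g.A * b, g.E⟩

theorem Lin.comp_val (g : Lin) (a b : ℝ) (w : Plane) : (g.comp a b).val w = g.val (cmul a b w) := by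
  simp [Lin.val, Lin.comp]; ring

/-- The region of those `w` for which `c + w` lies in the triangle `c p q` and `c + (a + bi) w` in
the triangle `c p' q'`, for counterclockwise triangles. -/
def pairLin (a b : ℝ) (c p q p' q' : Plane) : Fin 3 ⊕ Fin 3 → Lin :=
  Sum.elim (wedgeLin c p q) fun i => (wedgeLin c p' q' i).comp a b

theorem pairLin_nonneg {a b : ℝ} {c p q p' q' w : Plane} :
    (∀ i, 0 ≤ (pairLin a b c p q p' q' i).val w) ↔
      (0 ≤ cross c p (c + w) ∧ cross c q (c + w) ≤ 0 ∧ 0 ≤ cross p q (c + w)) ∧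
      0 ≤ cross c p' (c + cmul a b w) ∧ cross c q' (c + cmul a b w) ≤ 0 ∧
        0 ≤ cross p' q' (c + cmul a b w) := by
  rw [← wedgeLin_nonneg, ← wedgeLin_nonneg]
  simp [pairLin, Lin.comp_val]

/-! ### Sweeping a fixed angle around a vertex -/

theorem det_cmul_self (a b : ℝ) (x : Plane) : det (cmul a b x) x = -(b * nsq x) := by
  simp [det, nsq]; ring

theorem det_self_cmul (a b : ℝ) (x : Plane) : det x (cmul a b x) = b * nsq x := by
  simp [det, nsq]; ring

theorem det_swap (x y : Plane) : det x y = -det y x := by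
  simp [det]; ring

theorem cmul_combo (a b : ℝ) (x y : Plane) (s t : ℝ) :
    cmul a b (s • x + t • y) = s • cmul a b x + t • cmul a b y := by
  apply plane_ext <;> simp <;> ring

theorem det_combo_left (x y z : Plane) (s t : ℝ) :
    det (s • x + t • y) z = s * det x z + t * det y z := by
  simp [det]; ring

theorem det_combo_right (x y z : Plane) (s t : ℝ) :
    det z (s • x + t • y) = s * det z x + t * det z y := by
  simp [det]; ring

theorem eq_combo {x y : Plane} (h : det x y ≠ 0) (w : Plane) :
    w = (det w y / det x y) • x + (det x w / det x y) • y := by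
  apply plane_ext <;>
  · simp only [PiLp.add_apply, PiLp.smul_apply, smul_eq_mul]
    field_simp
    simp [det]; ring

/-- Turning preserves the order of directions: write `y` as a nonnegative combination of `x` and
`z`. The turned `z` is past `z`, so its share is nonpositive and the positive total must come from
the turned `x`. -/
theorem det_cmul_pos_of_between {a b : ℝ} (hb : 0 < b) {x y z : Plane} (hxy : 0 < det x y)
    (hyz : 0 ≤ det y z) (hxz : 0 < det x z) (h : 0 < det (cmul a b y) z) :
    0 < det (cmul a b x) z := by
  rw [eq_combo hxz.ne' y, cmul_combo, det_combo_left, det_cmul_self] at h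
  have h1 : 0 < det y z / det x z * det (cmul a b x) z := by
    have := mul_nonneg (div_nonneg hxy.le hxz.le) (mul_nonneg hb.le (nsq_nonneg z))
    linarith
  exact pos_of_mul_pos_right h1 (by positivity)

/-- `w` is a nonnegative combination of `u j - u 0` and `u (j + 1) - u 0`. -/
def InCone (u : ℕ → Plane) (j : ℕ) (w : Plane) : Prop :=
  ∃ s t : ℝ, 0 ≤ s ∧ 0 ≤ t ∧ w = s • (u j - u 0) + t • (u (j + 1) - u 0)

theorem CCW.det_pos {u : ℕ → Plane} {K : ℕ} (h : CCW u K) {i j : ℕ} (hi : 0 < i) (hij : i < j)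
    (hj : j < K) : 0 < det (u i - u 0) (u j - u 0) := by
  simpa [det, cross] using h 0 i j hi hij hj

theorem CCW.det_nonneg {u : ℕ → Plane} {K : ℕ} (h : CCW u K) {i j : ℕ} (hi : 0 < i)
    (hij : i ≤ j) (hj : j < K) : 0 ≤ det (u i - u 0) (u j - u 0) := by
  rcases hij.eq_or_lt with rfl | hij
  · simp [det, mul_comm]
  · exact (h.det_pos hi hij hj).le

theorem cross_add_eq_det (c p w : Plane) : cross c p (c + w) = det (p - c) w := by
  simp [cross, det]

theorem CCW.inCone_iff {u : ℕ → Plane} {K : ℕ} (h : CCW u K) {j : ℕ} (hj : 0 < j)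
    (hjK : j + 1 < K) {w : Plane} :
    InCone u j w ↔ 0 ≤ cross (u 0) (u j) (u 0 + w) ∧ cross (u 0) (u (j + 1)) (u 0 + w) ≤ 0 := by
  have hd := h.det_pos hj (Nat.lt_succ_self j) hjK
  rw [cross_add_eq_det, cross_add_eq_det]
  constructor
  · rintro ⟨s, t, hs, ht, rfl⟩
    rw [det_combo_right, det_combo_right, det_swap (u (j + 1) - u 0) (u j - u 0)]
    have e1 : det (u j - u 0) (u j - u 0) = 0 := by simp [det]; ring
    have e2 : det (u (j + 1) - u 0) (u (j + 1) - u 0) = 0 := by simp [det]; ring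
    rw [e1, e2]
    constructor <;> nlinarith
  · rintro ⟨h1, h2⟩
    refine ⟨_, _, ?_, ?_, eq_combo hd.ne' w⟩
    · rw [det_swap]
      exact div_nonneg (by linarith) hd.le
    · exact div_nonneg h1 hd.le

/-- Some pair of wedges of the fan with indices at least `j` and `l` contains `w` and
`(a + bi) w`. -/
def Covered (u : ℕ → Plane) (K : ℕ) (a b : ℝ) (j l : ℕ) (w : Plane) : Prop :=
  ∃ j' l', j ≤ j' ∧ l ≤ l' ∧ j' + 1 < K ∧ l' + 1 < K ∧ InCone u j' w ∧ InCone u l' (cmul a b w)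

theorem CCW.covered_of_mem {u : ℕ → Plane} {K : ℕ} (h : CCW u K) (hK : 3 ≤ K) {a b : ℝ}
    {w : Plane} (h₁ : u 0 + w ∈ hull u K) (h₂ : u 0 + cmul a b w ∈ hull u K) :
    Covered u K a b 1 1 w := by
  obtain ⟨j, hj, hjK, h3, h4⟩ := exists_fan_wedge hK (h.cross_edge_nonneg (by omega) h₁)
    (h.cross_closing_nonneg h₁)
  obtain ⟨l, hl, hlK, h5, h6⟩ := exists_fan_wedge hK (h.cross_edge_nonneg (by omega) h₂)
    (h.cross_closing_nonneg h₂)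
  exact ⟨j, l, hj, hl, hjK, hlK, (h.inCone_iff hj hjK).2 ⟨h3, h4⟩, (h.inCone_iff hl hlK).2 ⟨h5, h6⟩⟩

/-- The turned end of wedge `j` comes before the end of wedge `l`, so all of the turned wedge `j`
does. Nothing nonzero in wedge `j` can be turned into a wedge after `l`, and `j` may be discarded
once the pair (j, l) has been treated. -/
theorem CCW.covered_succ_left {u : ℕ → Plane} {K : ℕ} (h : CCW u K) {a b : ℝ} (hb : 0 < b)
    {j l : ℕ} (hj : 0 < j) (hjl : j ≤ l) (hl : l + 1 < K)
    (hT : 0 < det (cmul a b (u (j + 1) - u 0)) (u (l + 1) - u 0)) :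
    j < l ∧ ∀ w, w ≠ 0 → Covered u K a b j l w →
      (InCone u j w ∧ InCone u l (cmul a b w)) ∨ Covered u K a b (j + 1) l w := by
  have hlt : j < l := by
    rcases hjl.eq_or_lt with rfl | h'
    · rw [det_cmul_self] at hT
      have := mul_nonneg hb.le (nsq_nonneg (u (j + 1) - u 0))
      linarith
    · exact h'
  refine ⟨hlt, fun w hw => ?_⟩
  rintro ⟨j', l', h1, h2, h3, h4, h5, h6⟩
  rcases h1.eq_or_lt with rfl | h1
  swap
  · exact .inr ⟨j', l', h1, h2, h3, h4, h5, h6⟩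
  rcases h2.eq_or_lt with rfl | h2
  · exact .inl ⟨h5, h6⟩
  exfalso
  obtain ⟨s, t, hs, ht, rfl⟩ := h5
  obtain ⟨s', t', hs', ht', he⟩ := h6
  have hT' := det_cmul_pos_of_between hb (h.det_pos hj (Nat.lt_succ_self j) (by omega))
    (h.det_nonneg (by omega) (by omega) hl) (h.det_pos hj (by omega) hl) hT
  have hge : 0 ≤ det (u (l + 1) - u 0) (cmul a b (s • (u j - u 0) + t • (u (j + 1) - u 0))) := by
    rw [he, det_combo_right]
    have := h.det_nonneg (i := l + 1) (j := l') (by omega) h2 (by omega)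
    have := h.det_nonneg (i := l + 1) (j := l' + 1) (by omega) (by omega) (by omega)
    positivity
  rw [det_swap, cmul_combo, det_combo_left] at hge
  have hs0 : s = 0 := by
    rcases hs.eq_or_lt with h0 | h0
    · exact h0.symm
    · nlinarith [mul_pos h0 hT', mul_nonneg ht hT.le]
  have ht0 : t = 0 := by
    rcases ht.eq_or_lt with h0 | h0
    · exact h0.symm
    · nlinarith [mul_pos h0 hT, mul_nonneg hs hT'.le]
  exact hw (by rw [hs0, ht0]; simp)

/-- The mirror case: the turned end of wedge `j` is at or past the end of wedge `l`, so a `w` from a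
later wedge is turned into wedge `l` only if it lies on the common ray of the wedges `j` and `j +
1`, hence in wedge `j` as well. A `w` beyond wedge `l` is impossible, since turning would move it
backwards. -/
theorem CCW.covered_succ_right {u : ℕ → Plane} {K : ℕ} (h : CCW u K) {a b : ℝ} (hb : 0 < b)
    {j l : ℕ} (hj : 0 < j) (hjl : j ≤ l) (hl : l + 1 < K)
    (hT : det (cmul a b (u (j + 1) - u 0)) (u (l + 1) - u 0) ≤ 0) {w : Plane} (hw : w ≠ 0)
    (hc : Covered u K a b j l w) :
    (InCone u j w ∧ InCone u l (cmul a b w)) ∨ Covered u K a b j (l + 1) w := by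
  obtain ⟨j', l', h1, h2, h3, h4, h5, h6⟩ := hc
  rcases h2.eq_or_lt with rfl | h2
  swap
  · exact .inr ⟨j', l', h1, h2, h3, h4, h5, h6⟩
  refine .inl ⟨?_, h6⟩
  rcases h1.eq_or_lt with rfl | h1
  · exact h5
  obtain ⟨s, t, hs, ht, hwe⟩ := h5
  obtain ⟨s', t', hs', ht', he⟩ := h6
  rcases Nat.lt_or_ge l j' with hlj | hlj
  · exfalso
    have e1 : 0 ≤ det (u l - u 0) w := by
      rw [hwe, det_combo_right]
      have := h.det_nonneg (i := l) (j := j') (by omega) hlj.le (by omega)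
      have := h.det_nonneg (i := l) (j := j' + 1) (by omega) (by omega) (by omega)
      positivity
    have e2 : 0 ≤ det (u (l + 1) - u 0) w := by
      rw [hwe, det_combo_right]
      have := h.det_nonneg (i := l + 1) (j := j') (by omega) hlj (by omega)
      have := h.det_nonneg (i := l + 1) (j := j' + 1) (by omega) (by omega) (by omega)
      positivity
    have e3 := det_self_cmul a b w
    rw [he, det_combo_right, det_swap w, det_swap w] at e3
    have := mul_pos hb (nsq_pos hw)
    nlinarith [mul_nonneg hs' e1, mul_nonneg ht' e2]
  · have hpos := h.det_pos (i := j + 1) (j := l + 1) (by omega) (by omega) hl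
    have hσ : 0 ≤ det w (u (l + 1) - u 0) := by
      rw [hwe, det_combo_left]
      have := h.det_nonneg (i := j') (j := l + 1) (by omega) (by omega) (by omega)
      have := h.det_nonneg (i := j' + 1) (j := l + 1) (by omega) (by omega) (by omega)
      positivity
    have hτ : 0 ≤ det (u (j + 1) - u 0) w := by
      rw [hwe, det_combo_right]
      have := h.det_nonneg (i := j + 1) (j := j') (by omega) h1 (by omega)
      have := h.det_nonneg (i := j + 1) (j := j' + 1) (by omega) (by omega) (by omega)
      positivity
    have hm : 0 ≤ det (cmul a b w) (u (l + 1) - u 0) := by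
      rw [he, det_combo_left]
      have := h.det_nonneg (i := l) (j := l + 1) (by omega) (by omega) (by omega)
      have e0 : det (u (l + 1) - u 0) (u (l + 1) - u 0) = 0 := by simp [det]; ring
      rw [e0]
      positivity
    have hcombo := eq_combo hpos.ne' w
    set σ := det w (u (l + 1) - u 0) / det (u (j + 1) - u 0) (u (l + 1) - u 0) with hσd
    set τ := det (u (j + 1) - u 0) w / det (u (j + 1) - u 0) (u (l + 1) - u 0) with hτd
    have hσ' : 0 ≤ σ := div_nonneg hσ hpos.le
    have hτ' : 0 ≤ τ := div_nonneg hτ hpos.le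
    rw [hcombo, cmul_combo, det_combo_left, det_cmul_self] at hm
    have hne : u (l + 1) - u 0 ≠ 0 := by
      intro h0
      rw [h0] at hpos
      simp [det] at hpos
    have hτ0 : τ = 0 := by
      rcases hτ'.eq_or_lt with h0 | h0
      · exact h0.symm
      · nlinarith [mul_pos h0 (mul_pos hb (nsq_pos hne)), mul_nonneg hσ' (neg_nonneg.2 hT)]
    refine ⟨0, σ, le_rfl, hσ', ?_⟩
    rw [hcombo, hτ0]
    simp

/-- The triangles at the vertex `u 0` with the two other corners in given wedges. -/
theorem CCW.pair_subset {u : ℕ → Plane} {K : ℕ} (h : CCW u K) {a b : ℝ} {j l : ℕ} (hj : 0 < j)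
    (hjK : j + 1 < K) (hl : 0 < l) (hlK : l + 1 < K) {w : Plane}
    (hw : ∀ i, 0 ≤ (pairLin a b (u 0) (u j) (u (j + 1)) (u l) (u (l + 1)) i).val w) :
    u 0 + w ∈ hull u K ∧ u 0 + cmul a b w ∈ hull u K := by
  rw [pairLin_nonneg] at hw
  obtain ⟨⟨h1, h2, h3⟩, h4, h5, h6⟩ := hw
  exact ⟨h.mem_hull_of_fan hj hjK h1 h2 h3, h.mem_hull_of_fan hl hlK h4 h5 h6⟩

/-- What the finitely many candidates of one pair of wedges have to beat: every triangle of that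
pair is dominated by a feasible intersection of two of the six lines. -/
theorem CCW.exists_pair_meet {u : ℕ → Plane} {K : ℕ} (h : CCW u K) {a b : ℝ} {j l : ℕ}
    (hj : 0 < j) (hjK : j + 1 < K) (hl : 0 < l) (hlK : l + 1 < K) {w : Plane}
    (h₁ : u 0 + w ∈ hull u K) (h₂ : u 0 + cmul a b w ∈ hull u K) (hcj : InCone u j w)
    (hcl : InCone u l (cmul a b w)) :
    ∃ i k, (∀ i', 0 ≤ (pairLin a b (u 0) (u j) (u (j + 1)) (u l) (u (l + 1)) i').val
        ((pairLin a b (u 0) (u j) (u (j + 1)) (u l) (u (l + 1)) i).meet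
          (pairLin a b (u 0) (u j) (u (j + 1)) (u l) (u (l + 1)) k))) ∧
      nsq w ≤ nsq ((pairLin a b (u 0) (u j) (u (j + 1)) (u l) (u (l + 1)) i).meet
          (pairLin a b (u 0) (u j) (u (j + 1)) (u l) (u (l + 1)) k)) := by
  apply Lin.exists_meet_ge
  · have hc : IsCompact ((fun x => x - u 0) '' hull u K) :=
      (isCompact_hull u K).image (by fun_prop)
    refine hc.of_isClosed_subset ?_ ?_
    · have : {w | ∀ i, 0 ≤ (pairLin a b (u 0) (u j) (u (j + 1)) (u l) (u (l + 1)) i).val w} =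
          ⋂ i, {w | 0 ≤ (pairLin a b (u 0) (u j) (u (j + 1)) (u l) (u (l + 1)) i).val w} := by
        ext; simp
      rw [this]
      exact isClosed_iInter fun i => isClosed_le continuous_const (Lin.continuous_val _)
    · intro w hw
      exact ⟨u 0 + w, (h.pair_subset hj hjK hl hlK hw).1, by simp⟩
  · rw [pairLin_nonneg]
    rw [h.inCone_iff hj hjK] at hcj
    rw [h.inCone_iff hl hlK] at hcl
    exact ⟨⟨hcj.1, hcj.2, h.cross_edge_nonneg hjK h₁⟩, hcl.1, hcl.2, h.cross_edge_nonneg hlK h₂⟩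

/-! ### Chains of monotone slope -/

theorem le_of_step {φ : ℕ → ℝ} {s t : ℕ} (h : ∀ i, s ≤ i → i < t → φ i ≤ φ (i + 1)) {u v : ℕ}
    (hsu : s ≤ u) (huv : u ≤ v) (hvt : v ≤ t) : φ u ≤ φ v := by
  induction v, huv using Nat.le_induction with
  | base => exact le_rfl
  | succ v huv ih => exact (ih (by omega)).trans (h v (by omega) (by omega))

/-- The slope of edge `j - 1, j` in coordinates `P`, `R`, measured by its share in the increase of
`P + R`. -/
def edgeSlope (P R : ℕ → ℝ) (j : ℕ) : ℝ :=
  (R j - R (j - 1)) / ((P j - P (j - 1)) + (R j - R (j - 1)))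

/-- A measure for the size of the piece of the chain between `s` and `t`. -/
def deviation (P R : ℕ → ℝ) (s t : ℕ) : ℝ :=
  ((P t - P s) + (R t - R s)) ^ 2 + (edgeSlope P R t - edgeSlope P R (s + 1)) ^ 2

/-- A chain of points with coordinates `P i`, `R i` that is monotone in both coordinates and turns
counterclockwise. -/
structure ConvexChain (P R : ℕ → ℝ) (i₀ i₁ : ℕ) : Prop where
  two_le : i₀ + 2 ≤ i₁
  left_mono : ∀ i, i₀ ≤ i → i < i₁ → P i ≤ P (i + 1)
  right_mono : ∀ i, i₀ ≤ i → i < i₁ → R i ≤ R (i + 1)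
  turn : ∀ i, i₀ ≤ i → i + 1 < i₁ →
    0 < (P (i + 1) - P i) * (R (i + 2) - R (i + 1)) - (R (i + 1) - R i) * (P (i + 2) - P (i + 1))

namespace ConvexChain

variable {P R : ℕ → ℝ} {i₀ i₁ : ℕ}

theorem step_pos (h : ConvexChain P R i₀ i₁) {i : ℕ} (h₀ : i₀ ≤ i) (h₁ : i < i₁) :
    0 < (P (i + 1) - P i) + (R (i + 1) - R i) := by
  have hp := h.left_mono i h₀ h₁
  have hr := h.right_mono i h₀ h₁
  by_contra hc
  have e1 : P (i + 1) = P i := by linarith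
  have e2 : R (i + 1) = R i := by linarith
  -- An edge of length zero would make the turn at one of its ends vanish. The chain has at least
  -- two edges, so a neighbouring edge exists.
  by_cases hi : i + 1 < i₁
  · have := h.turn i h₀ hi
    rw [e1, e2] at this
    simp at this
  · obtain ⟨k, rfl⟩ : ∃ k, i = k + 1 := ⟨i - 1, by have := h.two_le; omega⟩
    have := h.turn k (by have := h.two_le; omega) h₁
    rw [e1, e2] at this
    simp at this

theorem slope_step (h : ConvexChain P R i₀ i₁) {j : ℕ} (h₀ : i₀ < j) (h₁ : j < i₁) :
    edgeSlope P R j ≤ edgeSlope P R (j + 1) := by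
  obtain ⟨i, rfl⟩ : ∃ i, j = i + 1 := ⟨j - 1, by omega⟩
  have h1 := h.step_pos (i := i) (by omega) (by omega)
  have h2 := h.step_pos (i := i + 1) (by omega) h₁
  have h3 := h.turn i (by omega) h₁
  unfold edgeSlope
  simp only [Nat.add_sub_cancel]
  rw [div_le_div_iff₀ h1 h2]
  nlinarith

theorem slope_mono (h : ConvexChain P R i₀ i₁) {j k : ℕ} (h₀ : i₀ < j) (hjk : j ≤ k)
    (h₁ : k ≤ i₁) : edgeSlope P R j ≤ edgeSlope P R k :=
  le_of_step (φ := edgeSlope P R) (s := i₀ + 1) (t := i₁) (fun i hi hi' => h.slope_step (by omega) hi') h₀ hjk h₁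

theorem slope_nonneg (h : ConvexChain P R i₀ i₁) {j : ℕ} (h₀ : i₀ < j) (h₁ : j ≤ i₁) :
    0 ≤ edgeSlope P R j := by
  obtain ⟨i, rfl⟩ : ∃ i, j = i + 1 := ⟨j - 1, by omega⟩
  have h1 := h.step_pos (i := i) (by omega) (by omega)
  have h2 := h.right_mono i (by omega) (by omega)
  unfold edgeSlope
  simp only [Nat.add_sub_cancel]
  exact div_nonneg (by linarith) h1.le

theorem slope_le_one (h : ConvexChain P R i₀ i₁) {j : ℕ} (h₀ : i₀ < j) (h₁ : j ≤ i₁) :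
    edgeSlope P R j ≤ 1 := by
  obtain ⟨i, rfl⟩ : ∃ i, j = i + 1 := ⟨j - 1, by omega⟩
  have h1 := h.step_pos (i := i) (by omega) (by omega)
  have h2 := h.left_mono i (by omega) (by omega)
  unfold edgeSlope
  simp only [Nat.add_sub_cancel]
  rw [div_le_one h1]
  linarith

theorem left_le (h : ConvexChain P R i₀ i₁) {s t : ℕ} (h₀ : i₀ ≤ s) (hst : s ≤ t) (h₁ : t ≤ i₁) :
    P s ≤ P t := le_of_step h.left_mono h₀ hst h₁

theorem right_le (h : ConvexChain P R i₀ i₁) {s t : ℕ} (h₀ : i₀ ≤ s) (hst : s ≤ t) (h₁ : t ≤ i₁) :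
    R s ≤ R t := le_of_step h.right_mono h₀ hst h₁

/-- A point of the chain is not far from the chord of a piece of small deviation. -/
theorem dist_le (h : ConvexChain P R i₀ i₁) {ε : ℝ} {s t u : ℕ} (h₀ : i₀ ≤ s) (hsu : s ≤ u)
    (hut : u ≤ t) (hst : s < t) (h₁ : t ≤ i₁) (hdev : deviation P R s t ≤ ε / 4) :
    (P u - P s) * (R t - R s) - (P t - P s) * (R u - R s) ≤
      ((P t - P s) + (R t - R s)) * (ε / 8) := by
  set τ₀ := edgeSlope P R (s + 1) with hτ₀
  set τ₁ := edgeSlope P R t with hτ₁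
  have hτ : τ₀ ≤ τ₁ := h.slope_mono (by omega) hst h₁
  have hedge : ∀ i, s ≤ i → i < t → R (i + 1) - R i =
      edgeSlope P R (i + 1) * ((P (i + 1) - P i) + (R (i + 1) - R i)) := by
    intro i hi hi'
    have h1 := h.step_pos (i := i) (by omega) (by omega)
    unfold edgeSlope
    simp only [Nat.add_sub_cancel]
    field_simp
  -- Between `s` and `t` every edge slope lies in [τ₀, τ₁]. Hence vertex `u` lies on or above the
  -- line of slope τ₀ through vertex `s`, while the chord has slope at most τ₁.
  have hlo : R s - τ₀ * (P s + R s) ≤ R u - τ₀ * (P u + R u) := by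
    refine le_of_step (φ := fun i => R i - τ₀ * (P i + R i)) (s := s) (t := t) ?_ le_rfl hsu hut
    intro i hi hi'
    have h1 := h.step_pos (i := i) (by omega) (by omega)
    have h2 := hedge i hi hi'
    have h3 := h.slope_mono (j := s + 1) (k := i + 1) (by omega) (by omega) (by omega)
    have := mul_le_mul_of_nonneg_right h3 h1.le
    linarith
  have hhi : τ₁ * (P s + R s) - R s ≤ τ₁ * (P t + R t) - R t := by
    refine le_of_step (φ := fun i => τ₁ * (P i + R i) - R i) (s := s) (t := t) ?_ le_rfl hst.le
      le_rfl
    intro i hi hi'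
    have h1 := h.step_pos (i := i) (by omega) (by omega)
    have h2 := hedge i hi hi'
    have h3 := h.slope_mono (j := i + 1) (k := t) (by omega) (by omega) (by omega)
    have := mul_le_mul_of_nonneg_right h3 h1.le
    linarith
  have p1 := h.left_le h₀ hsu (by omega)
  have p2 := h.left_le (by omega) hut h₁
  have r1 := h.right_le h₀ hsu (by omega)
  have r2 := h.right_le (by omega) hut h₁
  set x := (P u - P s) + (R u - R s) with hx
  set X := (P t - P s) + (R t - R s) with hX
  have hx0 : 0 ≤ x := by linarith
  have hxX : x ≤ X := by linarith
  -- The arithmetic-geometric mean inequality: 2XΔ ≤ X² + Δ² ≤ ε/4.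
  have hprod : X * (τ₁ - τ₀) ≤ ε / 8 := by
    have hd : X ^ 2 + (τ₁ - τ₀) ^ 2 ≤ ε / 4 := hdev
    nlinarith [sq_nonneg (X - (τ₁ - τ₀))]
  have h1 : x * (R t - R s) ≤ x * (τ₁ * X) := by
    gcongr
    linarith
  have h2 : X * (τ₀ * x) ≤ X * (R u - R s) := by
    apply mul_le_mul_of_nonneg_left _ (by linarith)
    linarith
  calc (P u - P s) * (R t - R s) - (P t - P s) * (R u - R s)
      = x * (R t - R s) - X * (R u - R s) := by rw [hx, hX]; ring
    _ ≤ x * (X * (τ₁ - τ₀)) := by linarith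
    _ ≤ X * (X * (τ₁ - τ₀)) := by
        apply mul_le_mul_of_nonneg_right hxX
        exact mul_nonneg (by linarith) (by linarith)
    _ ≤ X * (ε / 8) := by
        apply mul_le_mul_of_nonneg_left hprod (by linarith)

/-- Pieces of large deviation use up a bounded potential. -/
theorem exists_potential (h : ConvexChain P R i₀ i₁) (hP : P i₁ - P i₀ = 1)
    (hR : R i₁ - R i₀ = 1) {ε : ℝ} (hε : 0 < ε) :
    ∃ Z : ℕ → ℝ, (∀ i, i₀ ≤ i → i < i₁ → Z i ≤ Z (i + 1)) ∧ Z i₁ - Z i₀ ≤ 3 ∧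
      ∀ s t, i₀ ≤ s → s < t → t ≤ i₁ → ε / 4 < deviation P R s t →
        Real.sqrt ε / 2 ≤ Z t - Z s := by
  -- The potential adds the coordinate sum, which grows by 2, and the slope of the edge that ends at
  -- `i`, which grows by at most 1. The maximum replaces the edge before `i₀`, which is not part of
  -- the chain, by the first edge.
  refine ⟨fun i => P i + R i + edgeSlope P R (max i (i₀ + 1)), fun i hi hi' => ?_, ?_,
    fun s t h₀ hst h₁ hdev => ?_⟩
  · have h1 := h.step_pos hi hi'
    have h2 := h.slope_mono (j := max i (i₀ + 1)) (k := max (i + 1) (i₀ + 1)) (by omega)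
      (by omega) (by omega)
    linarith
  · have := h.two_le
    beta_reduce
    rw [max_eq_left (by omega), max_eq_right (by omega)]
    have h1 := h.slope_le_one (j := i₁) (by omega) le_rfl
    have h2 := h.slope_nonneg (j := i₀ + 1) (by omega) (by omega)
    linarith
  · have h1 := h.slope_mono (j := max s (i₀ + 1)) (k := s + 1) (by omega) (by omega) (by omega)
    have h2 := h.slope_mono (j := s + 1) (k := t) (by omega) (by omega) (by omega)
    have h3 := h.left_le h₀ hst.le h₁
    have h4 := h.right_le h₀ hst.le h₁
    have hmax : max t (i₀ + 1) = t := max_eq_left (by omega)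
    simp only [hmax]
    -- For nonnegative X and Δ, (X + Δ)² ≥ X² + Δ² > ε/4.
    have h5 : Real.sqrt ε / 2 ≤ (P t - P s) + (R t - R s) + (edgeSlope P R t - edgeSlope P R (s + 1)) := by
      apply le_of_sq_le_sq _ (by linarith)
      unfold deviation at hdev
      rw [div_pow, Real.sq_sqrt hε.le]
      nlinarith [mul_nonneg (add_nonneg (sub_nonneg.2 h3) (sub_nonneg.2 h4)) (sub_nonneg.2 h2)]
    linarith

/-- The shares of the two coordinates in an edge add up to 1, so slope differences only change sign.
The program can thus compute the deviation without knowing which order of coordinates makes the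
chain counterclockwise. -/
theorem deviation_swap (h : ConvexChain P R i₀ i₁) {s t : ℕ} (h₀ : i₀ ≤ s) (hst : s < t)
    (h₁ : t ≤ i₁) : deviation R P s t = deviation P R s t := by
  have hs : ∀ j, i₀ < j → j ≤ i₁ → edgeSlope R P j = 1 - edgeSlope P R j := by
    intro j hj hj'
    obtain ⟨i, rfl⟩ : ∃ i, j = i + 1 := ⟨j - 1, by omega⟩
    have h1 := h.step_pos (i := i) (by omega) (by omega)
    have h1' : 0 < (R (i + 1) - R i) + (P (i + 1) - P i) := by linarith
    unfold edgeSlope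
    simp only [Nat.add_sub_cancel]
    rw [eq_sub_iff_add_eq, add_comm (R (i + 1) - R i), ← add_div, div_self h1.ne']
  unfold deviation
  rw [hs t (by omega) h₁, hs (s + 1) (by omega) (by omega)]
  ring

/-- A line supporting the chain from inside is far from the opposite corner of the bounding box. -/
theorem le_opposite {p r p₀ r₀ p₁ r₁ D E : ℝ} (hp : p ≤ p₀) (hr : r₁ ≤ r) (h₁ : p₁ - p₀ = 1)
    (h₁' : r₁ - r₀ = 1) (hD : 0 ≤ D) (hE : 0 ≤ E) {x y : ℝ} (h0 : 0 ≤ D * (r₀ - y) - E * (p₀ - x))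
    (h1 : 0 ≤ D * (r₁ - y) - E * (p₁ - x)) :
    (D + E) / 2 ≤ D * (r - y) - E * (p - x) := by
  -- The mean of `h0` and `h1` says that the centre of the unit box is on the inner side of the
  -- line; passing from the centre to the corner (p₀, r₁) gains D/2 + E/2, and going on to (p, r)
  -- loses nothing.
  nlinarith [mul_le_mul_of_nonneg_left hp hE, mul_le_mul_of_nonneg_left hr hD]

end ConvexChain

/-! ### Unimodality of linear functionals on convex polygons -/

/-- Affine dependence of four points in convex position: the diagonals AC and BD cross, so an affine
functional cannot be smaller at A than at C and yet no smaller at B and D than at C. The identity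
`key` is this dependence with triangle areas as coefficients. -/
theorem no_valley {p q A B C D : Plane} (hBCD : 0 < cross B C D)
    (hACD : 0 < cross A C D) (hABC : 0 < cross A B C) (hA : cross p q A < cross p q C)
    (hB : cross p q C ≤ cross p q B) (hD : cross p q C ≤ cross p q D) : False := by
  have key : cross A C D * (cross p q B - cross p q C) + cross A B C * (cross p q D - cross p q C) =
      cross B C D * (cross p q A - cross p q C) := by
    simp only [cross]; ring
  nlinarith [mul_pos hBCD (sub_pos.2 hA), mul_nonneg hACD.le (sub_nonneg.2 hB),
    mul_nonneg hABC.le (sub_nonneg.2 hD)]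

/-- Going backwards from a rise just before `m`: a step that does not rise, followed by one that
does, would be a valley above the value at `o`. Thus a local condition at `m` gives strict
monotonicity from `o` to `m`. -/
theorem CCW.rise {V : ℕ → Plane} {n : ℕ} (h : CCW V n) {p q : Plane} {o m : ℕ} (hm : m < n)
    (ho : ∀ i, o < i → i ≤ m → cross p q (V o) < cross p q (V i))
    (hlast : o < m → cross p q (V (m - 1)) < cross p q (V m)) {i : ℕ} (hi : o ≤ i) (him : i < m) :
    cross p q (V i) < cross p q (V (i + 1)) := by
  obtain ⟨k, hk⟩ : ∃ k, m = i + 1 + k := ⟨m - i - 1, by omega⟩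
  induction k generalizing i with
  | zero =>
    have := hlast (by omega)
    rw [hk] at this
    simpa using this
  | succ k ih =>
    have h1 := ih (i := i + 1) (by omega) (by omega) (by omega)
    rcases hi.eq_or_lt with rfl | hlt
    · exact ho _ (by omega) (by omega)
    by_contra hc
    exact no_valley (h i (i + 1) (i + 1 + 1) (by omega) (by omega) (by omega))
      (h o (i + 1) (i + 1 + 1) (by omega) (by omega) (by omega))
      (h o i (i + 1) (by omega) (by omega) (by omega)) (ho (i + 1) (by omega) (by omega))
      (not_lt.1 hc) h1.le

/-- The same argument going forwards. The first step may be level, since two neighbouring vertices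
can be equally far away; all later steps are strict. -/
theorem CCW.fall {V : ℕ → Plane} {n : ℕ} (h : CCW V n) {p q : Plane} {o m e : ℕ} (hom : o ≤ m)
    (he : e < n) (ho : ∀ i, m < i → i < e → cross p q (V o) < cross p q (V i))
    (hfirst : m < e → cross p q (V (m + 1)) ≤ cross p q (V m)) {i : ℕ} (hi : m ≤ i) (hie : i < e) :
    cross p q (V (i + 1)) ≤ cross p q (V i) ∧
      (m < i → cross p q (V (i + 1)) < cross p q (V i)) := by
  induction i, hi using Nat.le_induction with
  | base => exact ⟨hfirst hie, fun h => absurd h (lt_irrefl _)⟩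
  | succ i hi ih =>
    have h1 := (ih (by omega)).1
    suffices cross p q (V (i + 1 + 1)) < cross p q (V (i + 1)) from ⟨this.le, fun _ => this⟩
    have h2 := ho (i + 1) (by omega) hie
    have hoi : o < i := by
      rcases Nat.lt_or_ge o i with h' | h'
      · exact h'
      · obtain rfl : o = i := by omega
        linarith
    by_contra hc
    exact no_valley (h i (i + 1) (i + 1 + 1) (by omega) (by omega) (by omega))
      (h o (i + 1) (i + 1 + 1) (by omega) (by omega) (by omega))
      (h o i (i + 1) (by omega) (by omega) (by omega)) h2 h1 (not_lt.1 hc)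

theorem CCW.cross_nonneg_of_outside {V : ℕ → Plane} {n : ℕ} (h : CCW V n) {s t k : ℕ}
    (hst : s < t) (ht : t < n) (hk : k < n) (hout : k ≤ s ∨ t ≤ k) :
    0 ≤ cross (V s) (V t) (V k) := by
  rcases hout with hks | htk
  · rcases hks.eq_or_lt with rfl | hks
    · simp
    · rw [cross_rotate]
      exact (h k s t hks hst ht).le
  · rcases htk.eq_or_lt with rfl | htk
    · simp
    · exact (h s t k hst htk hk).le

/-! ### Sparsifying a convex polygon -/

/-- The functional `cross p q`, scaled so that it changes by `1` from `V i₀` to `V i₁`. -/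
def scaled (V : ℕ → Plane) (p q : Plane) (i₀ i₁ i : ℕ) : ℝ :=
  cross p q (V i) / (cross p q (V i₁) - cross p q (V i₀))

/-- The vertices `V i₀, …, V i₁` form a chain that is monotone in the directions of `p q` and
`r m`, and either end of its bounding box is opposite to the vertex number `0` or `m`. -/
structure BoxChain (V : ℕ → Plane) (n m : ℕ) (p q p' q' : Plane) (i₀ i₁ : ℕ) : Prop where
  le : i₀ ≤ i₁
  lt : i₁ < n
  side : m ≤ i₀ ∨ i₁ ≤ m
  left_mono : ∀ i, i₀ ≤ i → i < i₁ → scaled V p q i₀ i₁ i ≤ scaled V p q i₀ i₁ (i + 1)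
  right_mono : ∀ i, i₀ ≤ i → i < i₁ → scaled V p' q' i₀ i₁ i ≤ scaled V p' q' i₀ i₁ (i + 1)
  opposite : i₀ + 2 ≤ i₁ → ∃ o, (o = 0 ∨ o = m) ∧
    cross p q (V i₁) - cross p q (V i₀) ≠ 0 ∧ cross p' q' (V i₁) - cross p' q' (V i₀) ≠ 0 ∧
    ((0 < det (q - p) (q' - p') / ((cross p q (V i₁) - cross p q (V i₀)) *
          (cross p' q' (V i₁) - cross p' q' (V i₀))) ∧
        scaled V p q i₀ i₁ o ≤ scaled V p q i₀ i₁ i₀ ∧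
        scaled V p' q' i₀ i₁ i₁ ≤ scaled V p' q' i₀ i₁ o) ∨
      (det (q - p) (q' - p') / ((cross p q (V i₁) - cross p q (V i₀)) *
          (cross p' q' (V i₁) - cross p' q' (V i₀))) < 0 ∧
        scaled V p' q' i₀ i₁ o ≤ scaled V p' q' i₀ i₁ i₀ ∧
        scaled V p q i₀ i₁ i₁ ≤ scaled V p q i₀ i₁ o))

namespace BoxChain

variable {V : ℕ → Plane} {n m : ℕ} {p q p' q' : Plane} {i₀ i₁ : ℕ}

theorem scaled_end (hne : cross p q (V i₁) - cross p q (V i₀) ≠ 0) :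
    scaled V p q i₀ i₁ i₁ - scaled V p q i₀ i₁ i₀ = 1 := by
  unfold scaled
  rw [← sub_div, div_self hne]

/-- The two scaled functionals form an affine coordinate system, so determinants in it are true
determinants times a constant factor. The sign of this factor decides which functional plays the
role of the first coordinate. -/
theorem scaled_det (s t x y : ℕ) :
    (scaled V p q i₀ i₁ t - scaled V p q i₀ i₁ s) *
        (scaled V p' q' i₀ i₁ x - scaled V p' q' i₀ i₁ y) -
      (scaled V p' q' i₀ i₁ t - scaled V p' q' i₀ i₁ s) *
        (scaled V p q i₀ i₁ x - scaled V p q i₀ i₁ y) =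
    det (q - p) (q' - p') / ((cross p q (V i₁) - cross p q (V i₀)) *
          (cross p' q' (V i₁) - cross p' q' (V i₀))) * det (V t - V s) (V x - V y) := by
  unfold scaled
  rw [← sub_div, ← sub_div, ← sub_div, ← sub_div, div_mul_div_comm, div_mul_div_comm,
    mul_comm (cross p' q' (V i₁) - cross p' q' (V i₀)), ← sub_div, div_mul_eq_mul_div]
  congr 1
  simp [cross, det]; ring

theorem det_edges {V : ℕ → Plane} (i : ℕ) :
    det (V (i + 1) - V i) (V (i + 2) - V (i + 1)) = cross (V i) (V (i + 1)) (V (i + 2)) := by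
  simp [cross, det]; ring

theorem det_chord {V : ℕ → Plane} (s t x : ℕ) :
    det (V t - V s) (V x - V s) = cross (V s) (V t) (V x) := by
  simp [cross, det]

/-- In suitable order of the coordinates a box chain turns counterclockwise. -/
theorem convexChain (h : BoxChain V n m p q p' q' i₀ i₁) (hV : CCW V n) (h2 : i₀ + 2 ≤ i₁) :
    ∃ P R : ℕ → ℝ, ∃ o κ, (o = 0 ∨ o = m) ∧ 0 < κ ∧ ConvexChain P R i₀ i₁ ∧ P i₁ - P i₀ = 1 ∧
      R i₁ - R i₀ = 1 ∧ P o ≤ P i₀ ∧ R i₁ ≤ R o ∧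
      (∀ s t x, (P t - P s) * (R x - R s) - (R t - R s) * (P x - P s) =
        κ * cross (V s) (V t) (V x)) ∧
      ∀ s t, i₀ ≤ s → s < t → t ≤ i₁ →
        deviation (scaled V p q i₀ i₁) (scaled V p' q' i₀ i₁) s t = deviation P R s t := by
  obtain ⟨o, ho, hne, hne', hsign⟩ := h.opposite h2
  have hdet := scaled_det (V := V) (p := p) (q := q) (p' := p') (q' := q') (i₀ := i₀) (i₁ := i₁)
  set κ := det (q - p) (q' - p') / ((cross p q (V i₁) - cross p q (V i₀)) *
          (cross p' q' (V i₁) - cross p' q' (V i₀))) with hκ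
  rcases hsign with ⟨hs, h3, h4⟩ | ⟨hs, h3, h4⟩
  · refine ⟨_, _, o, κ, ho, hs, ⟨h2, h.left_mono, h.right_mono, fun i hi hi' => ?_⟩,
      scaled_end hne, scaled_end hne', h3, h4, fun s t x => ?_, fun s t _ _ _ => rfl⟩
    · rw [hdet, det_edges]
      exact mul_pos hs (hV _ _ _ (by omega) (by omega) (by have := h.lt; omega))
    · rw [hdet, det_chord]
  -- A negative factor reverses orientation, which exchanging the two coordinates repairs.
  · have hc : ConvexChain (scaled V p' q' i₀ i₁) (scaled V p q i₀ i₁) i₀ i₁ := by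
      refine ⟨h2, h.right_mono, h.left_mono, fun i hi hi' => ?_⟩
      have := hdet i (i + 1) (i + 2) (i + 1)
      rw [det_edges] at this
      have hpos := hV i (i + 1) (i + 2) (by omega) (by omega) (by have := h.lt; omega)
      nlinarith [mul_pos (neg_pos.2 hs) hpos]
    refine ⟨_, _, o, -κ, ho, neg_pos.2 hs, hc,
      scaled_end hne', scaled_end hne, h3, h4, fun s t x => ?_, fun s t h5 h6 h7 => ?_⟩
    · have := hdet s t x s
      rw [det_chord] at this
      linarith
    · rw [hc.deviation_swap h5 h6 h7]

theorem exists_potential (h : BoxChain V n m p q p' q' i₀ i₁) (hV : CCW V n) {ε : ℝ}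
    (hε : 0 < ε) :
    ∃ Z : ℕ → ℝ, (∀ i, i₀ ≤ i → i < i₁ → Z i ≤ Z (i + 1)) ∧ Z i₁ - Z i₀ ≤ 3 ∧
      ∀ s t, i₀ ≤ s → s + 1 < t → t ≤ i₁ →
        ε / 4 < deviation (scaled V p q i₀ i₁) (scaled V p' q' i₀ i₁) s t →
        Real.sqrt ε / 2 ≤ Z t - Z s := by
  by_cases h2 : i₀ + 2 ≤ i₁
  · obtain ⟨P, R, o, κ, -, -, hc, hP, hR, -, -, -, hdev⟩ := h.convexChain hV h2
    obtain ⟨Z, hZ, hZ3, hZd⟩ := hc.exists_potential hP hR hε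
    refine ⟨Z, hZ, hZ3, fun s t h3 h4 h5 h6 => hZd s t h3 (by omega) h5 ?_⟩
    rwa [← hdev s t h3 (by omega) h5]
  · exact ⟨fun _ => 0, fun _ _ _ => le_rfl, by simp, fun s t h3 h4 h5 => by omega⟩

/-- The vertices between `s` and `t` are not far beyond the chord of a piece of small
deviation. -/
theorem chord (h : BoxChain V n m p q p' q' i₀ i₁) (hV : CCW V n) (hm : m < n) {ε : ℝ}
    (hε : 0 < ε) {s t u : ℕ} (h₀ : i₀ ≤ s) (hst : s < t) (h₁ : t ≤ i₁) (hsu : s ≤ u) (hut : u ≤ t)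
    (hdev : t = s + 1 ∨ deviation (scaled V p q i₀ i₁) (scaled V p' q' i₀ i₁) s t ≤ ε / 4) :
    -cross (V s) (V t) (V u) ≤
      ε / 2 * ((cross (V s) (V t) (V 0) + cross (V s) (V t) (V m)) / 2) := by
  have hin := h.lt
  have c0 := hV.cross_nonneg_of_outside (k := 0) hst (by omega) (by omega) (.inl (by omega))
  have cm := hV.cross_nonneg_of_outside (k := m) hst (by omega) hm
    (by rcases h.side with h | h <;> omega)
  -- A single edge skips nothing. This case comes first because a chain with only one edge has no
  -- box coordinates to work with.
  by_cases h2 : t = s + 1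
  · have : cross (V s) (V t) (V u) = 0 := by
      obtain rfl | rfl : u = s ∨ u = t := by omega
      · simp
      · simp
    rw [this]
    have := add_nonneg c0 cm
    simp only [neg_zero]
    positivity
  replace hdev := hdev.resolve_left h2
  obtain ⟨P, R, o, κ, ho, hκ, hc, hP, hR, hPo, hRo, hcr, hd⟩ := h.convexChain hV (by omega)
  rw [hd s t h₀ hst h₁] at hdev
  have h3 := hc.dist_le h₀ hsu hut hst h₁ hdev
  have e0 := hV.cross_nonneg_of_outside (k := i₀) hst (by omega) (by omega) (.inl (by omega))
  have e1 := hV.cross_nonneg_of_outside (k := i₁) hst (by omega) (by omega) (.inr (by omega))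
  have h4 := ConvexChain.le_opposite (D := P t - P s) (E := R t - R s) (x := P s) (y := R s) hPo hRo
    hP hR (sub_nonneg.2 (hc.left_le h₀ hst.le h₁)) (sub_nonneg.2 (hc.right_le h₀ hst.le h₁))
    (by rw [hcr]; positivity) (by rw [hcr]; positivity)
  rw [hcr] at h4
  have h5 := hcr s t u
  -- The protrusion is at most Xε/8, while the opposite vertex is at distance at least X/2, both
  -- times the same factor. The final bound by the mean over vertices 0 and `m` costs a factor 2 and
  -- makes one homothety centre serve all four chains.
  have h6 : κ * (-cross (V s) (V t) (V u)) ≤ κ * (ε / 4 * cross (V s) (V t) (V o)) := by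
    nlinarith
  have h7 := le_of_mul_le_mul_left h6 hκ
  rcases ho with rfl | rfl
  · nlinarith
  · nlinarith

end BoxChain

/-- A homothetic copy of a convex polygon is contained in the hull of a suitable subsequence of
its vertices. -/
theorem CCW.homothety_mem {V : ℕ → Plane} {n : ℕ} (hV : CCW V n) {m : ℕ} (hm : m < n)
    {κ : ℕ → ℕ} {K : ℕ} (hK : 3 ≤ K) (hκ : ∀ i j, i < j → j < K → κ i < κ j) (h0 : κ 0 = 0)
    (hlast : κ (K - 1) = n - 1) {e : ℝ} (he : 0 ≤ e) (he1 : e ≤ 1)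
    (hch : ∀ k, k + 1 < K → ∀ u, κ k ≤ u → u ≤ κ (k + 1) →
      -cross (V (κ k)) (V (κ (k + 1))) (V u) ≤
        e * ((cross (V (κ k)) (V (κ (k + 1))) (V 0) +
          cross (V (κ k)) (V (κ (k + 1))) (V m)) / 2)) {x : Plane} (hx : x ∈ hull V n) :
    (1 - e) • x + e • ((1 / 2 : ℝ) • V 0 + (1 / 2 : ℝ) • V m) ∈ hull (fun i => V (κ i)) K := by
  have hn : ∀ i < K, κ i < n := by
    intro i hi
    rcases Nat.lt_or_ge i (K - 1) with h | h
    · have := hκ i (K - 1) h (by omega)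
      omega
    · obtain rfl : i = K - 1 := by omega
      have := hκ 0 (K - 1) (by omega) (by omega)
      omega
  refine (hV.comp hκ hn).mem_hull_of_edges hK ?_ ?_
  · intro i hi
    rw [cross_combo _ _ _ _ (by ring), cross_combo _ _ _ _ (by norm_num)]
    set c := (cross (V (κ i)) (V (κ (i + 1))) (V 0) + cross (V (κ i)) (V (κ (i + 1))) (V m)) / 2
      with hc
    have hlt := hκ i (i + 1) (by omega) hi
    have hc0 : 0 ≤ e * c := by
      have := hch i hi (κ i) le_rfl hlt.le
      simpa using this
    have hxl : -(e * c) ≤ cross (V (κ i)) (V (κ (i + 1))) x := by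
      refine hull_subset (convex_le_cross _ _ _) (fun u hu => ?_) hx
      simp only [Set.mem_ofPred_eq]
      by_cases hout : u ≤ κ i ∨ κ (i + 1) ≤ u
      · have := hV.cross_nonneg_of_outside hlt (hn _ hi) hu hout
        linarith
      · push Not at hout
        have := hch i hi u hout.1.le hout.2.le
        rw [← hc] at this
        linarith
    -- With `c` the value at the centre and -ec a lower bound on the polygon, the image has value at
    -- least -(1 - e)ec + ec = e²c ≥ 0.
    have h1 : (1 - e) * -(e * c) ≤ (1 - e) * cross (V (κ i)) (V (κ (i + 1))) x :=
      mul_le_mul_of_nonneg_left hxl (by linarith)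
    have h2 : 0 ≤ e * (e * c) := by positivity
    rw [show (1 / 2 : ℝ) * cross (V (κ i)) (V (κ (i + 1))) (V 0) +
      1 / 2 * cross (V (κ i)) (V (κ (i + 1))) (V m) = c by rw [hc]; ring]
    linarith
  -- The closing edge of the sparse polygon is the closing edge of the original, so nothing sticks
  -- out there.
  · simp only [h0, hlast]
    rw [cross_combo _ _ _ _ (by ring), cross_combo _ _ _ _ (by norm_num)]
    have h1 := hV.cross_closing_nonneg hx
    have h2 := hV.cross_closing_nonneg (mem_hull hm)
    have h3 := mul_nonneg (sub_nonneg.2 he1) h1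
    have h4 := mul_nonneg he h2
    simp only [cross_self_right]
    linarith

/-! ### Four box chains that make up a convex polygon -/

/-- Dividing by the total change turns decreasing functionals into increasing ones as well. -/
theorem scaled_step {V : ℕ → Plane} {p q : Plane} {i₀ i₁ : ℕ} (hle : i₀ ≤ i₁)
    (h : (∀ i, i₀ ≤ i → i < i₁ → cross p q (V i) ≤ cross p q (V (i + 1))) ∨
      ∀ i, i₀ ≤ i → i < i₁ → cross p q (V (i + 1)) ≤ cross p q (V i)) {i : ℕ} (h₀ : i₀ ≤ i)
    (h₁ : i < i₁) : scaled V p q i₀ i₁ i ≤ scaled V p q i₀ i₁ (i + 1) := by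
  unfold scaled
  rcases h with h | h
  · exact div_le_div_of_nonneg_right (h i h₀ h₁)
      (sub_nonneg.2 (le_of_step (φ := fun i => cross p q (V i)) h le_rfl hle le_rfl))
  · have := le_of_step (φ := fun i => -cross p q (V i)) (s := i₀) (t := i₁)
      (fun i hi hi' => neg_le_neg (h i hi hi')) le_rfl hle le_rfl
    exact div_le_div_of_nonpos_of_le (by linarith) (h i h₀ h₁)

/-- The local maxima that determine the anchors `m`, `L`, `R`. -/
structure Anchors (V : ℕ → Plane) (n m L R : ℕ) : Prop where
  ccw : CCW V n
  m_pos : 0 < m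
  m_lt : m + 1 < n
  m_up : cross (V (n - 1)) (V 0) (V (m - 1)) < cross (V (n - 1)) (V 0) (V m)
  m_down : cross (V (n - 1)) (V 0) (V (m + 1)) ≤ cross (V (n - 1)) (V 0) (V m)
  L_lt : L < m
  L_up : L = 0 ∨ cross (V m) (V 0) (V (L - 1)) < cross (V m) (V 0) (V L)
  L_down : L + 1 = m ∨ cross (V m) (V 0) (V (L + 1)) ≤ cross (V m) (V 0) (V L)
  le_R : m ≤ R
  R_lt : R < n
  R_up : R = m ∨ cross (V 0) (V m) (V (R - 1)) < cross (V 0) (V m) (V R)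
  R_down : R + 1 = n ∨ cross (V 0) (V m) (V (R + 1)) ≤ cross (V 0) (V m) (V R)

namespace Anchors

variable {V : ℕ → Plane} {n m L R : ℕ}

theorem base_pos (h : Anchors V n m L R) {i : ℕ} (h₀ : 0 < i) (h₁ : i + 1 < n) :
    0 < cross (V (n - 1)) (V 0) (V i) := by
  have := h.ccw 0 i (n - 1) h₀ (by omega) (by omega)
  rwa [← cross_rotate, ← cross_rotate] at this

theorem base_rise (h : Anchors V n m L R) {i : ℕ} (hi : i < m) :
    cross (V (n - 1)) (V 0) (V i) < cross (V (n - 1)) (V 0) (V (i + 1)) := by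
  have hm := h.m_lt
  refine h.ccw.rise (o := 0) (m := m) (by omega) (fun i h₀ h₁ => ?_) (fun _ => h.m_up)
    (Nat.zero_le i) hi
  rw [cross_self_right]
  exact h.base_pos h₀ (by omega)

theorem base_fall (h : Anchors V n m L R) {i : ℕ} (hi : m ≤ i) (hin : i < n - 1) :
    cross (V (n - 1)) (V 0) (V (i + 1)) ≤ cross (V (n - 1)) (V 0) (V i) ∧
      (m < i → cross (V (n - 1)) (V 0) (V (i + 1)) < cross (V (n - 1)) (V 0) (V i)) := by
  have hm := h.m_lt
  refine h.ccw.fall (o := 0) (m := m) (e := n - 1) (by omega) (by omega) (fun i h₀ h₁ => ?_)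
    (fun _ => h.m_down) hi hin
  rw [cross_self_right]
  exact h.base_pos (by omega) (by omega)

theorem left_pos (h : Anchors V n m L R) {i : ℕ} (h₀ : 0 < i) (h₁ : i < m) :
    0 < cross (V m) (V 0) (V i) := by
  have := h.ccw 0 i m h₀ h₁ (by have := h.m_lt; omega)
  rwa [← cross_rotate, ← cross_rotate] at this

theorem right_pos (h : Anchors V n m L R) {i : ℕ} (h₀ : m < i) (h₁ : i < n) :
    0 < cross (V 0) (V m) (V i) := h.ccw 0 m i h.m_pos h₀ h₁

/-- Unless there is no vertex between 0 and `m`, a local maximum cannot be vertex 0: it lies on the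
diagonal, and vertex 1 is strictly to its left. -/
theorem L_pos (h : Anchors V n m L R) : 0 < L ∨ m = 1 := by
  rcases Nat.eq_zero_or_pos L with h0 | h0
  · right
    have := h.L_lt
    rcases h.L_down with h1 | h1
    · omega
    · by_contra hne
      have h2 := h.left_pos (i := L + 1) (by omega) (by omega)
      rw [h0] at h1 h2
      rw [cross_self_right] at h1
      linarith
  · exact .inl h0

theorem left_rise (h : Anchors V n m L R) {i : ℕ} (hi : i < L) :
    cross (V m) (V 0) (V i) < cross (V m) (V 0) (V (i + 1)) := by
  have hm := h.m_lt
  have hL := h.L_lt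
  refine h.ccw.rise (o := 0) (m := L) (by omega) (fun i h₀ h₁ => ?_)
    (fun h0 => h.L_up.resolve_left (by omega)) (Nat.zero_le i) hi
  rw [cross_self_right]
  exact h.left_pos h₀ (by omega)

theorem left_fall (h : Anchors V n m L R) {i : ℕ} (hi : L ≤ i) (him : i < m) :
    cross (V m) (V 0) (V (i + 1)) ≤ cross (V m) (V 0) (V i) := by
  have hm := h.m_lt
  have hL := h.L_lt
  refine (h.ccw.fall (o := 0) (m := L) (e := m) (by omega) (by omega) (fun i h₀ h₁ => ?_)
    (fun _ => ?_) hi him).1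
  · rw [cross_self_right]
    exact h.left_pos (by omega) (by omega)
  · rcases h.L_down with h1 | h1
    · rw [h1, cross_self_outer]
      rcases h.L_pos with h2 | h2
      · exact (h.left_pos h2 hL).le
      · obtain rfl : L = 0 := by omega
        simp
    · exact h1

theorem m_lt_R (h : Anchors V n m L R) : m < R := by
  have hm := h.m_lt
  rcases h.le_R.eq_or_lt with h0 | h0
  · exfalso
    rcases h.R_down with h1 | h1
    · omega
    · have h2 := h.right_pos (i := m + 1) (by omega) (by omega)
      rw [← h0, cross_self_right] at h1
      linarith
  · exact h0

theorem right_rise (h : Anchors V n m L R) {i : ℕ} (hi : m ≤ i) (hiR : i < R) :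
    cross (V 0) (V m) (V i) < cross (V 0) (V m) (V (i + 1)) := by
  have hR := h.R_lt
  refine h.ccw.rise (o := m) (m := R) (by omega) (fun i h₀ h₁ => ?_)
    (fun h0 => h.R_up.resolve_left (by omega)) hi hiR
  rw [cross_self_right]
  exact h.right_pos h₀ (by omega)

theorem right_fall (h : Anchors V n m L R) {i : ℕ} (hi : R ≤ i) (hin : i < n - 1) :
    cross (V 0) (V m) (V (i + 1)) ≤ cross (V 0) (V m) (V i) ∧
      (R < i → cross (V 0) (V m) (V (i + 1)) < cross (V 0) (V m) (V i)) := by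
  have hR := h.m_lt_R
  refine h.ccw.fall (o := m) (m := R) (e := n - 1) (by omega) (by omega) (fun i h₀ h₁ => ?_)
    (fun _ => h.R_down.resolve_left (by omega)) hi hin
  rw [cross_self_right]
  exact h.right_pos (by omega) (by omega)

theorem det_neg (h : Anchors V n m L R) :
    det (V 0 - V (n - 1)) (V 0 - V m) < 0 := by
  have := h.right_pos (i := n - 1) (by have := h.m_lt; omega) (by have := h.m_lt; omega)
  have e : det (V 0 - V (n - 1)) (V 0 - V m) = -cross (V 0) (V m) (V (n - 1)) := by
    simp [det, cross]; ring
  linarith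

/-- Both distances grow from vertex 0 to `L`. Vertex `m` lies on the diagonal like vertex 0, and is
at least as far from the base edge as vertex `L`. -/
theorem chain₀ (h : Anchors V n m L R) : BoxChain V n m (V (n - 1)) (V 0) (V m) (V 0) 0 L := by
  have hm := h.m_lt
  have hL := h.L_lt
  refine ⟨Nat.zero_le _, by omega, .inr hL.le,
    fun i => scaled_step (Nat.zero_le _) (.inl fun i _ hi => (h.base_rise (i := i) (by omega)).le),
    fun i => scaled_step (Nat.zero_le _) (.inl fun i _ hi => (h.left_rise hi).le), fun h2 => ?_⟩
  have hf := h.base_pos (i := L) (by omega) (by omega)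
  have hg := h.left_pos (i := L) (by omega) hL
  refine ⟨m, .inr rfl, ?_, ?_, .inr ⟨?_, ?_, ?_⟩⟩
  · simpa using hf.ne'
  · simpa using hg.ne'
  · simp only [cross_self_right, sub_zero]
    exact div_neg_of_neg_of_pos h.det_neg (mul_pos hf hg)
  · simp [scaled]
  · unfold scaled
    refine div_le_div_of_nonneg_right ?_ (by simpa using hf.le)
    exact le_of_step (φ := fun i => cross (V (n - 1)) (V 0) (V i)) (s := 0) (t := m)
      (fun i _ hi => (h.base_rise hi).le) (Nat.zero_le _) hL.le le_rfl

/-- From `L` to `m` the distance from the base still grows while that from the diagonal shrinks; now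
vertex 0, where both are zero, is opposite. -/
theorem chain₁ (h : Anchors V n m L R) : BoxChain V n m (V (n - 1)) (V 0) (V m) (V 0) L m := by
  have hm := h.m_lt
  have hL := h.L_lt
  refine ⟨hL.le, by omega, .inr le_rfl,
    fun i => scaled_step hL.le (.inl fun i _ hi => (h.base_rise (i := i) (by omega)).le),
    fun i => scaled_step hL.le (.inr fun i hi hi' => h.left_fall hi hi'), fun h2 => ?_⟩
  have hL0 : 0 < L := h.L_pos.resolve_right (by omega)
  have hf : 0 < cross (V (n - 1)) (V 0) (V m) - cross (V (n - 1)) (V 0) (V L) := by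
    have h1 := h.base_rise (i := L) (by omega)
    have h2 := le_of_step (φ := fun i => cross (V (n - 1)) (V 0) (V i)) (s := 0) (t := m)
      (fun i _ hi => (h.base_rise hi).le) (u := L + 1) (by omega) hL le_rfl
    linarith
  have hg := h.left_pos (i := L) (by omega) hL
  refine ⟨0, .inl rfl, hf.ne', ?_, .inl ⟨?_, ?_, ?_⟩⟩
  · simpa using hg.ne'
  · simp only [cross_self_outer, zero_sub]
    exact div_pos_of_neg_of_neg h.det_neg (mul_neg_of_pos_of_neg hf (by linarith))
  · unfold scaled
    refine div_le_div_of_nonneg_right ?_ hf.le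
    rw [cross_self_right]
    exact (h.base_pos hL0 (by omega)).le
  · simp [scaled]

/-- The part from `m` to `R`, beyond the diagonal: the base distance shrinks, the diagonal distance
grows in absolute value, and vertex 0 is opposite. -/
theorem chain₂ (h : Anchors V n m L R) : BoxChain V n m (V (n - 1)) (V 0) (V m) (V 0) m R := by
  have hm := h.m_lt
  have hR := h.m_lt_R
  have hRn := h.R_lt
  refine ⟨hR.le, by omega, .inl le_rfl,
    fun i => scaled_step hR.le (.inr fun i hi hi' => (h.base_fall (i := i) hi (by omega)).1),
    fun i => scaled_step hR.le (.inr fun i hi hi' => ?_), fun h2 => ?_⟩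
  · rw [cross_swap, cross_swap (V 0)]
    exact neg_le_neg (h.right_rise hi hi').le
  have hf : cross (V (n - 1)) (V 0) (V R) - cross (V (n - 1)) (V 0) (V m) < 0 := by
    have h1 := (h.base_fall (i := m + 1) (by omega) (by omega)).2 (by omega)
    have h4 := h.m_down
    have h3 := le_of_step (φ := fun i => -cross (V (n - 1)) (V 0) (V i)) (s := m) (t := n - 1)
      (fun i hi hi' => neg_le_neg (h.base_fall hi hi').1) (u := m + 1 + 1) (v := R) (by omega) (by omega)
      (by omega)
    linarith
  have hg : cross (V m) (V 0) (V R) < 0 := by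
    have := h.right_pos (i := R) hR hRn
    rw [cross_swap] at this
    linarith
  refine ⟨0, .inl rfl, hf.ne, ?_, .inr ⟨?_, ?_, ?_⟩⟩
  · simpa using hg.ne
  · simp only [cross_self_outer, sub_zero]
    exact div_neg_of_neg_of_pos h.det_neg (mul_pos_of_neg_of_neg hf hg)
  · simp [scaled]
  · unfold scaled
    refine div_le_div_of_nonpos_of_le hf.le ?_
    rw [cross_self_right]
    exact h.ccw.cross_closing_nonneg (mem_hull hRn)

/-- From `R` to the last vertex both distances shrink, and vertex `m` is opposite: farthest from the
base and on the diagonal. -/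
theorem chain₃ (h : Anchors V n m L R) :
    BoxChain V n m (V (n - 1)) (V 0) (V m) (V 0) R (n - 1) := by
  have hm := h.m_lt
  have hR := h.m_lt_R
  have hRn := h.R_lt
  refine ⟨by omega, by omega, .inl hR.le,
    fun i => scaled_step (by omega) (.inr fun i hi hi' => (h.base_fall (by omega) hi').1),
    fun i => scaled_step (by omega) (.inl fun i hi hi' => ?_), fun h2 => ?_⟩
  · rw [cross_swap, cross_swap (V 0)]
    exact neg_le_neg (h.right_fall hi hi').1
  have hf := h.base_pos (i := R) (by omega) (by omega)
  have hg : 0 < cross (V m) (V 0) (V (n - 1)) - cross (V m) (V 0) (V R) := by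
    have h1 := (h.right_fall (i := R + 1) (by omega) (by omega)).2 (by omega)
    have h2 := (h.right_fall (i := R) le_rfl (by omega)).1
    have h3 := le_of_step (φ := fun i => -cross (V 0) (V m) (V i)) (s := R) (t := n - 1)
      (fun i hi hi' => neg_le_neg (h.right_fall hi hi').1) (u := R + 1 + 1) (v := n - 1) (by omega)
      (by omega) le_rfl
    rw [cross_swap, cross_swap (V 0)]
    linarith
  refine ⟨m, .inr rfl, ?_, hg.ne', .inl ⟨?_, ?_, ?_⟩⟩
  · simpa using hf.ne'
  · simp only [cross_self_outer, zero_sub]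
    exact div_pos_of_neg_of_neg h.det_neg (mul_neg_of_neg_of_pos (by linarith) hg)
  · unfold scaled
    refine div_le_div_of_nonpos_of_le (by rw [cross_self_outer]; linarith) ?_
    have := le_of_step (φ := fun i => -cross (V (n - 1)) (V 0) (V i)) (s := m) (t := n - 1)
      (fun i hi hi' => neg_le_neg (h.base_fall hi hi').1) (u := m) (v := R) le_rfl hR.le (by omega)
    linarith
  · unfold scaled
    refine div_le_div_of_nonneg_right ?_ hg.le
    rw [cross_self_outer, cross_swap]
    exact neg_nonpos.2 (h.right_pos (by omega) (by omega)).le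

end Anchors

namespace RealRAM

/-! ### Access to the vertices in counterclockwise order

The integer variable `1` is `0` if the input is in counterclockwise order, and `n - 1` otherwise. -/

/-- With truncated subtraction the index is |d - i|, where d is variable 1. For d = 0 this is i and
for d = n - 1 it is n - 1 - i, so a clockwise input is read backwards without being copied. -/
def vtx (i : IExp) : PExp :=
  let j : IExp := .add (.sub (ivar 1) i) (.sub i (ivar 1))
  ⟨.get 0 j, .get 1 j⟩

def vert (s : State) (i : ℕ) : Plane :=
  !₂[s.real 0 ((s.int 1 0 - i) + (i - s.int 1 0)), s.real 1 ((s.int 1 0 - i) + (i - s.int 1 0))]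

@[simp] theorem eval_vtx (s : State) (i : IExp) : (vtx i).eval s = vert s (i.eval s) := rfl

theorem vert_congr {s s' : State} (h₀ : s'.real 0 = s.real 0) (h₁ : s'.real 1 = s.real 1)
    (h : s'.int 1 0 = s.int 1 0) : vert s' = vert s := by
  funext i
  simp only [vert, h₀, h₁, h]

/-- A bisection between the values of `lo` and `hi`, the result of which is stored in `tgt`. -/
def search (lo hi : IExp) (test : BExp) (tgt : ℕ) : Program :=
  .seq (setIvar 4 lo) (.seq (setIvar 5 hi) (.seq (bisect 4 5 6 test) (setIvar tgt (ivar 4))))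

/-- `s'` agrees with `s` except for the integer arrays with numbers in `l`. -/
def SameBut (l : List ℕ) (s s' : State) : Prop :=
  s'.real = s.real ∧ ∀ k, k ∉ l → s'.int k = s.int k

/-- The side condition is needed because `hi` is evaluated after variable 4 has been overwritten by
`lo`. -/
theorem exists_search_halts (lo hi : IExp) (test : BExp) (tgt : ℕ)
    (hhi : ∀ s x, hi.eval (s.setInt 4 0 x) = hi.eval s) :
    ∃ C : ℕ, ∀ (s : State) (p : ℕ → Prop),
      (∀ s', SameBut [4, 5, 6] s s' → (test.holds s' ↔ p (s'.int 6 0))) →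
      lo.eval s < hi.eval s → ∀ N, hi.eval s - lo.eval s ≤ N →
      Halts (search lo hi test tgt) s (C * (Nat.clog 2 N + 1)) (fun s' =>
        SameBut [4, 5, 6, tgt] s s' ∧
        (∀ i, i ≠ 0 → tgt ∉ [4, 5, 6] → s'.int tgt i = s.int tgt i) ∧
        lo.eval s ≤ s'.int tgt 0 ∧ s'.int tgt 0 < hi.eval s ∧
        (s'.int tgt 0 = lo.eval s ∨ p (s'.int tgt 0)) ∧
        (s'.int tgt 0 + 1 = hi.eval s ∨ ¬ p (s'.int tgt 0 + 1))) := by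
  obtain ⟨C, hC⟩ := exists_bisect_halts (lo := 4) (hi := 5) (mid := 6) (by norm_num)
    (by norm_num) (by norm_num) test
  refine ⟨(setIvar 4 lo).bound + (setIvar 5 hi).bound + C + (setIvar tgt (ivar 4)).bound,
    fun s p hp hlt N hN => ?_⟩
  have h1 := loopFree_setIvar 4 lo
  have h2 := loopFree_setIvar 5 hi
  have h3 := loopFree_setIvar tgt (ivar 4)
  set s₂ := (s.setInt 4 0 (lo.eval s)).setInt 5 0 (hi.eval s) with hs₂
  have e4 : s₂.int 4 0 = lo.eval s := by simp [hs₂, State.setInt_int]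
  have e5 : s₂.int 5 0 = hi.eval s := by simp [hs₂, State.setInt_int]
  have hne : ∀ k, k ≠ 4 → k ≠ 5 → s₂.int k = s.int k := by
    intro k h4 h5
    simp [hs₂, State.setInt, h4, h5]
  have hw : ∀ k, k ≠ 4 → k ≠ 5 → k ≠ 6 → ¬ (bisect 4 5 6 test).WritesInt k := by
    intro k h4 h5 h6
    simp [bisect, Program.WritesInt, h4, h5, h6]
  have hwr : ∀ k, ¬ (bisect 4 5 6 test).WritesReal k := by
    intro k
    simp [bisect, Program.WritesReal]
  have key := (hC s₂ p (fun s' hs' => hp s' ⟨funext fun k => hs'.real k (hwr k), fun k hk => by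
    simp at hk
    rw [hs'.int k (hw k hk.1 hk.2.1 hk.2.2), hne k hk.1 hk.2.1]⟩)
    (by rw [e4, e5]; exact hlt) N (by rw [e4, e5]; exact hN)).frame
  have hall : Halts (search lo hi test tgt) s ((setIvar 4 lo).bound + ((setIvar 5 hi).bound +
      (C * (Nat.clog 2 N + 1) + (setIvar tgt (ivar 4)).bound))) (fun s' =>
        SameBut [4, 5, 6, tgt] s s' ∧
        (∀ i, i ≠ 0 → tgt ∉ [4, 5, 6] → s'.int tgt i = s.int tgt i) ∧
        lo.eval s ≤ s'.int tgt 0 ∧ s'.int tgt 0 < hi.eval s ∧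
        (s'.int tgt 0 = lo.eval s ∨ p (s'.int tgt 0)) ∧
        (s'.int tgt 0 + 1 = hi.eval s ∨ ¬ p (s'.int tgt 0 + 1))) := by
    refine Halts.seq (h1.halts (Halts.seq (h2.halts ?_)))
    rw [exec_setIvar, exec_setIvar, hhi]
    refine Halts.seq (key.mono le_rfl ?_)
    rintro s' ⟨⟨g1, g2, g3, g4, g5⟩, hf⟩
    refine h3.halts ?_
    rw [e4] at g2 g4
    rw [e5] at g3 g5
    rw [g1] at g3 g5
    refine ⟨⟨funext fun k => hf.real k (hwr k), fun k hk => ?_⟩, fun i hi ht => ?_, ?_⟩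
    · simp at hk
      rw [← hne k hk.1 hk.2.1, ← hf.int k (hw k hk.1 hk.2.1 hk.2.2.1)]
      simp [State.setInt, hk.2.2.2]
    · simp at ht
      simp only [exec_setIvar, State.setInt_int, hi, and_false, if_false]
      rw [hf.int tgt (hw _ ht.1 ht.2.1 ht.2.2), hne tgt ht.1 ht.2.1]
    · simp only [exec_setIvar, State.setInt_int, and_self, if_true, eval_ivar]
      exact ⟨g2, by omega, g4, g5⟩
  refine hall.mono ?_ fun _ h => h
  have : 1 ≤ Nat.clog 2 N + 1 := by omega
  nlinarith [Nat.le_mul_of_pos_right ((setIvar 4 lo).bound + (setIvar 5 hi).bound +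
    (setIvar tgt (ivar 4)).bound) (Nat.succ_pos (Nat.clog 2 N))]

/-! ### The anchors -/

/-- Is vertex `mid` farther to the left of the directed line `A B` than its predecessor? -/
def climbs (A B : IExp) : BExp :=
  .rlt (crossExp (vtx A) (vtx B) (vtx (.sub (ivar 6) (.const 1))))
    (crossExp (vtx A) (vtx B) (vtx (ivar 6)))

def orient : Program :=
  .ite (.rlt (crossExp (vtx (.const 0)) (vtx (.const 1)) (vtx (.const 2))) (.const 0))
    (setIvar 1 (.sub (ivar 0) (.const 1))) .skip

def lastIdx : IExp := .sub (ivar 0) (.const 1)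

def findAnchors : Program :=
  .seq (search (.const 1) lastIdx (climbs lastIdx (.const 0)) 2)
    (.seq (search (.const 0) (ivar 2) (climbs (ivar 2) (.const 0)) 8)
      (search (ivar 2) (ivar 0) (climbs (.const 0) (ivar 2)) 9))

theorem SameBut.vert_eq {l : List ℕ} {s s' : State} (h : SameBut l s s') (hl : 1 ∉ l) :
    vert s' = vert s :=
  vert_congr (by rw [h.1]) (by rw [h.1]) (by rw [h.2 1 hl])

/-- Each bisection stops at a vertex that is farther than its predecessor and not nearer than its
successor, or at an end of its range. For `m`, the ends are also covered because the two endpoints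
of the base edge lie on the base line. -/
theorem exists_findAnchors_halts :
    ∃ C : ℕ, ∀ (s : State) (n : ℕ), s.int 0 0 = n → 3 ≤ n → CCW (vert s) n →
      Halts findAnchors s (C * (Nat.clog 2 n + 1)) (fun s' =>
        SameBut [2, 4, 5, 6, 8, 9] s s' ∧
        Anchors (vert s) n (s'.int 2 0) (s'.int 8 0) (s'.int 9 0)) := by
  obtain ⟨C₁, h₁⟩ := exists_search_halts (.const 1) lastIdx (climbs lastIdx (.const 0)) 2
    (fun s x => by simp [lastIdx, State.setInt_int])
  obtain ⟨C₂, h₂⟩ := exists_search_halts (.const 0) (ivar 2) (climbs (ivar 2) (.const 0)) 8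
    (fun s x => by simp [State.setInt_int])
  obtain ⟨C₃, h₃⟩ := exists_search_halts (ivar 2) (ivar 0) (climbs (.const 0) (ivar 2)) 9
    (fun s x => by simp [State.setInt_int])
  refine ⟨C₁ + C₂ + C₃, fun s n hn hn3 hccw => ?_⟩
  have e0 : lastIdx.eval s = n - 1 := by simp [lastIdx, hn]
  have key : Halts findAnchors s (C₁ * (Nat.clog 2 n + 1) + (C₂ * (Nat.clog 2 n + 1) +
      C₃ * (Nat.clog 2 n + 1))) (fun s' =>
        SameBut [2, 4, 5, 6, 8, 9] s s' ∧
        Anchors (vert s) n (s'.int 2 0) (s'.int 8 0) (s'.int 9 0)) := by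
    refine Halts.seq ((h₁ s (fun i => cross (vert s (n - 1)) (vert s 0) (vert s (i - 1)) <
      cross (vert s (n - 1)) (vert s 0) (vert s i)) ?_ ?_ n ?_).mono le_rfl ?_)
    · intro s' hs'
      simp [climbs, lastIdx, hs'.vert_eq (by simp), hs'.2 0 (by simp), hn]
    · rw [e0]
      simp
      omega
    · rw [e0]
      omega
    rintro s₁ ⟨hs₁, -, g1, g2, g3, g4⟩
    rw [e0] at g2 g4
    simp only [eval_const] at g1 g3
    have v₁ := hs₁.vert_eq (by simp)
    have n₁ : s₁.int 0 0 = n := by rw [hs₁.2 0 (by simp), hn]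
    set m := s₁.int 2 0 with hm
    refine Halts.seq ((h₂ s₁ (fun i => cross (vert s m) (vert s 0) (vert s (i - 1)) <
      cross (vert s m) (vert s 0) (vert s i)) ?_ ?_ n ?_).mono le_rfl ?_)
    · intro s' hs'
      simp [climbs, hs'.vert_eq (by simp), hs'.2 2 (by simp), v₁, ← hm]
    · simp
      omega
    · simp
      omega
    rintro s₂ ⟨hs₂, -, k1, k2, k3, k4⟩
    simp only [eval_const, eval_ivar, ← hm] at k1 k2 k3 k4
    have v₂ : vert s₂ = vert s := by rw [hs₂.vert_eq (by simp), v₁]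
    have n₂ : s₂.int 0 0 = n := by rw [hs₂.2 0 (by simp), n₁]
    have m₂ : s₂.int 2 0 = m := by rw [hs₂.2 2 (by simp)]
    refine ((h₃ s₂ (fun i => cross (vert s 0) (vert s m) (vert s (i - 1)) <
      cross (vert s 0) (vert s m) (vert s i)) ?_ ?_ n ?_).mono le_rfl ?_)
    · intro s' hs'
      simp [climbs, hs'.vert_eq (by simp), hs'.2 2 (by simp), v₂, m₂]
    · simp [m₂, n₂]
      omega
    · simp [m₂, n₂]
    rintro s₃ ⟨hs₃, -, l1, l2, l3, l4⟩
    simp only [eval_const, eval_ivar, m₂, n₂] at l1 l2 l3 l4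
    have hbase : ∀ i, 0 < i → i + 1 < n → 0 < cross (vert s (n - 1)) (vert s 0) (vert s i) := by
      intro i h0 h1
      have := hccw 0 i (n - 1) h0 (by omega) (by omega)
      rwa [← cross_rotate, ← cross_rotate] at this
    refine ⟨⟨by rw [hs₃.1, hs₂.1, hs₁.1], fun k hk => ?_⟩, ?_⟩
    · simp at hk
      rw [hs₃.2 k (by simp; tauto), hs₂.2 k (by simp; tauto), hs₁.2 k (by simp; tauto)]
    rw [hs₃.2 2 (by simp), hs₃.2 8 (by simp), m₂]
    refine ⟨hccw, by omega, by omega, ?_, ?_, k2, ?_, ?_, l1, l2, l3, ?_⟩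
    · rcases g3 with g3 | g3
      · rw [g3]
        simpa using hbase 1 (by norm_num) (by omega)
      · exact g3
    · rcases g4 with g4 | g4
      · rw [g4, cross_self_outer]
        exact (hbase m (by omega) (by omega)).le
      · simpa using g4
    · exact k3
    · rcases k4 with k4 | k4
      · exact .inl k4
      · exact .inr (by simpa using k4)
    · rcases l4 with l4 | l4
      · exact .inl l4
      · exact .inr (by simpa using l4)
  refine key.mono ?_ fun _ h => h
  ring_nf
  omega

end RealRAM

/-! ### Lists of kept vertices, as built up by the greedy algorithm -/

/-- The indices `κ 0, …, κ (K - 1)` start with `0`, are increasing, and the vertices that they skip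
are not far beyond the chords. -/
structure Kernel (V : ℕ → Plane) (m : ℕ) (ε : ℝ) (κ : ℕ → ℕ) (K : ℕ) : Prop where
  pos : 0 < K
  zero : κ 0 = 0
  step : ∀ k, k + 1 < K → κ k < κ (k + 1)
  chord : ∀ k, k + 1 < K → ∀ u, κ k ≤ u → u ≤ κ (k + 1) →
    -cross (V (κ k)) (V (κ (k + 1))) (V u) ≤
      ε / 2 * ((cross (V (κ k)) (V (κ (k + 1))) (V 0) + cross (V (κ k)) (V (κ (k + 1))) (V m)) / 2)

theorem Kernel.lt {V : ℕ → Plane} {m : ℕ} {ε : ℝ} {κ : ℕ → ℕ} {K : ℕ} (h : Kernel V m ε κ K)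
    {i j : ℕ} (hij : i < j) (hj : j < K) : κ i < κ j := by
  induction j, hij using Nat.le_induction with
  | base => exact h.step i hj
  | succ j hij ih => exact (ih (by omega)).trans (h.step j hj)

theorem Kernel.congr {V : ℕ → Plane} {m : ℕ} {ε : ℝ} {κ κ' : ℕ → ℕ} {K : ℕ}
    (h : Kernel V m ε κ K) (he : ∀ i < K, κ' i = κ i) : Kernel V m ε κ' K := by
  refine ⟨h.pos, by rw [he 0 h.pos, h.zero], fun k hk => ?_, fun k hk => ?_⟩
  · rw [he k (by omega), he _ hk]
    exact h.step k hk
  · rw [he k (by omega), he _ hk]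
    exact h.chord k hk

theorem Kernel.push {V : ℕ → Plane} {m : ℕ} {ε : ℝ} {κ κ' : ℕ → ℕ} {K t : ℕ}
    (h : Kernel V m ε κ K) (he : ∀ i < K, κ' i = κ i) (hK : κ' K = t) (hlt : κ (K - 1) < t)
    (hch : ∀ u, κ (K - 1) ≤ u → u ≤ t → -cross (V (κ (K - 1))) (V t) (V u) ≤
      ε / 2 * ((cross (V (κ (K - 1))) (V t) (V 0) + cross (V (κ (K - 1))) (V t) (V m)) / 2)) :
    Kernel V m ε κ' (K + 1) := by
  have hpos := h.pos
  refine ⟨by omega, by rw [he 0 hpos, h.zero], fun k hk => ?_, fun k hk => ?_⟩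
  · rcases Nat.lt_or_ge (k + 1) K with hk' | hk'
    · rw [he k (by omega), he _ hk']
      exact h.step k hk'
    · obtain rfl : K = k + 1 := by omega
      rw [he k (by omega), hK]
      exact hlt
  · rcases Nat.lt_or_ge (k + 1) K with hk' | hk'
    · rw [he k (by omega), he _ hk']
      exact h.chord k hk'
    · obtain rfl : K = k + 1 := by omega
      rw [he k (by omega), hK]
      exact hch

namespace RealRAM

/-! ### The greedy sparsification of a chain

The chain between the vertices with numbers in the integer variables `10` and `11` is traversed with
variable `3`; the selected indices are appended to the integer array `15` of length variable `7`. -/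

def scaledExp (P Q : PExp) (i : IExp) : RExp :=
  .div (crossExp P Q (vtx i))
    (.sub (crossExp P Q (vtx (ivar 11))) (crossExp P Q (vtx (ivar 10))))

def baseExp : IExp → RExp := scaledExp (vtx lastIdx) (vtx (.const 0))
def sideExp : IExp → RExp := scaledExp (vtx (ivar 2)) (vtx (.const 0))

def slopeExp (j : IExp) : RExp :=
  let i : IExp := .sub j (.const 1)
  .div (.sub (sideExp j) (sideExp i))
    (.add (.sub (baseExp j) (baseExp i)) (.sub (sideExp j) (sideExp i)))

def deviationExp (s t : IExp) : RExp :=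
  let d : RExp := .add (.sub (baseExp t) (baseExp s)) (.sub (sideExp t) (sideExp s))
  let e : RExp := .sub (slopeExp t) (slopeExp (.add s (.const 1)))
  .add (.mul d d) (.mul e e)

/-- The deviation that `deviationExp` computes. -/
def stateDeviation (s : State) (i j : ℕ) : ℝ :=
  deviation
    (scaled (vert s) (vert s (s.int 0 0 - 1)) (vert s 0) (s.int 10 0) (s.int 11 0))
    (scaled (vert s) (vert s (s.int 2 0)) (vert s 0) (s.int 10 0) (s.int 11 0)) i j

theorem eval_deviationExp (s : State) (i j : IExp) :
    (deviationExp i j).eval s = stateDeviation s (i.eval s) (j.eval s) := by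
  simp [deviationExp, stateDeviation, deviation, edgeSlope, slopeExp, sideExp, baseExp, scaledExp,
    scaled, lastIdx]
  ring

def chainTest : BExp :=
  .not (.rlt (.mul (.const (1 / 4)) (.get 2 (.const 0))) (deviationExp (ivar 3) (ivar 6)))

/-- The search starts one past the current vertex, which is always acceptable since no vertex is
skipped, and its upper end is one past the end of the chain, which is never tested. -/
def chainStep : Program :=
  .seq (search (.add (ivar 3) (.const 1)) (.add (ivar 11) (.const 1)) chainTest 3)
    (.seq (.setI 15 (ivar 7) (ivar 3)) (setIvar 7 (.add (ivar 7) (.const 1))))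

def chainLoop : Program := .loop (.ilt (ivar 3) (ivar 11)) chainStep

theorem SameBut.deviation_eq {l : List ℕ} {s s' : State} (h : SameBut l s s') (h1 : 1 ∉ l)
    (h0 : 0 ∉ l) (h2 : 2 ∉ l) (h10 : 10 ∉ l) (h11 : 11 ∉ l) :
    stateDeviation s' = stateDeviation s := by
  funext i j
  simp only [stateDeviation, h.vert_eq h1, h.2 0 h0, h.2 2 h2, h.2 10 h10, h.2 11 h11]

theorem exists_chainStep_halts :
    ∃ C : ℕ, ∀ (s : State) (n : ℕ), s.int 3 0 < s.int 11 0 → s.int 11 0 < n →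
      Halts chainStep s (C * (Nat.clog 2 n + 1)) (fun s' => SameBut [3, 4, 5, 6, 7, 15] s s' ∧
        s'.int 7 0 = s.int 7 0 + 1 ∧ s'.int 15 (s.int 7 0) = s'.int 3 0 ∧
        (∀ i < s.int 7 0, s'.int 15 i = s.int 15 i) ∧ s.int 3 0 < s'.int 3 0 ∧
        s'.int 3 0 ≤ s.int 11 0 ∧
        (s'.int 3 0 = s.int 3 0 + 1 ∨
          stateDeviation s (s.int 3 0) (s'.int 3 0) ≤ s.real 2 0 / 4) ∧
        (s'.int 3 0 = s.int 11 0 ∨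
          s.real 2 0 / 4 < stateDeviation s (s.int 3 0) (s'.int 3 0 + 1))) := by
  obtain ⟨C, hC⟩ := exists_search_halts (.add (ivar 3) (.const 1)) (.add (ivar 11) (.const 1))
    chainTest 3 (fun s x => by simp [State.setInt_int])
  set fin : Program := .seq (.setI 15 (ivar 7) (ivar 3)) (setIvar 7 (.add (ivar 7) (.const 1)))
    with hfin
  have hfree : fin.LoopFree := ⟨trivial, trivial⟩
  refine ⟨C + fin.bound, fun s n h1 h2 => ?_⟩
  have key : Halts chainStep s (C * (Nat.clog 2 n + 1) + fin.bound) (fun s' =>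
      SameBut [3, 4, 5, 6, 7, 15] s s' ∧
        s'.int 7 0 = s.int 7 0 + 1 ∧ s'.int 15 (s.int 7 0) = s'.int 3 0 ∧
        (∀ i < s.int 7 0, s'.int 15 i = s.int 15 i) ∧ s.int 3 0 < s'.int 3 0 ∧
        s'.int 3 0 ≤ s.int 11 0 ∧
        (s'.int 3 0 = s.int 3 0 + 1 ∨
          stateDeviation s (s.int 3 0) (s'.int 3 0) ≤ s.real 2 0 / 4) ∧
        (s'.int 3 0 = s.int 11 0 ∨
          s.real 2 0 / 4 < stateDeviation s (s.int 3 0) (s'.int 3 0 + 1))) := by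
    refine Halts.seq ((hC s (fun t => stateDeviation s (s.int 3 0) t ≤ s.real 2 0 / 4) ?_ ?_ n
      ?_).mono le_rfl ?_)
    · intro s' hs'
      simp only [chainTest, holds_not, holds_rlt, eval_deviationExp, not_lt,
        hs'.deviation_eq (by simp) (by simp) (by simp) (by simp) (by simp), eval_ivar,
        hs'.2 3 (by simp), reval_mul, reval_const, reval_get, eval_const, hs'.1]
      rw [show ((1 / 4 : ℚ) : ℝ) * s.real 2 0 = s.real 2 0 / 4 by push_cast; ring]
    · simpa using h1
    · simp
      omega
    rintro s₁ ⟨hs₁, -, g1, g2, g3, g4⟩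
    simp only [eval_add, eval_ivar, eval_const] at g1 g2 g3 g4
    refine hfree.halts ?_
    have e7 : s₁.int 7 0 = s.int 7 0 := by rw [hs₁.2 7 (by simp)]
    have e15 : s₁.int 15 = s.int 15 := by rw [hs₁.2 15 (by simp)]
    have hex : fin.exec s₁ = (s₁.setInt 15 (s.int 7 0) (s₁.int 3 0)).setInt 7 0
        (s.int 7 0 + 1) := by
      simp [hfin, Program.exec, State.setInt_int, e7]
    rw [hex]
    refine ⟨⟨by simp [hs₁.1], fun k hk => ?_⟩, ?_, ?_, ?_, ?_⟩
    · simp at hk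
      rw [← hs₁.2 k (by simp; tauto)]
      simp [State.setInt, hk]
    · simp [State.setInt_int]
    · simp [State.setInt_int]
    · intro i hi
      simp [State.setInt_int, hi.ne, e15]
    · simp only [State.setInt_int]
      norm_num
      refine ⟨by omega, by omega, g3, ?_⟩
      rcases g4 with g4 | g4
      · exact .inl (by omega)
      · exact .inr (not_le.1 g4)
  refine key.mono ?_ fun _ h => h
  have : 1 ≤ Nat.clog 2 n + 1 := by omega
  nlinarith [Nat.le_mul_of_pos_right fin.bound (Nat.succ_pos (Nat.clog 2 n))]

/-- A piece from s to t that stops short of the end would have been too large if extended to t + 1,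
so Z(t + 1) - Z(s) ≥ √ε/2. Since Z is monotone, each such piece increases Z(t) + Z(t + 1) by this
amount; the total is at most 6, so there are at most 12/√ε of them, and one last piece. -/
theorem exists_chainLoop_halts :
    ∃ C : ℕ, ∀ (s : State) (n N : ℕ) (ε : ℝ), s.int 0 0 = n → CCW (vert s) n → s.int 2 0 < n →
      s.real 2 0 = ε → 0 < ε → 12 / Real.sqrt ε ≤ N →
      BoxChain (vert s) n (s.int 2 0) (vert s (n - 1)) (vert s 0) (vert s (s.int 2 0)) (vert s 0)
        (s.int 10 0) (s.int 11 0) →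
      s.int 3 0 = s.int 10 0 → Kernel (vert s) (s.int 2 0) ε (s.int 15) (s.int 7 0) →
      s.int 15 (s.int 7 0 - 1) = s.int 3 0 →
      Halts chainLoop s (C * ((N + 1) * (Nat.clog 2 n + 1))) (fun s' =>
        SameBut [3, 4, 5, 6, 7, 15] s s' ∧
        Kernel (vert s) (s.int 2 0) ε (s'.int 15) (s'.int 7 0) ∧
        s'.int 15 (s'.int 7 0 - 1) = s'.int 3 0 ∧ s'.int 3 0 = s.int 11 0 ∧
        s'.int 7 0 ≤ s.int 7 0 + (N + 1)) := by
  obtain ⟨C, hC⟩ := exists_chainStep_halts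
  refine ⟨2 * (C + (BExp.ilt (ivar 3) (ivar 11)).cost + 1),
    fun s n N ε hn hccw hm hreal hε hN hbox hstart hker hlast => ?_⟩
  obtain ⟨Z, hZ, hZ3, hZd⟩ := hbox.exists_potential hccw hε
  have hsq : 0 < Real.sqrt ε := Real.sqrt_pos.2 hε
  have hZm : ∀ u v, s.int 10 0 ≤ u → u ≤ v → v ≤ s.int 11 0 → Z u ≤ Z v := fun u v h1 h2 h3 =>
    le_of_step (s := s.int 10 0) (t := s.int 11 0) hZ h1 h2 h3
  have key := Halts.loop (b := .ilt (ivar 3) (ivar 11)) (c := chainStep)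
    (T := C * (Nat.clog 2 n + 1))
    (fun s' => SameBut [3, 4, 5, 6, 7, 15] s s' ∧
      Kernel (vert s) (s.int 2 0) ε (s'.int 15) (s'.int 7 0) ∧
      s'.int 15 (s'.int 7 0 - 1) = s'.int 3 0 ∧ s.int 10 0 ≤ s'.int 3 0 ∧
      s'.int 3 0 ≤ s.int 11 0 ∧ s.int 7 0 ≤ s'.int 7 0 ∧ s'.int 7 0 ≤ s.int 7 0 + (N + 1) ∧
      -- The count is claimed only before the end is reached, because the last piece may be
      -- arbitrarily small; this is why the list may grow by `N + 1`.
      (s'.int 3 0 < s.int 11 0 → ((s'.int 7 0 : ℝ) - s.int 7 0) * (Real.sqrt ε / 2) ≤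
        Z (s'.int 3 0) + Z (s'.int 3 0 + 1) - 2 * Z (s.int 10 0)))
    (fun s' => s.int 7 0 + (N + 1) - s'.int 7 0) ?_ (s := s)
    ⟨⟨rfl, fun _ _ => rfl⟩, hker, hlast, hstart.ge, by rw [hstart]; exact hbox.le, le_rfl, by omega,
      fun h => ?_⟩ (N := N + 1) (by omega)
  · refine Halts.mono key ?_ ?_
    · have : 1 ≤ Nat.clog 2 n + 1 := by omega
      set c := (BExp.ilt (ivar 3) (ivar 11)).cost
      calc (N + 1 + 1) * (C * (Nat.clog 2 n + 1) + c + 1)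
          ≤ (2 * (N + 1)) * ((C + c + 1) * (Nat.clog 2 n + 1)) := by
            apply Nat.mul_le_mul
            · omega
            · nlinarith
        _ = _ := by ring
    · rintro s' ⟨⟨h1, h2, h3, h4, h5, h6, h7, h8⟩, h9⟩
      simp [h1.2 11] at h9
      exact ⟨h1, h2, h3, by omega, h7⟩
  · rintro s' ⟨h1, h2, h3, h4, h5, h6, h7, h8⟩ h9
    simp only [holds_ilt, eval_ivar] at h9
    have e11 : s'.int 11 0 = s.int 11 0 := by rw [h1.2 11 (by simp)]
    have ev := h1.vert_eq (by simp)
    have ed := h1.deviation_eq (by simp) (by simp) (by simp) (by simp) (by simp)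
    have er : s'.real 2 0 = ε := by rw [h1.1, hreal]
    rw [e11] at h9
    have hlt := hbox.lt
    refine (hC s' n (by rw [e11]; exact h9) (by rw [e11]; exact hlt)).mono le_rfl ?_
    rintro s'' ⟨g1, g2, g3, g4, g5, g6, g7, g8⟩
    rw [ed, er] at g7 g8
    rw [e11] at g6 g8
    have hcount := h8 h9
    have hk : s'.int 7 0 ≤ s.int 7 0 + N := by
      have u1 := hZm (s'.int 3 0) (s.int 11 0) h4 h5 le_rfl
      have u2 := hZm (s'.int 3 0 + 1) (s.int 11 0) (by omega) h9 le_rfl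
      have u3 : ((s'.int 7 0 : ℝ) - s.int 7 0) * Real.sqrt ε ≤ 12 := by linarith
      rw [← le_div_iff₀ hsq] at u3
      have : (s'.int 7 0 : ℝ) ≤ ((s.int 7 0 + N : ℕ) : ℝ) := by
        push_cast
        linarith
      exact_mod_cast this
    have edev : stateDeviation s = deviation
        (scaled (vert s) (vert s (n - 1)) (vert s 0) (s.int 10 0) (s.int 11 0))
        (scaled (vert s) (vert s (s.int 2 0)) (vert s 0) (s.int 10 0) (s.int 11 0)) := by
      funext i j
      rw [stateDeviation, hn]
    rw [edev] at g7 g8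
    refine ⟨⟨⟨g1.1.trans h1.1, fun k hk => (g1.2 k hk).trans (h1.2 k hk)⟩, ?_, ?_, by omega, g6,
      by omega, by omega, fun hlt' => ?_⟩, by omega⟩
    · rw [g2]
      refine h2.push g4 g3 (by rw [h3]; exact g5) ?_
      rw [h3]
      exact fun u hu hu' => hbox.chord hccw hm hε h4 g5 g6 hu hu' g7
    · rw [g2]
      simpa using g3
    · have hd := hZd (s'.int 3 0) (s''.int 3 0 + 1) h4 (by omega) hlt'
        (g8.resolve_left hlt'.ne)
      have u1 := hZm (s'.int 3 0 + 1) (s''.int 3 0) (by omega) g5 g6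
      rw [g2]
      push_cast
      linarith
  · rw [hstart, sub_self, zero_mul]
    have := hZ (s.int 10 0) le_rfl (by omega)
    linarith

/-- Sparsify the chain from the current vertex to the vertex with number `e`. -/
def chain (e : IExp) : Program :=
  .seq (setIvar 10 (ivar 3)) (.seq (setIvar 11 e) chainLoop)

theorem exists_chain_halts (e : IExp) (he : ∀ s x, e.eval (s.setInt 10 0 x) = e.eval s) :
    ∃ C : ℕ, ∀ (s : State) (n N : ℕ) (ε : ℝ), s.int 0 0 = n → CCW (vert s) n → s.int 2 0 < n →
      s.real 2 0 = ε → 0 < ε → 12 / Real.sqrt ε ≤ N →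
      BoxChain (vert s) n (s.int 2 0) (vert s (n - 1)) (vert s 0) (vert s (s.int 2 0)) (vert s 0)
        (s.int 3 0) (e.eval s) →
      Kernel (vert s) (s.int 2 0) ε (s.int 15) (s.int 7 0) →
      s.int 15 (s.int 7 0 - 1) = s.int 3 0 →
      Halts (chain e) s (C * ((N + 1) * (Nat.clog 2 n + 1))) (fun s' =>
        SameBut [3, 4, 5, 6, 7, 10, 11, 15] s s' ∧
        Kernel (vert s) (s.int 2 0) ε (s'.int 15) (s'.int 7 0) ∧
        s'.int 15 (s'.int 7 0 - 1) = s'.int 3 0 ∧ s'.int 3 0 = e.eval s ∧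
        s'.int 7 0 ≤ s.int 7 0 + (N + 1)) := by
  obtain ⟨C, hC⟩ := exists_chainLoop_halts
  refine ⟨(setIvar 10 (ivar 3)).bound + (setIvar 11 e).bound + C,
    fun s n N ε hn hccw hm hreal hε hN hbox hker hlast => ?_⟩
  set s₁ := (s.setInt 10 0 (s.int 3 0)).setInt 11 0 (e.eval s) with hs₁
  have hsame : SameBut [10, 11] s s₁ := by
    refine ⟨rfl, fun k hk => ?_⟩
    simp at hk
    simp [hs₁, State.setInt, hk]
  have e10 : s₁.int 10 0 = s.int 3 0 := by simp [hs₁, State.setInt_int]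
  have e11 : s₁.int 11 0 = e.eval s := by simp [hs₁, State.setInt_int]
  have ev := hsame.vert_eq (by simp)
  have e0 : s₁.int 0 = s.int 0 := hsame.2 0 (by simp)
  have e2 : s₁.int 2 = s.int 2 := hsame.2 2 (by simp)
  have e3 : s₁.int 3 = s.int 3 := hsame.2 3 (by simp)
  have e7 : s₁.int 7 = s.int 7 := hsame.2 7 (by simp)
  have e15 : s₁.int 15 = s.int 15 := hsame.2 15 (by simp)
  have key : Halts (chain e) s ((setIvar 10 (ivar 3)).bound + ((setIvar 11 e).bound +
      C * ((N + 1) * (Nat.clog 2 n + 1)))) (fun s' =>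
        SameBut [3, 4, 5, 6, 7, 10, 11, 15] s s' ∧
        Kernel (vert s) (s.int 2 0) ε (s'.int 15) (s'.int 7 0) ∧
        s'.int 15 (s'.int 7 0 - 1) = s'.int 3 0 ∧ s'.int 3 0 = e.eval s ∧
        s'.int 7 0 ≤ s.int 7 0 + (N + 1)) := by
    refine Halts.seq ((loopFree_setIvar _ _).halts (Halts.seq ((loopFree_setIvar _ _).halts ?_)))
    rw [exec_setIvar, exec_setIvar, he, eval_ivar, ← hs₁]
    refine (hC s₁ n N ε (by rw [e0, hn]) (by rw [ev]; exact hccw) (by rw [e2]; exact hm) hreal hε hN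
      (by rw [ev, e2, e10, e11]; exact hbox) (by rw [e10, e3])
      (by rw [ev, e2, e7, e15]; exact hker) (by rw [e3, e7, e15]; exact hlast)).mono le_rfl ?_
    rintro s' ⟨h1, h2, h3, h4, h5⟩
    rw [ev, e2] at h2
    rw [e11] at h4
    rw [e7] at h5
    refine ⟨⟨h1.1, fun k hk => ?_⟩, h2, h3, h4, h5⟩
    simp at hk
    rw [h1.2 k (by simp; tauto), hsame.2 k (by simp; tauto)]
  refine key.mono ?_ fun _ h => h
  have : 1 ≤ (N + 1) * (Nat.clog 2 n + 1) := Nat.mul_pos (by omega) (by omega)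
  nlinarith [Nat.le_mul_of_pos_right ((setIvar 10 (ivar 3)).bound + (setIvar 11 e).bound) this]

def kernelInit : Program :=
  .seq (setIvar 3 (.const 0)) (.seq (.setI 15 (.const 0) (.const 0)) (setIvar 7 (.const 1)))

/-- Select the vertices of a sparse polygon. -/
def kernel : Program :=
  .seq kernelInit
    (.seq (chain (ivar 8)) (.seq (chain (ivar 2)) (.seq (chain (ivar 9)) (chain lastIdx))))

/-- Consecutive chains share their end vertices, so the lists are simply concatenated: one initial
vertex and at most `N + 1` new ones per chain. -/
theorem exists_kernel_halts :
    ∃ C : ℕ, ∀ (s : State) (n N : ℕ) (ε : ℝ), s.int 0 0 = n →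
      Anchors (vert s) n (s.int 2 0) (s.int 8 0) (s.int 9 0) →
      s.real 2 0 = ε → 0 < ε → 12 / Real.sqrt ε ≤ N →
      Halts kernel s (C * ((N + 1) * (Nat.clog 2 n + 1))) (fun s' =>
        SameBut [3, 4, 5, 6, 7, 10, 11, 15] s s' ∧
        Kernel (vert s) (s.int 2 0) ε (s'.int 15) (s'.int 7 0) ∧
        s'.int 15 (s'.int 7 0 - 1) = n - 1 ∧ s'.int 7 0 ≤ 5 * (N + 1)) := by
  obtain ⟨C₀, h₀⟩ := exists_chain_halts (ivar 8) (fun s x => by simp [State.setInt_int])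
  obtain ⟨C₁, h₁⟩ := exists_chain_halts (ivar 2) (fun s x => by simp [State.setInt_int])
  obtain ⟨C₂, h₂⟩ := exists_chain_halts (ivar 9) (fun s x => by simp [State.setInt_int])
  obtain ⟨C₃, h₃⟩ := exists_chain_halts lastIdx (fun s x => by simp [lastIdx, State.setInt_int])
  refine ⟨kernelInit.bound + C₀ + C₁ + C₂ + C₃, fun s n N ε hn ha hreal hε hN => ?_⟩
  have hinit : kernelInit.LoopFree := ⟨trivial, trivial, trivial⟩
  have hm : s.int 2 0 < n := by have := ha.m_lt; omega
  set M := (N + 1) * (Nat.clog 2 n + 1) with hM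
  have hadv : ∀ (s' : State) (e : IExp) (C : ℕ), (∀ (s : State) (n N : ℕ) (ε : ℝ), s.int 0 0 = n →
      CCW (vert s) n → s.int 2 0 < n →
      s.real 2 0 = ε → 0 < ε → 12 / Real.sqrt ε ≤ N →
      BoxChain (vert s) n (s.int 2 0) (vert s (n - 1)) (vert s 0) (vert s (s.int 2 0)) (vert s 0)
        (s.int 3 0) (e.eval s) →
      Kernel (vert s) (s.int 2 0) ε (s.int 15) (s.int 7 0) →
      s.int 15 (s.int 7 0 - 1) = s.int 3 0 →
      Halts (chain e) s (C * ((N + 1) * (Nat.clog 2 n + 1))) (fun s' =>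
        SameBut [3, 4, 5, 6, 7, 10, 11, 15] s s' ∧
        Kernel (vert s) (s.int 2 0) ε (s'.int 15) (s'.int 7 0) ∧
        s'.int 15 (s'.int 7 0 - 1) = s'.int 3 0 ∧ s'.int 3 0 = e.eval s ∧
        s'.int 7 0 ≤ s.int 7 0 + (N + 1))) →
      SameBut [3, 4, 5, 6, 7, 10, 11, 15] s s' → ∀ i₀ i₁ : ℕ, s'.int 3 0 = i₀ → e.eval s' = i₁ →
      BoxChain (vert s) n (s.int 2 0) (vert s (n - 1)) (vert s 0) (vert s (s.int 2 0)) (vert s 0)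
        i₀ i₁ → Kernel (vert s) (s.int 2 0) ε (s'.int 15) (s'.int 7 0) →
      s'.int 15 (s'.int 7 0 - 1) = s'.int 3 0 →
      Halts (chain e) s' (C * M) (fun s'' => SameBut [3, 4, 5, 6, 7, 10, 11, 15] s s'' ∧
        Kernel (vert s) (s.int 2 0) ε (s''.int 15) (s''.int 7 0) ∧
        s''.int 15 (s''.int 7 0 - 1) = s''.int 3 0 ∧ s''.int 3 0 = i₁ ∧
        s''.int 7 0 ≤ s'.int 7 0 + (N + 1)) := by
    intro s' e C hC hs i₀ i₁ hi₀ hi₁ hbox hker hlast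
    have ev := hs.vert_eq (by simp)
    have e2 : s'.int 2 = s.int 2 := hs.2 2 (by simp)
    refine (hC s' n N ε (by rw [hs.2 0 (by simp), hn]) (by rw [ev]; exact ha.ccw)
      (by rw [e2]; exact hm) (by rw [hs.1, hreal]) hε hN
      (by rw [ev, e2, hi₀, hi₁]; exact hbox) (by rw [ev, e2]; exact hker) hlast).mono le_rfl ?_
    rintro s'' ⟨g1, g2, g3, g4, g5⟩
    rw [ev, e2] at g2
    exact ⟨⟨g1.1.trans hs.1, fun k hk => (g1.2 k hk).trans (hs.2 k hk)⟩, g2, g3, g4.trans hi₁, g5⟩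
  have key : Halts kernel s (kernelInit.bound + (C₀ * M + (C₁ * M + (C₂ * M + C₃ * M))))
      (fun s' => SameBut [3, 4, 5, 6, 7, 10, 11, 15] s s' ∧
        Kernel (vert s) (s.int 2 0) ε (s'.int 15) (s'.int 7 0) ∧
        s'.int 15 (s'.int 7 0 - 1) = n - 1 ∧ s'.int 7 0 ≤ 5 * (N + 1)) := by
    refine Halts.seq (hinit.halts ?_)
    set s₀ := kernelInit.exec s with hs₀
    have hs₀' : s₀ = ((s.setInt 3 0 0).setInt 15 0 0).setInt 7 0 1 := by
      simp [hs₀, kernelInit, Program.exec]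
    have hsame : SameBut [3, 4, 5, 6, 7, 10, 11, 15] s s₀ := by
      rw [hs₀']
      refine ⟨rfl, fun k hk => ?_⟩
      simp at hk
      simp [State.setInt, hk]
    have i3 : s₀.int 3 0 = 0 := by simp [hs₀', State.setInt_int]
    have i7 : s₀.int 7 0 = 1 := by simp [hs₀', State.setInt_int]
    have i15 : s₀.int 15 0 = 0 := by simp [hs₀', State.setInt_int]
    have hk₀ : Kernel (vert s) (s.int 2 0) ε (s₀.int 15) (s₀.int 7 0) := by
      rw [i7]
      exact ⟨by norm_num, i15, fun k hk => by omega, fun k hk => by omega⟩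
    refine Halts.seq ((hadv s₀ (ivar 8) C₀ h₀ hsame 0 (s.int 8 0) i3
      (by rw [eval_ivar, hsame.2 8 (by simp)]) ha.chain₀ hk₀ (by rw [i7, i15, i3])).mono le_rfl ?_)
    rintro s₁ ⟨b1, b2, b3, b4, b5⟩
    refine Halts.seq ((hadv s₁ (ivar 2) C₁ h₁ b1 (s.int 8 0) (s.int 2 0) b4
      (by rw [eval_ivar, b1.2 2 (by simp)]) ha.chain₁ b2 b3).mono le_rfl ?_)
    rintro s₂ ⟨c1, c2, c3, c4, c5⟩
    refine Halts.seq ((hadv s₂ (ivar 9) C₂ h₂ c1 (s.int 2 0) (s.int 9 0) c4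
      (by rw [eval_ivar, c1.2 9 (by simp)]) ha.chain₂ c2 c3).mono le_rfl ?_)
    rintro s₃ ⟨d1, d2, d3, d4, d5⟩
    refine (hadv s₃ lastIdx C₃ h₃ d1 (s.int 9 0) (n - 1) d4
      (by simp [lastIdx, d1.2 0, hn]) ha.chain₃ d2 d3).mono le_rfl ?_
    rintro s₄ ⟨f1, f2, f3, f4, f5⟩
    refine ⟨f1, f2, f3.trans f4, by omega⟩
  refine key.mono ?_ fun _ h => h
  have : 1 ≤ M := Nat.mul_pos (by omega) (by omega)
  nlinarith [Nat.le_mul_of_pos_right kernelInit.bound this]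

/-- Append a second copy of the list of selected indices. -/
def double : Program :=
  .seq (setIvar 12 (.const 0)) (.loop (.ilt (ivar 12) (ivar 7))
    (.seq (.setI 15 (.add (ivar 7) (ivar 12)) (.get 15 (ivar 12)))
      (setIvar 12 (.add (ivar 12) (.const 1)))))

theorem exists_double_halts :
    ∃ C : ℕ, ∀ s : State, Halts double s (C * (s.int 7 0 + 1)) (fun s' =>
      SameBut [12, 15] s s' ∧ (∀ i < s.int 7 0, s'.int 15 i = s.int 15 i) ∧
        ∀ i < s.int 7 0, s'.int 15 (i + s.int 7 0) = s.int 15 i) := by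
  set body : Program := .seq (.setI 15 (.add (ivar 7) (ivar 12)) (.get 15 (ivar 12)))
      (setIvar 12 (.add (ivar 12) (.const 1))) with hbody
  have hfree : body.LoopFree := ⟨trivial, trivial⟩
  refine ⟨(setIvar 12 (.const 0)).bound + body.bound + (BExp.ilt (ivar 12) (ivar 7)).cost + 1,
    fun s => ?_⟩
  have key := Halts.loop (b := .ilt (ivar 12) (ivar 7)) (c := body) (T := body.bound)
    (fun s' => SameBut [12, 15] s s' ∧ (∀ i < s.int 7 0, s'.int 15 i = s.int 15 i) ∧
      s'.int 12 0 ≤ s.int 7 0 ∧ ∀ i < s'.int 12 0, s'.int 15 (i + s.int 7 0) = s.int 15 i)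
    (fun s' => s.int 7 0 - s'.int 12 0) ?_ (s := s.setInt 12 0 0) ?_ (N := s.int 7 0) (by simp)
  · have hall : Halts double s ((setIvar 12 (.const 0)).bound + (s.int 7 0 + 1) *
        (body.bound + (BExp.ilt (ivar 12) (ivar 7)).cost + 1)) (fun s' =>
        SameBut [12, 15] s s' ∧ (∀ i < s.int 7 0, s'.int 15 i = s.int 15 i) ∧
        ∀ i < s.int 7 0, s'.int 15 (i + s.int 7 0) = s.int 15 i) := by
      refine Halts.seq ((loopFree_setIvar _ _).halts ?_)
      rw [exec_setIvar]
      refine Halts.mono key le_rfl ?_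
      rintro s' ⟨⟨h1, h2, h3, h4⟩, h5⟩
      simp [h1.2 7] at h5
      exact ⟨h1, h2, fun i hi => h4 i (by omega)⟩
    refine hall.mono ?_ fun _ h => h
    nlinarith [Nat.le_mul_of_pos_right (setIvar 12 (.const 0)).bound (Nat.succ_pos (s.int 7 0))]
  · rintro s' ⟨h1, h2, h3, h4⟩ h5
    have e7 : s'.int 7 0 = s.int 7 0 := by rw [h1.2 7 (by simp)]
    simp only [holds_ilt, eval_ivar, e7] at h5
    refine hfree.halts ?_
    have hex : body.exec s' = (s'.setInt 15 (s.int 7 0 + s'.int 12 0)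
        (s'.int 15 (s'.int 12 0))).setInt 12 0 (s'.int 12 0 + 1) := by
      simp [hbody, Program.exec, State.setInt_int, e7]
    rw [hex]
    refine ⟨⟨⟨h1.1, fun k hk => ?_⟩, fun i hi => ?_, ?_, fun i hi => ?_⟩, ?_⟩
    · simp at hk
      rw [← h1.2 k (by simp; tauto)]
      simp [State.setInt, hk]
    · simp [State.setInt_int, h2 i hi]
      intro h
      omega
    · simp [State.setInt_int]
      omega
    · simp [State.setInt_int] at hi ⊢
      split_ifs with h
      · obtain rfl : i = s'.int 12 0 := by omega
        exact h2 _ (by omega)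
      · exact h4 i (by omega)
    · simp [State.setInt_int]
      omega
  · refine ⟨⟨rfl, fun k hk => ?_⟩, fun i hi => ?_, ?_, fun i hi => ?_⟩
    · simp at hk
      simp [State.setInt, hk]
    · simp [State.setInt_int]
    · simp [State.setInt_int]
    · simp [State.setInt_int] at hi

/-! ### Largest triangles with a corner at a given vertex -/

/-- An inequality `A x + B y + E ≥ 0` with coefficients given by expressions. -/
structure LinExp where
  A : RExp
  B : RExp
  E : RExp

def LinExp.eval (s : State) (g : LinExp) : Lin := ⟨g.A.eval s, g.B.eval s, g.E.eval s⟩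

def LinExp.valExp (g : LinExp) (x y : RExp) : RExp := .add (.add (.mul g.A x) (.mul g.B y)) g.E

def LinExp.meetX (g h : LinExp) : RExp :=
  .div (.sub (.mul g.B h.E) (.mul h.B g.E)) (.sub (.mul g.A h.B) (.mul h.A g.B))

def LinExp.meetY (g h : LinExp) : RExp :=
  .div (.sub (.mul h.A g.E) (.mul g.A h.E)) (.sub (.mul g.A h.B) (.mul h.A g.B))

/-- The conjunction of a list of tests. -/
def allTests : List BExp → BExp
  | [] => .not (.ilt (.const 0) (.const 0))
  | b :: l => .and b (allTests l)

theorem holds_allTests (s : State) (l : List BExp) :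
    (allTests l).holds s ↔ ∀ b ∈ l, b.holds s := by
  induction l with
  | nil => simp [allTests]
  | cons b l ih => simp [allTests, ih]

def runAll : List Program → Program
  | [] => .skip
  | c :: l => .seq c (runAll l)

theorem loopFree_runAll {l : List Program} (h : ∀ c ∈ l, c.LoopFree) : (runAll l).LoopFree := by
  induction l with
  | nil => trivial
  | cons c l ih => exact ⟨h c (by simp), ih fun d hd => h d (by simp [hd])⟩

def lins : List (Fin 3 ⊕ Fin 3) := [.inl 0, .inl 1, .inl 2, .inr 0, .inr 1, .inr 2]

theorem mem_lins (i : Fin 3 ⊕ Fin 3) : i ∈ lins := by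
  rcases i with i | i <;> fin_cases i <;> simp [lins]

/-- The area of the triangle with corner vector in the real variables `8`, `9`. -/
def areaExp : RExp := .mul (rvar 7) (.add (.mul (rvar 8) (rvar 8)) (.mul (rvar 9) (rvar 9)))

def setPoint (o : ℕ) (x y : RExp) : Program :=
  .seq (.setR 3 (.const o) x) (.setR 4 (.const o) y)

/-- Store the triangle with corners `c`, `c + w`, `c + (a + bi) w` in the output cells `o₀`, `o₁`,
`o₂`. -/
def record (c : PExp) (o₀ o₁ o₂ : ℕ) : Program :=
  .seq (setPoint o₀ c.x c.y) (.seq (setPoint o₁ (.add c.x (rvar 8)) (.add c.y (rvar 9)))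
    (.seq (setPoint o₂
      (.add c.x (.sub (.mul (rvar 6) (rvar 8)) (.mul (rvar 7) (rvar 9))))
      (.add c.y (.add (.mul (rvar 7) (rvar 8)) (.mul (rvar 6) (rvar 9)))))
      (setRvar 5 areaExp)))

/-- Try the common boundary point of the constraints `i` and `k`. -/
def candidate (g : Fin 3 ⊕ Fin 3 → LinExp) (c : PExp) (o₀ o₁ o₂ : ℕ) (i k : Fin 3 ⊕ Fin 3) :
    Program :=
  .seq (setRvar 8 ((g i).meetX (g k))) (.seq (setRvar 9 ((g i).meetY (g k)))
    (.ite (.and (allTests (lins.map fun l => .not (.rlt ((g l).valExp (rvar 8) (rvar 9)) (.const 0))))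
        (.rlt (rvar 5) areaExp))
      (record c o₀ o₁ o₂) .skip))

def candidates (g : Fin 3 ⊕ Fin 3 → LinExp) (c : PExp) (o₀ o₁ o₂ : ℕ) : Program :=
  runAll ((lins ×ˢ lins).map fun ik => candidate g c o₀ o₁ o₂ ik.1 ik.2)

theorem loopFree_candidate (g : Fin 3 ⊕ Fin 3 → LinExp) (c : PExp) (o₀ o₁ o₂ : ℕ)
    (i k : Fin 3 ⊕ Fin 3) : (candidate g c o₀ o₁ o₂ i k).LoopFree := by
  simp [candidate, record, setPoint, Program.LoopFree]

theorem loopFree_candidates (g : Fin 3 ⊕ Fin 3 → LinExp) (c : PExp) (o₀ o₁ o₂ : ℕ) :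
    (candidates g c o₀ o₁ o₂).LoopFree := by
  refine loopFree_runAll fun d hd => ?_
  simp only [List.mem_map] at hd
  obtain ⟨ik, -, rfl⟩ := hd
  exact loopFree_candidate _ _ _ _ _ _ _

/-- The real variable `5` is zero, or it is twice the area of the triangle in the output cells and
this triangle satisfies `Ok`. -/
def Valid (Ok : Plane → Plane → Plane → Prop) (s : State) : Prop :=
  s.real 5 0 = 0 ∨ (0 < s.real 5 0 ∧
    Ok (outputCorner s 0) (outputCorner s 1) (outputCorner s 2) ∧
    cross (outputCorner s 0) (outputCorner s 1) (outputCorner s 2) = s.real 5 0)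

theorem Valid.nonneg {Ok : Plane → Plane → Plane → Prop} {s : State} (h : Valid Ok s) :
    0 ≤ s.real 5 0 := by
  rcases h with h | h
  · exact h.ge
  · exact h.1.le

/-- `s'` agrees with `s` except for the real arrays used for intermediate results. -/
def Keeps (s s' : State) : Prop :=
  s'.int = s.int ∧ ∀ k, k ∉ [3, 4, 5, 8, 9] → s'.real k = s.real k

theorem Keeps.trans {s s' s'' : State} (h : Keeps s s') (h' : Keeps s' s'') : Keeps s s'' :=
  ⟨h'.1.trans h.1, fun k hk => (h'.2 k hk).trans (h.2 k hk)⟩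

theorem cross_of_cyclic {o₀ o₁ o₂ : ℕ} (ho : (o₀, o₁, o₂) ∈ [(0, 1, 2), (1, 2, 0), (2, 0, 1)])
    (X : ℕ → Plane) : cross (X 0) (X 1) (X 2) = cross (X o₀) (X o₁) (X o₂) := by
  simp at ho
  rcases ho with ⟨rfl, rfl, rfl⟩ | ⟨rfl, rfl, rfl⟩ | ⟨rfl, rfl, rfl⟩
  · rfl
  · exact (cross_rotate _ _ _).symm
  · exact ((cross_rotate (X 1) (X 2) (X 0)).trans (cross_rotate (X 0) (X 1) (X 2))).symm

theorem exec_record {c : PExp} {o₀ o₁ o₂ : ℕ}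
    (ho : (o₀, o₁, o₂) ∈ [(0, 1, 2), (1, 2, 0), (2, 0, 1)])
    (hc : ∀ s s', Keeps s s' → c.eval s' = c.eval s) (s : State) :
    Keeps s ((record c o₀ o₁ o₂).exec s) ∧
      ((record c o₀ o₁ o₂).exec s).real 5 0 = s.real 7 0 * nsq !₂[s.real 8 0, s.real 9 0] ∧
      outputCorner ((record c o₀ o₁ o₂).exec s) o₀ = c.eval s ∧
      outputCorner ((record c o₀ o₁ o₂).exec s) o₁ = c.eval s + !₂[s.real 8 0, s.real 9 0] ∧
      outputCorner ((record c o₀ o₁ o₂).exec s) o₂ =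
        c.eval s + cmul (s.real 6 0) (s.real 7 0) !₂[s.real 8 0, s.real 9 0] := by
  have hx : ∀ s', Keeps s s' → c.x.eval s' = c.x.eval s := fun s' h => by
    have := congrArg (fun v : Plane => v 0) (hc s s' h)
    simpa [PExp.eval] using this
  have hy : ∀ s', Keeps s s' → c.y.eval s' = c.y.eval s := fun s' h => by
    have := congrArg (fun v : Plane => v 1) (hc s s' h)
    simpa [PExp.eval] using this
  have hset : ∀ s' k i x, k ∈ [3, 4, 5, 8, 9] → Keeps s s' → Keeps s (s'.setReal k i x) := by
    intro s' k i x hk h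
    refine ⟨h.1, fun j hj => ?_⟩
    rw [← h.2 j hj]
    have : j ≠ k := by rintro rfl; exact hj hk
    simp [State.setReal, this]
  have k0 : Keeps s s := ⟨rfl, fun _ _ => rfl⟩
  have k1 := hset _ 3 o₀ (c.x.eval s) (by simp) k0
  have k2 := hset _ 4 o₀ (c.y.eval s) (by simp) k1
  have k3 := hset _ 3 o₁ (c.x.eval s + s.real 8 0) (by simp) k2
  have k4 := hset _ 4 o₁ (c.y.eval s + s.real 9 0) (by simp) k3
  have k5 := hset _ 3 o₂ (c.x.eval s + (s.real 6 0 * s.real 8 0 - s.real 7 0 * s.real 9 0))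
    (by simp) k4
  have k6 := hset _ 4 o₂ (c.y.eval s + (s.real 7 0 * s.real 8 0 + s.real 6 0 * s.real 9 0))
    (by simp) k5
  have k7 := hset _ 5 0 (s.real 7 0 * (s.real 8 0 * s.real 8 0 + s.real 9 0 * s.real 9 0))
    (by simp) k6
  have hex : (record c o₀ o₁ o₂).exec s = (((((((s.setReal 3 o₀ (c.x.eval s)).setReal 4 o₀
      (c.y.eval s)).setReal 3 o₁ (c.x.eval s + s.real 8 0)).setReal 4 o₁
      (c.y.eval s + s.real 9 0)).setReal 3 o₂ (c.x.eval s +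
        (s.real 6 0 * s.real 8 0 - s.real 7 0 * s.real 9 0))).setReal 4 o₂ (c.y.eval s +
        (s.real 7 0 * s.real 8 0 + s.real 6 0 * s.real 9 0))).setReal 5 0
        (s.real 7 0 * (s.real 8 0 * s.real 8 0 + s.real 9 0 * s.real 9 0))) := by
    simp [record, setPoint, Program.exec, areaExp, State.setReal_real, hx _ k1, hx _ k2, hy _ k1,
      hx _ k3, hx _ k4, hx _ k5, hy _ k2, hy _ k3, hy _ k4, hy _ k5]
  rw [hex]
  refine ⟨k7, ?_, ?_, ?_, ?_⟩
  · simp [State.setReal_real, nsq]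
    left; ring
  all_goals
    simp at ho
    rcases ho with ⟨rfl, rfl, rfl⟩ | ⟨rfl, rfl, rfl⟩ | ⟨rfl, rfl, rfl⟩ <;>
    · apply plane_ext <;>
      simp [outputCorner, State.setReal_real, PExp.eval]

/-- The constraints `g` and the point `c` do not refer to intermediate results. -/
structure Stable (g : Fin 3 ⊕ Fin 3 → LinExp) (c : PExp) : Prop where
  lin : ∀ s s', Keeps s s' → ∀ i, (g i).eval s' = (g i).eval s
  corner : ∀ s s', Keeps s s' → c.eval s' = c.eval s

theorem exec_candidate {g : Fin 3 ⊕ Fin 3 → LinExp} {c : PExp} {o₀ o₁ o₂ : ℕ}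
    (ho : (o₀, o₁, o₂) ∈ [(0, 1, 2), (1, 2, 0), (2, 0, 1)]) (hg : Stable g c)
    {Ok : Plane → Plane → Plane → Prop} {s : State} (hs : Valid Ok s)
    (hOk : ∀ w, (∀ l, 0 ≤ ((g l).eval s).val w) → ∀ X : ℕ → Plane, X o₀ = c.eval s →
      X o₁ = c.eval s + w → X o₂ = c.eval s + cmul (s.real 6 0) (s.real 7 0) w →
      Ok (X 0) (X 1) (X 2)) (i k : Fin 3 ⊕ Fin 3) :
    Keeps s ((candidate g c o₀ o₁ o₂ i k).exec s) ∧
      Valid Ok ((candidate g c o₀ o₁ o₂ i k).exec s) ∧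
      s.real 5 0 ≤ ((candidate g c o₀ o₁ o₂ i k).exec s).real 5 0 ∧
      ((∀ l, 0 ≤ ((g l).eval s).val (((g i).eval s).meet ((g k).eval s))) →
        s.real 7 0 * nsq (((g i).eval s).meet ((g k).eval s)) ≤
          ((candidate g c o₀ o₁ o₂ i k).exec s).real 5 0) := by
  set W := ((g i).eval s).meet ((g k).eval s) with hW
  set s₁ := s.setReal 8 0 (W 0) with hs₁
  set s₂ := s₁.setReal 9 0 (W 1) with hs₂
  have k1 : Keeps s s₁ := by
    refine ⟨rfl, fun j hj => ?_⟩
    simp at hj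
    simp [hs₁, State.setReal, hj]
  have k2 : Keeps s s₂ := by
    refine ⟨rfl, fun j hj => ?_⟩
    simp at hj
    simp [hs₂, hs₁, State.setReal, hj]
  have ex1 : (setRvar 8 ((g i).meetX (g k))).exec s = s₁ := rfl
  have ex2 : (setRvar 9 ((g i).meetY (g k))).exec s₁ = s₂ := by
    have : ((g i).meetY (g k)).eval s₁ = (((g i).eval s₁).meet ((g k).eval s₁)) 1 := rfl
    rw [exec_setRvar, this, hg.lin _ _ k1, hg.lin _ _ k1]
  have h8 : s₂.real 8 0 = W 0 := by simp [hs₂, hs₁, State.setReal_real]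
  have h9 : s₂.real 9 0 = W 1 := by simp [hs₂, hs₁, State.setReal_real]
  have h6 : s₂.real 6 = s.real 6 := k2.2 6 (by simp)
  have h7 : s₂.real 7 = s.real 7 := k2.2 7 (by simp)
  have hr : ∀ j, j ≠ 8 → j ≠ 9 → s₂.real j = s.real j := by
    intro j h8 h9
    simp [hs₂, hs₁, State.setReal, h8, h9]
  have hpt : !₂[s₂.real 8 0, s₂.real 9 0] = W := by
    rw [h8, h9]
    exact plane_ext rfl rfl
  -- Parallel boundary lines give a division by zero and hence w = 0, whose area 0 fails the strict
  -- comparison with a nonnegative record. Thus recorded triangles are never degenerate.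
  have htest : (BExp.and (allTests (lins.map fun l =>
      .not (.rlt ((g l).valExp (rvar 8) (rvar 9)) (.const 0)))) (.rlt (rvar 5) areaExp)).holds s₂ ↔
      (∀ l, 0 ≤ ((g l).eval s).val W) ∧ s.real 5 0 < s.real 7 0 * nsq W := by
    have e : ∀ l, ((g l).valExp (rvar 8) (rvar 9)).eval s₂ = ((g l).eval s).val W := by
      intro l
      rw [← hg.lin _ _ k2]
      simp [LinExp.valExp, LinExp.eval, Lin.val, h8, h9]
    simp only [holds_and, holds_allTests, List.forall_mem_map, holds_not, holds_rlt, e, not_lt, reval_const, Rat.cast_zero,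
      mem_lins, true_imp_iff, areaExp, reval_mul, reval_add, eval_rvar, h8, h9, h7,
      hr 5 (by norm_num) (by norm_num), nsq]
    rw [sq, sq]
  have hexec : (candidate g c o₀ o₁ o₂ i k).exec s =
      if (∀ l, 0 ≤ ((g l).eval s).val W) ∧ s.real 5 0 < s.real 7 0 * nsq W then
        (record c o₀ o₁ o₂).exec s₂ else s₂ := by
    simp only [candidate, Program.exec, ex1, ex2, htest]
  by_cases hcond : (∀ l, 0 ≤ ((g l).eval s).val W) ∧ s.real 5 0 < s.real 7 0 * nsq W
  · rw [hexec, if_pos hcond]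
    obtain ⟨r1, r2, r3, r4, r5⟩ := exec_record ho hg.corner s₂
    rw [hpt, hg.corner _ _ k2] at r4
    rw [hpt, hg.corner _ _ k2, h6, h7] at r5
    rw [hpt, h7] at r2
    rw [hg.corner _ _ k2] at r3
    refine ⟨k2.trans r1, .inr ⟨?_, hOk W hcond.1 (outputCorner _) r3 r4 r5, ?_⟩, ?_, ?_⟩
    · rw [r2]
      linarith [hs.nonneg, hcond.2]
    · rw [cross_of_cyclic ho (outputCorner ((record c o₀ o₁ o₂).exec s₂)), r3, r4, r5, r2,
        cross_cmul]
    · rw [r2]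
      exact hcond.2.le
    · intro _
      rw [r2]
  · rw [hexec, if_neg hcond]
    have h5 := hr 5 (by norm_num) (by norm_num)
    refine ⟨k2, ?_, by rw [h5], fun hf => ?_⟩
    · simpa only [Valid, outputCorner, h5, hr 3 (by norm_num) (by norm_num),
        hr 4 (by norm_num) (by norm_num)] using hs
    · rw [h5]
      exact not_lt.1 fun h => hcond ⟨hf, h⟩

/-- Soundness and completeness are separate: every recorded `w` is feasible and therefore accepted,
and the record is at least the value of every feasible intersection point. -/
theorem exec_candidates {g : Fin 3 ⊕ Fin 3 → LinExp} {c : PExp} {o₀ o₁ o₂ : ℕ}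
    (ho : (o₀, o₁, o₂) ∈ [(0, 1, 2), (1, 2, 0), (2, 0, 1)]) (hg : Stable g c)
    {Ok : Plane → Plane → Plane → Prop} {s : State} (hs : Valid Ok s)
    (hOk : ∀ w, (∀ l, 0 ≤ ((g l).eval s).val w) → ∀ X : ℕ → Plane, X o₀ = c.eval s →
      X o₁ = c.eval s + w → X o₂ = c.eval s + cmul (s.real 6 0) (s.real 7 0) w →
      Ok (X 0) (X 1) (X 2)) :
    Keeps s ((candidates g c o₀ o₁ o₂).exec s) ∧
      Valid Ok ((candidates g c o₀ o₁ o₂).exec s) ∧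
      s.real 5 0 ≤ ((candidates g c o₀ o₁ o₂).exec s).real 5 0 ∧
      ∀ i k, (∀ l, 0 ≤ ((g l).eval s).val (((g i).eval s).meet ((g k).eval s))) →
        s.real 7 0 * nsq (((g i).eval s).meet ((g k).eval s)) ≤
          ((candidates g c o₀ o₁ o₂).exec s).real 5 0 := by
  suffices h : ∀ (L : List ((Fin 3 ⊕ Fin 3) × (Fin 3 ⊕ Fin 3))) (s' : State), Keeps s s' →
      Valid Ok s' →
      let s'' := (runAll (L.map fun ik => candidate g c o₀ o₁ o₂ ik.1 ik.2)).exec s'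
      Keeps s s'' ∧ Valid Ok s'' ∧ s'.real 5 0 ≤ s''.real 5 0 ∧
      ∀ ik ∈ L, (∀ l, 0 ≤ ((g l).eval s).val (((g ik.1).eval s).meet ((g ik.2).eval s))) →
        s.real 7 0 * nsq (((g ik.1).eval s).meet ((g ik.2).eval s)) ≤ s''.real 5 0 by
    obtain ⟨h1, h2, h3, h4⟩ := h (lins ×ˢ lins) s ⟨rfl, fun _ _ => rfl⟩ hs
    exact ⟨h1, h2, h3, fun i k => h4 (i, k) (List.mem_product.2 ⟨mem_lins i, mem_lins k⟩)⟩
  intro L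
  induction L with
  | nil => exact fun s' hk hv => ⟨hk, hv, le_rfl, by simp⟩
  | cons ik L ih =>
    intro s' hk hv
    have e : ∀ l, (g l).eval s' = (g l).eval s := hg.lin _ _ hk
    have e6 : s'.real 6 = s.real 6 := hk.2 6 (by simp)
    have e7 : s'.real 7 = s.real 7 := hk.2 7 (by simp)
    obtain ⟨h1, h2, h3, h4⟩ := exec_candidate ho hg hv (by
      simpa only [e, hg.corner _ _ hk, e6, e7] using hOk) ik.1 ik.2
    simp only [e, e7] at h4
    obtain ⟨g1, g2, g3, g4⟩ := ih _ (hk.trans h1) h2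
    refine ⟨g1, g2, h3.trans g3, ?_⟩
    intro ik' hik'
    rcases List.mem_cons.1 hik' with rfl | hik'
    · exact fun hf => (h4 hf).trans g3
    · exact g4 ik' hik'

/-! ### The sweep around a vertex

Variable `12` is the number of the vertex in the list of selected indices; variables `13` and `14`
are the numbers of the two wedges, relative to this vertex. -/

def wedgeExp (c p q : PExp) : Fin 3 → LinExp :=
  ![⟨.sub c.y p.y, .sub p.x c.x, .const 0⟩, ⟨.sub q.y c.y, .sub c.x q.x, .const 0⟩,
    ⟨.sub p.y q.y, .sub q.x p.x, crossExp p q c⟩]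

def pairExp (c p q p' q' : PExp) : Fin 3 ⊕ Fin 3 → LinExp :=
  Sum.elim (wedgeExp c p q) fun i =>
    let g := wedgeExp c p' q' i
    ⟨.add (.mul g.A (rvar 6)) (.mul g.B (rvar 7)), .sub (.mul g.B (rvar 6)) (.mul g.A (rvar 7)), g.E⟩

theorem eval_wedgeExp (s : State) (c p q : PExp) (i : Fin 3) :
    (wedgeExp c p q i).eval s = wedgeLin (c.eval s) (p.eval s) (q.eval s) i := by
  fin_cases i <;> simp [wedgeExp, wedgeLin, LinExp.eval, PExp.eval]

theorem eval_pairExp (s : State) (c p q p' q' : PExp) (i : Fin 3 ⊕ Fin 3) :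
    (pairExp c p q p' q' i).eval s = pairLin (s.real 6 0) (s.real 7 0) (c.eval s) (p.eval s)
      (q.eval s) (p'.eval s) (q'.eval s) i := by
  rcases i with i | i
  · exact eval_wedgeExp _ _ _ _ _
  · simp only [pairExp, pairLin, Sum.elim_inr, ← eval_wedgeExp]
    rfl

def corner (i : IExp) : PExp := vtx (.get 15 (.add (ivar 12) i))

@[simp] theorem eval_corner (s : State) (i : IExp) :
    (corner i).eval s = vert s (s.int 15 (s.int 12 0 + i.eval s)) := rfl

def succVar (a : ℕ) : IExp := .add (ivar a) (.const 1)

@[simp] theorem eval_succVar (s : State) (a : ℕ) : (succVar a).eval s = s.int a 0 + 1 := rfl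

def sweepLin : Fin 3 ⊕ Fin 3 → LinExp :=
  pairExp (corner (.const 0)) (corner (ivar 13)) (corner (succVar 13)) (corner (ivar 14))
    (corner (succVar 14))

/-- The determinant that tells which of the two wedges ends first. -/
def turnExp : RExp :=
  let c := corner (.const 0)
  let p := corner (succVar 13)
  let q := corner (succVar 14)
  let dx : RExp := .sub p.x c.x
  let dy : RExp := .sub p.y c.y
  .sub (.mul (.sub (.mul (rvar 6) dx) (.mul (rvar 7) dy)) (.sub q.y c.y))
    (.mul (.add (.mul (rvar 7) dx) (.mul (rvar 6) dy)) (.sub q.x c.x))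

theorem eval_turnExp (s : State) : turnExp.eval s =
    det (cmul (s.real 6 0) (s.real 7 0)
        ((corner (succVar 13)).eval s - (corner (.const 0)).eval s))
      ((corner (succVar 14)).eval s - (corner (.const 0)).eval s) := by
  simp only [turnExp, det, cmul_zero', cmul_one', PiLp.sub_apply, PExp.eval]
  rfl

/-- After the pair of wedges has been searched, the pointer whose wedge ends first in the turned
picture moves on. -/
def sweepStep (o₀ o₁ o₂ : ℕ) : Program :=
  .seq (candidates sweepLin (corner (.const 0)) o₀ o₁ o₂)
    (.ite (.rlt (.const 0) turnExp) (setIvar 13 (succVar 13)) (setIvar 14 (succVar 14)))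

def sweep (o₀ o₁ o₂ : ℕ) : Program := .loop (.ilt (succVar 14) (ivar 7)) (sweepStep o₀ o₁ o₂)

theorem Keeps.vert_eq {s s' : State} (h : Keeps s s') : vert s' = vert s :=
  vert_congr (h.2 0 (by simp)) (h.2 1 (by simp)) (by rw [h.1])

theorem Keeps.corner_eq {s s' : State} (h : Keeps s s') {i : IExp}
    (hi : i.eval s' = i.eval s) : (corner i).eval s' = (corner i).eval s := by
  rw [eval_corner, eval_corner, h.vert_eq, h.1, hi]

theorem stable_sweepLin : Stable sweepLin (corner (.const 0)) := by
  refine ⟨fun s s' h i => ?_, fun s s' h => h.corner_eq rfl⟩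
  have e : ∀ a, s'.int a 0 = s.int a 0 := fun a => by rw [h.1]
  rw [sweepLin, eval_pairExp, eval_pairExp, h.corner_eq (i := .const 0) rfl,
    h.corner_eq (i := ivar 13) (e 13), h.corner_eq (i := ivar 14) (e 14),
    h.corner_eq (i := succVar 13) (by simp [e]), h.corner_eq (i := succVar 14) (by simp [e]),
    h.2 6 (by simp), h.2 7 (by simp)]

/-- The memory describes the polygon `S` with `K` vertices and the shape `a + bi`. -/
structure Ctx (S : ℕ → Plane) (K : ℕ) (a b : ℝ) (s : State) : Prop where
  vertex : ∀ i, vert s (s.int 15 i) = S i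
  card : s.int 7 0 = K
  re : s.real 6 0 = a
  im : s.real 7 0 = b

/-- `s'` agrees with `s` except for the arrays that the sweep uses. -/
def Preserves (s s' : State) : Prop :=
  (∀ k, k ∉ [12, 13, 14] → s'.int k = s.int k) ∧ ∀ k, k ∉ [3, 4, 5, 8, 9] → s'.real k = s.real k

theorem Preserves.trans {s s' s'' : State} (h : Preserves s s') (h' : Preserves s' s'') :
    Preserves s s'' :=
  ⟨fun k hk => (h'.1 k hk).trans (h.1 k hk), fun k hk => (h'.2 k hk).trans (h.2 k hk)⟩

theorem Keeps.preserves {s s' : State} (h : Keeps s s') : Preserves s s' :=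
  ⟨fun k _ => by rw [h.1], h.2⟩

theorem preserves_setInt (s : State) {k : ℕ} (hk : k ∈ [12, 13, 14]) (x : ℕ) :
    Preserves s (s.setInt k 0 x) := by
  refine ⟨fun j hj => ?_, fun _ _ => rfl⟩
  have : j ≠ k := by rintro rfl; exact hj hk
  simp [State.setInt, this]

theorem Ctx.preserves {S : ℕ → Plane} {K : ℕ} {a b : ℝ} {s s' : State} (h : Ctx S K a b s)
    (hp : Preserves s s') : Ctx S K a b s' := by
  have hv : vert s' = vert s :=
    vert_congr (hp.2 0 (by simp)) (hp.2 1 (by simp)) (by rw [hp.1 1 (by simp)])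
  refine ⟨fun i => ?_, ?_, ?_, ?_⟩
  · rw [hv, hp.1 15 (by simp), h.vertex]
  · rw [hp.1 7 (by simp), h.card]
  · rw [hp.2 6 (by simp), h.re]
  · rw [hp.2 7 (by simp), h.im]

theorem valid_setInt {Ok : Plane → Plane → Plane → Prop} {s : State} (h : Valid Ok s)
    (k i x : ℕ) : Valid Ok (s.setInt k i x) := h

/-- All triangles at the corner `u 0` are accepted by `Ok`. -/
def Accepts (Ok : Plane → Plane → Plane → Prop) (o₀ o₁ o₂ : ℕ) (u : ℕ → Plane) (K : ℕ)
    (a b : ℝ) : Prop :=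
  ∀ w, u 0 + w ∈ hull u K → u 0 + cmul a b w ∈ hull u K → ∀ X : ℕ → Plane, X o₀ = u 0 →
    X o₁ = u 0 + w → X o₂ = u 0 + cmul a b w → Ok (X 0) (X 1) (X 2)

/-- One pointer move loses nothing: a triangle covered by wedge indices from (j, l) on is either
dominated by the record or still covered by the new indices, and the sum of the two indices goes up
by one. -/
theorem sweepStep_halts {o₀ o₁ o₂ : ℕ}
    (ho : (o₀, o₁, o₂) ∈ [(0, 1, 2), (1, 2, 0), (2, 0, 1)])
    {S : ℕ → Plane} {K : ℕ} {a b : ℝ} {Ok : Plane → Plane → Plane → Prop} {d : ℕ} {s : State}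
    (hctx : Ctx S K a b s) (hd : s.int 12 0 = d) (hccw : CCW (fun i => S (d + i)) K) (hb : 0 < b)
    (hOk : Accepts Ok o₀ o₁ o₂ (fun i => S (d + i)) K a b) (hv : Valid Ok s)
    {j l : ℕ} (hj : s.int 13 0 = j) (hl : s.int 14 0 = l) (hj0 : 0 < j) (hjl : j ≤ l)
    (hlK : l + 1 < K) :
    Halts (sweepStep o₀ o₁ o₂) s (sweepStep o₀ o₁ o₂).bound (fun s' =>
      Preserves s s' ∧ Valid Ok s' ∧ s.real 5 0 ≤ s'.real 5 0 ∧ s'.int 12 0 = d ∧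
      0 < s'.int 13 0 ∧ s'.int 13 0 ≤ s'.int 14 0 ∧ s'.int 14 0 < K ∧
      s'.int 13 0 + s'.int 14 0 = j + l + 1 ∧
      ∀ w, w ≠ 0 → S d + w ∈ hull (fun i => S (d + i)) K →
        S d + cmul a b w ∈ hull (fun i => S (d + i)) K →
        Covered (fun i => S (d + i)) K a b j l w →
        b * nsq w ≤ s'.real 5 0 ∨
          Covered (fun i => S (d + i)) K a b (s'.int 13 0) (s'.int 14 0) w) := by
  set u : ℕ → Plane := fun i => S (d + i) with hu
  have hu0 : u 0 = S d := rfl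
  have hfree : (sweepStep o₀ o₁ o₂).LoopFree :=
    ⟨loopFree_candidates _ _ _ _ _, loopFree_setIvar _ _, loopFree_setIvar _ _⟩
  have hco : ∀ i : IExp, (corner i).eval s = u (i.eval s) := by
    intro i
    rw [eval_corner, hctx.vertex, hd]
  have hlin : ∀ i, (sweepLin i).eval s = pairLin a b (u 0) (u j) (u (j + 1)) (u l) (u (l + 1)) i := by
    intro i
    rw [sweepLin, eval_pairExp, hctx.re, hctx.im]
    simp only [hco, eval_const, eval_ivar, eval_succVar, hj, hl]
  refine hfree.halts ?_
  obtain ⟨h1, h2, h3, h4⟩ := exec_candidates ho stable_sweepLin hv (by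
    intro w hw X hX0 hX1 hX2
    simp only [hlin] at hw
    rw [hco, eval_const] at hX0 hX1 hX2
    rw [hctx.re, hctx.im] at hX2
    have hin := hccw.pair_subset hj0 (by omega) (by omega) hlK hw
    exact hOk w hin.1 hin.2 X hX0 hX1 hX2)
  set s₁ := (candidates sweepLin (corner (.const 0)) o₀ o₁ o₂).exec s with hs₁
  simp only [hlin, hctx.im] at h4
  have hc1 := hctx.preserves h1.preserves
  have hco1 : ∀ i : IExp, (corner i).eval s₁ = u (i.eval s₁) := by
    intro i
    rw [eval_corner, hc1.vertex, h1.1, hd]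
  have j1 : s₁.int 13 0 = j := by rw [h1.1, hj]
  have l1 : s₁.int 14 0 = l := by rw [h1.1, hl]
  have d1 : s₁.int 12 0 = d := by rw [h1.1, hd]
  have hturn : turnExp.eval s₁ = det (cmul a b (u (j + 1) - u 0)) (u (l + 1) - u 0) := by
    rw [eval_turnExp, hc1.re, hc1.im]
    simp only [hco1, eval_const, eval_succVar, j1, l1]
  have hpair : ∀ w, S d + w ∈ hull u K → S d + cmul a b w ∈ hull u K →
      InCone u j w → InCone u l (cmul a b w) → b * nsq w ≤ s₁.real 5 0 := by
    intro w hw1 hw2 hcj hcl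
    obtain ⟨i, k, hf, hle⟩ := hccw.exists_pair_meet hj0 (by omega) (by omega) hlK hw1 hw2 hcj hcl
    exact (mul_le_mul_of_nonneg_left hle hb.le).trans (h4 i k hf)
  have hexec : (sweepStep o₀ o₁ o₂).exec s =
      if 0 < det (cmul a b (u (j + 1) - u 0)) (u (l + 1) - u 0) then s₁.setInt 13 0 (j + 1)
      else s₁.setInt 14 0 (l + 1) := by
    simp only [sweepStep, Program.exec, ← hs₁, holds_rlt, hturn, reval_const, Rat.cast_zero,
      exec_setIvar, eval_succVar, j1, l1]
  by_cases hT : 0 < det (cmul a b (u (j + 1) - u 0)) (u (l + 1) - u 0)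
  · rw [hexec, if_pos hT]
    obtain ⟨hlt, hcov⟩ := hccw.covered_succ_left hb hj0 hjl hlK hT
    refine ⟨h1.preserves.trans (preserves_setInt _ (by simp) _), valid_setInt h2 _ _ _, h3, ?_⟩
    simp only [State.setInt_int, State.setInt_real]
    norm_num
    refine ⟨d1, by omega, by omega, by omega, fun w hw hw1 hw2 hc => ?_⟩
    rw [l1]
    rcases hcov w hw hc with h | h
    · exact .inl (hpair w hw1 hw2 h.1 h.2)
    · exact .inr h
  · rw [hexec, if_neg hT]
    refine ⟨h1.preserves.trans (preserves_setInt _ (by simp) _), valid_setInt h2 _ _ _, h3, ?_⟩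
    simp only [State.setInt_int, State.setInt_real]
    norm_num
    refine ⟨d1, by omega, by omega, by omega, by omega, fun w hw hw1 hw2 hc => ?_⟩
    rw [j1]
    rcases hccw.covered_succ_right hb hj0 hjl hlK (not_lt.1 hT) hw hc with h | h
    · exact .inl (hpair w hw1 hw2 h.1 h.2)
    · exact .inr h

/-- The triangles at all vertices. -/
def cornerStep (o₀ o₁ o₂ : ℕ) : Program :=
  .seq (setIvar 13 (.const 1)) (.seq (setIvar 14 (.const 1))
    (.seq (sweep o₀ o₁ o₂) (setIvar 12 (succVar 12))))

def allCorners (o₀ o₁ o₂ : ℕ) : Program :=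
  .seq (setIvar 12 (.const 0)) (.loop (.ilt (ivar 12) (ivar 7)) (cornerStep o₀ o₁ o₂))

/-- No triangle at the vertex `u 0` has area more than `x / 2`. -/
def BestAt (u : ℕ → Plane) (K : ℕ) (a b x : ℝ) : Prop :=
  ∀ w, u 0 + w ∈ hull u K → u 0 + cmul a b w ∈ hull u K → b * nsq w ≤ x

theorem exists_cornerStep_halts {o₀ o₁ o₂ : ℕ}
    (ho : (o₀, o₁, o₂) ∈ [(0, 1, 2), (1, 2, 0), (2, 0, 1)]) :
    ∃ C : ℕ, ∀ (S : ℕ → Plane) (K : ℕ) (a b : ℝ) (Ok : Plane → Plane → Plane → Prop) (d : ℕ)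
      (s : State), Ctx S K a b s → s.int 12 0 = d → 3 ≤ K → CCW (fun i => S (d + i)) K → 0 < b →
      Accepts Ok o₀ o₁ o₂ (fun i => S (d + i)) K a b → Valid Ok s →
      Halts (cornerStep o₀ o₁ o₂) s (C * (K + 1)) (fun s' => Preserves s s' ∧ Valid Ok s' ∧
        s.real 5 0 ≤ s'.real 5 0 ∧ s'.int 12 0 = d + 1 ∧
        BestAt (fun i => S (d + i)) K a b (s'.real 5 0)) := by
  set B := (sweepStep o₀ o₁ o₂).bound + (BExp.ilt (succVar 14) (ivar 7)).cost + 1 with hB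
  refine ⟨(setIvar 13 (.const 1)).bound + (setIvar 14 (.const 1)).bound + 2 * B +
    (setIvar 12 (succVar 12)).bound, fun S K a b Ok d s hctx hd hK hccw hb hOk hv => ?_⟩
  set s₀ := (s.setInt 13 0 1).setInt 14 0 1 with hs₀
  have p0 : Preserves s s₀ :=
    (preserves_setInt s (by simp) 1).trans (preserves_setInt _ (by simp) 1)
  have e12 : s₀.int 12 0 = d := by simp [hs₀, State.setInt_int, hd]
  have e13 : s₀.int 13 0 = 1 := by simp [hs₀, State.setInt_int]
  have e14 : s₀.int 14 0 = 1 := by simp [hs₀, State.setInt_int]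
  have key := Halts.loop (b := .ilt (succVar 14) (ivar 7)) (c := sweepStep o₀ o₁ o₂)
    (T := (sweepStep o₀ o₁ o₂).bound)
    (fun s' => Preserves s s' ∧ Valid Ok s' ∧ s.real 5 0 ≤ s'.real 5 0 ∧ s'.int 12 0 = d ∧
      0 < s'.int 13 0 ∧ s'.int 13 0 ≤ s'.int 14 0 ∧ s'.int 14 0 < K ∧
      ∀ w, w ≠ 0 → S d + w ∈ hull (fun i => S (d + i)) K →
        S d + cmul a b w ∈ hull (fun i => S (d + i)) K →
        b * nsq w ≤ s'.real 5 0 ∨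
          Covered (fun i => S (d + i)) K a b (s'.int 13 0) (s'.int 14 0) w)
    -- Each step increases the sum of the pointers, which stay below `K`; this makes the sweep at
    -- one vertex linear in `K`.
    (fun s' => 2 * K - (s'.int 13 0 + s'.int 14 0)) ?_ (s := s₀)
    ⟨p0, valid_setInt (valid_setInt hv _ _ _) _ _ _, le_rfl, e12, by omega, by omega, by omega,
      fun w hw hw1 hw2 => ?_⟩ (N := 2 * K + 1) (by omega)
  · have hall : Halts (cornerStep o₀ o₁ o₂) s ((setIvar 13 (.const 1)).bound +
        ((setIvar 14 (.const 1)).bound + ((2 * K + 1 + 1) * B + (setIvar 12 (succVar 12)).bound)))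
        (fun s' => Preserves s s' ∧ Valid Ok s' ∧
        s.real 5 0 ≤ s'.real 5 0 ∧ s'.int 12 0 = d + 1 ∧
        BestAt (fun i => S (d + i)) K a b (s'.real 5 0)) := by
      refine Halts.seq ((loopFree_setIvar _ _).halts (Halts.seq ((loopFree_setIvar _ _).halts ?_)))
      refine Halts.seq (Halts.mono key le_rfl ?_)
      rintro s' ⟨⟨h1, h2, h3, h4, h5, h6, h7, h8⟩, h9⟩
      refine (loopFree_setIvar _ _).halts ?_
      rw [exec_setIvar]
      refine ⟨h1.trans (preserves_setInt _ (by simp) _), valid_setInt h2 _ _ _, h3,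
        by simp [State.setInt_int, h4], fun w hw1 hw2 => ?_⟩
      simp only [State.setInt_real]
      by_cases hw : w = 0
      · subst hw
        simpa [nsq] using h2.nonneg
      · refine (h8 w hw hw1 hw2).resolve_right ?_
        rintro ⟨j', l', g1, g2, g3, g4, -⟩
        have : s'.int 7 0 = K := by rw [h1.1 7 (by simp), hctx.card]
        simp [this] at h9
        omega
    refine hall.mono ?_ fun _ h => h
    set c₁ := (setIvar 13 (.const 1)).bound
    set c₂ := (setIvar 14 (.const 1)).bound
    set c₃ := (setIvar 12 (succVar 12)).bound
    calc c₁ + (c₂ + ((2 * K + 1 + 1) * B + c₃)) = (c₁ + c₂ + c₃) * 1 + 2 * B * (K + 1) := by ring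
      _ ≤ (c₁ + c₂ + c₃) * (K + 1) + 2 * B * (K + 1) := by gcongr; omega
      _ = _ := by ring
  · rintro s' ⟨h1, h2, h3, h4, h5, h6, h7, h8⟩ h9
    have hc := hctx.preserves h1
    simp only [holds_ilt, eval_succVar, eval_ivar, hc.card] at h9
    refine (sweepStep_halts ho hc h4 hccw hb hOk h2 rfl rfl h5 h6 h9).mono le_rfl ?_
    rintro s'' ⟨g1, g2, g3, g4, g5, g6, g7, g8, g9⟩
    refine ⟨⟨h1.trans g1, g2, h3.trans g3, g4, g5, g6, g7, fun w hw hw1 hw2 => ?_⟩, by omega⟩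
    rcases h8 w hw hw1 hw2 with h | h
    · exact .inl (h.trans g3)
    · exact g9 w hw hw1 hw2 h
  · rw [e13, e14]
    exact .inr (hccw.covered_of_mem hK hw1 hw2)

theorem exists_allCorners_halts {o₀ o₁ o₂ : ℕ}
    (ho : (o₀, o₁, o₂) ∈ [(0, 1, 2), (1, 2, 0), (2, 0, 1)]) :
    ∃ C : ℕ, ∀ (S : ℕ → Plane) (K : ℕ) (a b : ℝ) (Ok : Plane → Plane → Plane → Prop)
      (s : State), Ctx S K a b s → 3 ≤ K → (∀ d < K, CCW (fun i => S (d + i)) K) → 0 < b →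
      (∀ d < K, Accepts Ok o₀ o₁ o₂ (fun i => S (d + i)) K a b) → Valid Ok s →
      Halts (allCorners o₀ o₁ o₂) s (C * (K + 1) ^ 2) (fun s' => Preserves s s' ∧ Valid Ok s' ∧
        s.real 5 0 ≤ s'.real 5 0 ∧
        ∀ d < K, BestAt (fun i => S (d + i)) K a b (s'.real 5 0)) := by
  obtain ⟨C, hC⟩ := exists_cornerStep_halts ho
  refine ⟨(setIvar 12 (.const 0)).bound + C + (BExp.ilt (ivar 12) (ivar 7)).cost + 1,
    fun S K a b Ok s hctx hK hccw hb hOk hv => ?_⟩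
  have p0 : Preserves s (s.setInt 12 0 0) := preserves_setInt s (by simp) 0
  have key := Halts.loop (b := .ilt (ivar 12) (ivar 7)) (c := cornerStep o₀ o₁ o₂)
    (T := C * (K + 1))
    (fun s' => Preserves s s' ∧ Valid Ok s' ∧ s.real 5 0 ≤ s'.real 5 0 ∧ s'.int 12 0 ≤ K ∧
      ∀ d < s'.int 12 0, BestAt (fun i => S (d + i)) K a b (s'.real 5 0))
    (fun s' => K - s'.int 12 0) ?_ (s := s.setInt 12 0 0)
    ⟨p0, valid_setInt hv _ _ _, le_rfl, by simp [State.setInt_int],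
      fun d hd => by simp [State.setInt_int] at hd⟩ (N := K) (by simp)
  · have hall : Halts (allCorners o₀ o₁ o₂) s ((setIvar 12 (.const 0)).bound + (K + 1) *
        (C * (K + 1) + (BExp.ilt (ivar 12) (ivar 7)).cost + 1)) (fun s' => Preserves s s' ∧
        Valid Ok s' ∧ s.real 5 0 ≤ s'.real 5 0 ∧
        ∀ d < K, BestAt (fun i => S (d + i)) K a b (s'.real 5 0)) := by
      refine Halts.seq ((loopFree_setIvar _ _).halts (Halts.mono key le_rfl ?_))
      rintro s' ⟨⟨h1, h2, h3, h4, h5⟩, h6⟩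
      have : s'.int 7 0 = K := by rw [h1.1 7 (by simp), hctx.card]
      simp [this] at h6
      exact ⟨h1, h2, h3, fun d hd => h5 d (by omega)⟩
    refine hall.mono ?_ fun _ h => h
    set c₁ := (setIvar 12 (.const 0)).bound
    set c₂ := (BExp.ilt (ivar 12) (ivar 7)).cost
    calc c₁ + (K + 1) * (C * (K + 1) + c₂ + 1)
        = c₁ * 1 + C * (K + 1) ^ 2 + (c₂ + 1) * ((K + 1) * 1) := by ring
      _ ≤ c₁ * (K + 1) ^ 2 + C * (K + 1) ^ 2 + (c₂ + 1) * ((K + 1) * (K + 1)) := by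
          gcongr
          · exact Nat.one_le_pow _ _ (by omega)
          · omega
      _ = _ := by ring
  · rintro s' ⟨h1, h2, h3, h4, h5⟩ h6
    have hc := hctx.preserves h1
    simp only [holds_ilt, eval_ivar, hc.card] at h6
    refine (hC S K a b Ok _ s' hc rfl hK (hccw _ h6) hb (hOk _ h6) h2).mono le_rfl ?_
    rintro s'' ⟨g1, g2, g3, g4, g5⟩
    refine ⟨⟨h1.trans g1, g2, h3.trans g3, by omega, fun d hd => ?_⟩, by omega⟩
    rcases Nat.lt_or_ge d (s'.int 12 0) with h | h
    · exact fun w hw1 hw2 => (h5 d h w hw1 hw2).trans g3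
    · obtain rfl : d = s'.int 12 0 := by omega
      exact g5

/-! ### Largest triangles in a polygon -/

/-- From the shape of the triangle `pqr` to that of the triangle `qrp`. -/
def nextShape : Program :=
  .seq (setRvar 10 (.add (.mul (.sub (.const 1) (rvar 6)) (.sub (.const 1) (rvar 6)))
      (.mul (rvar 7) (rvar 7))))
    (.seq (setRvar 6 (.div (.sub (.const 1) (rvar 6)) (rvar 10)))
      (setRvar 7 (.div (rvar 7) (rvar 10))))

/-- Find a largest triangle of the given shape in the polygon with the selected vertices. -/
def largest : Program :=
  .seq (allCorners 0 1 2) (.seq nextShape (.seq (allCorners 1 2 0)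
    (.seq nextShape (allCorners 2 0 1))))

theorem loopFree_nextShape : nextShape.LoopFree := ⟨trivial, trivial, trivial⟩

theorem exec_nextShape {S : ℕ → Plane} {K : ℕ} {a b : ℝ}
    {Ok : Plane → Plane → Plane → Prop} {s : State} (hc : Ctx S K a b s) (hv : Valid Ok s) :
    Ctx S K ((1 - a) / ((1 - a) ^ 2 + b ^ 2)) (b / ((1 - a) ^ 2 + b ^ 2)) (nextShape.exec s) ∧
      Valid Ok (nextShape.exec s) ∧ (nextShape.exec s).real 5 0 = s.real 5 0 := by
  have hr : ∀ k, k ∉ [6, 7, 10] → (nextShape.exec s).real k = s.real k := by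
    intro k hk
    simp at hk
    simp [nextShape, Program.exec, State.setReal, hk]
  have hvert : vert (nextShape.exec s) = vert s :=
    vert_congr (hr 0 (by simp)) (hr 1 (by simp)) rfl
  have h5 := hr 5 (by simp)
  refine ⟨⟨fun i => ?_, hc.card, ?_, ?_⟩, ?_, by rw [h5]⟩
  · rw [hvert]
    exact hc.vertex i
  · simp [nextShape, Program.exec, State.setReal_real, hc.re, hc.im, sq]
  · simp [nextShape, Program.exec, State.setReal_real, hc.re, hc.im, sq]
  · simpa only [Valid, outputCorner, h5, hr 3 (by simp), hr 4 (by simp)] using hv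

/-- Some maximum triangle has a corner at a vertex, but it may be any of the three corners. Three
rounds relabel the triangle cyclically; the record is always twice the area, which relabelling does
not change, so one record serves all rounds. -/
theorem exists_largest_halts :
    ∃ C : ℕ, ∀ (S : ℕ → Plane) (K : ℕ) (a b : ℝ) (s : State), Ctx S K a b s → 3 ≤ K →
      CCW S K → (∀ i < K, S (i + K) = S i) → 0 < b → s.real 5 0 = 0 →
      Halts largest s (C * (K + 1) ^ 2) (fun s' =>
        outputCorner s' 0 ∈ hull S K ∧ outputCorner s' 1 ∈ hull S K ∧
        outputCorner s' 2 ∈ hull S K ∧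
        outputCorner s' 2 = outputCorner s' 0 + cmul a b (outputCorner s' 1 - outputCorner s' 0) ∧
        0 < cross (outputCorner s' 0) (outputCorner s' 1) (outputCorner s' 2) ∧
        ∀ p w, p ∈ hull S K → p + w ∈ hull S K → p + cmul a b w ∈ hull S K →
          b * nsq w ≤ cross (outputCorner s' 0) (outputCorner s' 1) (outputCorner s' 2)) := by
  obtain ⟨C₀, h₀⟩ := exists_allCorners_halts (o₀ := 0) (o₁ := 1) (o₂ := 2) (by simp)
  obtain ⟨C₁, h₁⟩ := exists_allCorners_halts (o₀ := 1) (o₁ := 2) (o₂ := 0) (by simp)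
  obtain ⟨C₂, h₂⟩ := exists_allCorners_halts (o₀ := 2) (o₁ := 0) (o₂ := 1) (by simp)
  refine ⟨C₀ + nextShape.bound + C₁ + nextShape.bound + C₂,
    fun S K a b s hc hK hccw hper hb h5 => ?_⟩
  set a₁ := (1 - a) / ((1 - a) ^ 2 + b ^ 2) with ha₁
  set b₁ := b / ((1 - a) ^ 2 + b ^ 2) with hb₁
  set a₂ := (1 - a₁) / ((1 - a₁) ^ 2 + b₁ ^ 2) with ha₂
  set b₂ := b₁ / ((1 - a₁) ^ 2 + b₁ ^ 2) with hb₂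
  have hb₁pos : 0 < b₁ := by positivity
  have hb₂pos : 0 < b₂ := by positivity
  have cyc₁ := fun p q r => cmul_cycle (a := a) hb (p := p) (q := q) (r := r)
  have cyc₂ := fun p q r => cmul_cycle (a := a₁) hb₁pos (p := p) (q := q) (r := r)
  simp only [← ha₁, ← hb₁] at cyc₁
  simp only [← ha₂, ← hb₂] at cyc₂
  set Ok : Plane → Plane → Plane → Prop := fun p q r =>
    p ∈ hull S K ∧ q ∈ hull S K ∧ r ∈ hull S K ∧ r = p + cmul a b (q - p) with hOk
  have hshift : ∀ d < K, CCW (fun i => S (d + i)) K := fun d hd => hccw.shift hper hd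
  have acc₀ : ∀ d < K, Accepts Ok 0 1 2 (fun i => S (d + i)) K a b := by
    intro d hd w hw1 hw2 X h0 h1 h2
    rw [hull_shift hper hd] at hw1 hw2
    refine ⟨by rw [h0]; exact mem_hull hd, by rwa [h1], by rwa [h2], ?_⟩
    rw [h0, h1, h2, add_sub_cancel_left]
  have acc₁ : ∀ d < K, Accepts Ok 1 2 0 (fun i => S (d + i)) K a₁ b₁ := by
    intro d hd w hw1 hw2 X h0 h1 h2
    rw [hull_shift hper hd] at hw1 hw2
    refine ⟨by rwa [h2], by rw [h0]; exact mem_hull hd, by rwa [h1], ?_⟩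
    rw [cyc₁, h0, h1, h2, add_sub_cancel_left]
  have acc₂ : ∀ d < K, Accepts Ok 2 0 1 (fun i => S (d + i)) K a₂ b₂ := by
    intro d hd w hw1 hw2 X h0 h1 h2
    rw [hull_shift hper hd] at hw1 hw2
    refine ⟨by rwa [h1], by rwa [h2], by rw [h0]; exact mem_hull hd, ?_⟩
    rw [cyc₁, cyc₂, h0, h1, h2, add_sub_cancel_left]
  have key : Halts largest s (C₀ * (K + 1) ^ 2 + (nextShape.bound + (C₁ * (K + 1) ^ 2 +
      (nextShape.bound + C₂ * (K + 1) ^ 2)))) (fun s' => Valid Ok s' ∧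
        ∀ d < K, BestAt (fun i => S (d + i)) K a b (s'.real 5 0) ∧
          BestAt (fun i => S (d + i)) K a₁ b₁ (s'.real 5 0) ∧
          BestAt (fun i => S (d + i)) K a₂ b₂ (s'.real 5 0)) := by
    refine Halts.seq ((h₀ S K a b Ok s hc hK hshift hb acc₀ (.inl h5)).mono le_rfl ?_)
    rintro s₁ ⟨p₁, v₁, -, g₁⟩
    obtain ⟨c₁, v₁', e₁⟩ := exec_nextShape (hc.preserves p₁) v₁
    refine Halts.seq (loopFree_nextShape.halts (Halts.seq
      ((h₁ S K a₁ b₁ Ok _ c₁ hK hshift hb₁pos acc₁ v₁').mono le_rfl ?_)))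
    rintro s₂ ⟨p₂, v₂, l₂, g₂⟩
    obtain ⟨c₂, v₂', e₂⟩ := exec_nextShape (c₁.preserves p₂) v₂
    refine Halts.seq (loopFree_nextShape.halts
      ((h₂ S K a₂ b₂ Ok _ c₂ hK hshift hb₂pos acc₂ v₂').mono le_rfl ?_))
    rintro s₃ ⟨p₃, v₃, l₃, g₃⟩
    rw [e₁] at l₂
    rw [e₂] at l₃
    exact ⟨v₃, fun d hd => ⟨fun w hw1 hw2 => (g₁ d hd w hw1 hw2).trans (l₂.trans l₃),
      fun w hw1 hw2 => (g₂ d hd w hw1 hw2).trans l₃, g₃ d hd⟩⟩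
  refine key.mono ?_ ?_
  · have : 1 ≤ (K + 1) ^ 2 := Nat.one_le_pow _ _ (by omega)
    nlinarith [Nat.le_mul_of_pos_right nextShape.bound this]
  rintro s' ⟨hv, hbest⟩
  obtain ⟨p, w, hp, hq, hr, ⟨d, hd, hcor⟩, hmax⟩ := exists_max_triangle S (by omega : 0 < K) a b
  have hle : b * nsq w ≤ s'.real 5 0 := by
    obtain ⟨f₀, f₁, f₂⟩ := hbest d hd
    simp only [BestAt, hull_shift hper hd, add_zero] at f₀ f₁ f₂
    set q := p + w with hqd
    set r := p + cmul a b w with hrd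
    have hpq : r = p + cmul a b (q - p) := by rw [hqd, add_sub_cancel_left]
    have hcr : cross p q r = b * nsq w := cross_cmul a b p w
    have e₁ := (cyc₁ p q r).1 hpq
    have e₂ := (cyc₂ q r p).1 e₁
    rcases hcor with h | h | h
    · rw [← h] at f₀
      exact f₀ w hq hr
    · rw [← h] at f₁
      have := f₁ (r - q) (by rwa [add_sub_cancel]) (by rwa [← e₁])
      rwa [← cross_cmul a₁ b₁ q (r - q), ← e₁, add_sub_cancel, cross_rotate, hcr] at this
    · rw [← h] at f₂
      have := f₂ (p - r) (by rwa [add_sub_cancel]) (by rwa [← e₂])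
      rwa [← cross_cmul a₂ b₂ r (p - r), ← e₂, add_sub_cancel, cross_rotate, cross_rotate,
        hcr] at this
  have hall : ∀ p w, p ∈ hull S K → p + w ∈ hull S K → p + cmul a b w ∈ hull S K →
      b * nsq w ≤ s'.real 5 0 := fun p' w' h1 h2 h3 =>
    (mul_le_mul_of_nonneg_left (hmax p' w' h1 h2 h3) hb.le).trans hle
  obtain ⟨p', w', hw', g1, g2, g3⟩ := hccw.exists_triangle hK a b
  have hpos : 0 < s'.real 5 0 := (mul_pos hb (nsq_pos hw')).trans_le (hall p' w' g1 g2 g3)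
  rcases hv with hv | ⟨-, ⟨o₁, o₂, o₃, o₄⟩, hcr⟩
  · exact absurd hv hpos.ne'
  · rw [hcr]
    exact ⟨o₁, o₂, o₃, o₄, hpos, hall⟩

end RealRAM

/-- A list consisting only of vertices 0 and n - 1 would skip vertex `m`, which lies strictly beyond
the chord, while the homothety centre lies beyond it too; the chord condition would then bound a
positive number by a negative one. -/
theorem Kernel.three_le {V : ℕ → Plane} {n m L R : ℕ} {ε : ℝ} {κ : ℕ → ℕ} {K : ℕ}
    (ha : Anchors V n m L R) (h : Kernel V m ε κ K) (hlast : κ (K - 1) = n - 1) (hε : 0 < ε) :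
    3 ≤ K := by
  have hm := ha.m_pos
  have hm' := ha.m_lt
  have hz := h.zero
  have hpos := h.pos
  by_contra hc
  obtain rfl | rfl : K = 1 ∨ K = 2 := by omega
  · norm_num at hlast
    omega
  · norm_num at hlast
    have := h.chord 0 (by norm_num) m (by omega) (by rw [zero_add, hlast]; omega)
    rw [hz, zero_add, hlast] at this
    have h1 := ha.ccw 0 m (n - 1) hm (by omega) (by omega)
    rw [← cross_rotate, ← cross_rotate, cross_swap] at h1
    have h2 : cross (V 0) (V (n - 1)) (V 0) = 0 := by
      simp only [cross]; ring
    rw [h2] at this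
    nlinarith

/-! ### The complete algorithm, its accuracy and its running time -/

namespace RealRAM

/-- The shape of the triangle, from the two angles. -/
def initShape : Program :=
  let cα : RExp := .get 2 (.const 1)
  let sα : RExp := .get 2 (.const 2)
  let cβ : RExp := .get 2 (.const 3)
  let sβ : RExp := .get 2 (.const 4)
  .seq (setRvar 10 (.add (.mul sα cβ) (.mul cα sβ)))
    (.seq (setRvar 6 (.div (.mul cα sβ) (rvar 10))) (setRvar 7 (.div (.mul sα sβ) (rvar 10))))

/-- The algorithm for polygons in counterclockwise order. -/
def approximate : Program :=
  .seq findAnchors (.seq kernel (.seq double (.seq initShape largest)))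

theorem loopFree_initShape : initShape.LoopFree := ⟨trivial, trivial, trivial⟩

theorem exists_approximate_halts :
    ∃ C : ℕ, ∀ (s : State) (n N : ℕ) (ε σ a b : ℝ), s.int 0 0 = n → 3 ≤ n → CCW (vert s) n →
      s.real 2 0 = ε → 0 < ε → ε < 1 → 12 / Real.sqrt ε ≤ N → s.real 5 0 = 0 →
      σ = s.real 2 2 * s.real 2 3 + s.real 2 1 * s.real 2 4 →
      a = s.real 2 1 * s.real 2 4 / σ → b = s.real 2 2 * s.real 2 4 / σ → 0 < b →
      Halts approximate s (C * ((N + 1) * (Nat.clog 2 n + 1) + (N + 1) ^ 2)) (fun s' =>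
        outputCorner s' 0 ∈ hull (vert s) n ∧ outputCorner s' 1 ∈ hull (vert s) n ∧
        outputCorner s' 2 ∈ hull (vert s) n ∧
        outputCorner s' 2 = outputCorner s' 0 + cmul a b (outputCorner s' 1 - outputCorner s' 0) ∧
        0 < cross (outputCorner s' 0) (outputCorner s' 1) (outputCorner s' 2) ∧
        ∀ p w, p ∈ hull (vert s) n → p + w ∈ hull (vert s) n → p + cmul a b w ∈ hull (vert s) n →
          (1 - ε) * (b * nsq w) ≤
            cross (outputCorner s' 0) (outputCorner s' 1) (outputCorner s' 2)) := by
  obtain ⟨C₁, h₁⟩ := exists_findAnchors_halts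
  obtain ⟨C₂, h₂⟩ := exists_kernel_halts
  obtain ⟨C₃, h₃⟩ := exists_double_halts
  obtain ⟨C₄, h₄⟩ := exists_largest_halts
  refine ⟨C₁ + C₂ + 6 * C₃ + initShape.bound + 36 * C₄,
    fun s n N ε σ a b hn hn3 hccw hre hε hε1 hN h5 hσ ha hb hbpos => ?_⟩
  have key : Halts approximate s (C₁ * (Nat.clog 2 n + 1) + (C₂ * ((N + 1) * (Nat.clog 2 n + 1)) +
      (C₃ * (5 * (N + 1) + 1) + (initShape.bound + C₄ * (5 * (N + 1) + 1) ^ 2)))) (fun s' =>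
        outputCorner s' 0 ∈ hull (vert s) n ∧ outputCorner s' 1 ∈ hull (vert s) n ∧
        outputCorner s' 2 ∈ hull (vert s) n ∧
        outputCorner s' 2 = outputCorner s' 0 + cmul a b (outputCorner s' 1 - outputCorner s' 0) ∧
        0 < cross (outputCorner s' 0) (outputCorner s' 1) (outputCorner s' 2) ∧
        ∀ p w, p ∈ hull (vert s) n → p + w ∈ hull (vert s) n → p + cmul a b w ∈ hull (vert s) n →
          (1 - ε) * (b * nsq w) ≤
            cross (outputCorner s' 0) (outputCorner s' 1) (outputCorner s' 2)) := by
    refine Halts.seq ((h₁ s n hn hn3 hccw).mono le_rfl ?_)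
    rintro s₁ ⟨q₁, anc⟩
    have v₁ : vert s₁ = vert s := q₁.vert_eq (by simp)
    refine Halts.seq ((h₂ s₁ n N ε (by rw [q₁.2 0 (by simp), hn]) (by rwa [v₁])
      (by rw [q₁.1, hre]) hε hN).mono le_rfl ?_)
    rintro s₂ ⟨q₂, ker, last, card⟩
    rw [v₁] at ker
    have v₂ : vert s₂ = vert s := (q₂.vert_eq (by simp)).trans v₁
    set K := s₂.int 7 0 with hK
    refine Halts.seq ((h₃ s₂).mono (Nat.mul_le_mul_left _ (by omega)) ?_)
    rintro s₃ ⟨q₃, fst, snd⟩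
    rw [← hK] at fst snd
    have v₃ : vert s₃ = vert s := (q₃.vert_eq (by simp)).trans v₂
    have hreal : s₃.real = s.real := by rw [q₃.1, q₂.1, q₁.1]
    refine Halts.seq (loopFree_initShape.halts ?_)
    set s₄ := initShape.exec s₃ with hs₄
    have hr : ∀ k, k ∉ [6, 7, 10] → s₄.real k = s.real k := by
      intro k hk
      simp at hk
      rw [← hreal]
      simp [hs₄, initShape, Program.exec, State.setReal, hk]
    have v₄ : vert s₄ = vert s :=
      (vert_congr (s := s₃) (s' := s₄) (by rw [hr 0 (by simp), hreal])
        (by rw [hr 1 (by simp), hreal]) rfl).trans v₃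
    set S : ℕ → Plane := fun i => vert s (s₃.int 15 i) with hS
    have ker' := ker.congr fst
    have hK3 : 3 ≤ K := Kernel.three_le anc ker last hε
    have last' : s₃.int 15 (K - 1) = n - 1 := by rw [fst _ (by omega), last]
    have hlt : ∀ i < K, s₃.int 15 i < n := by
      intro i hi
      rcases Nat.lt_or_ge i (K - 1) with h | h
      · have := ker'.lt h (by omega)
        omega
      · obtain rfl : i = K - 1 := by omega
        omega
    have hSccw : CCW S K := hccw.comp (fun i j => ker'.lt) hlt
    have hper : ∀ i < K, S (i + K) = S i := fun i hi => by
      simp only [hS]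
      rw [snd i hi, fst i hi]
    have hctx : Ctx S K a b s₄ := by
      refine ⟨fun i => by rw [v₄]; rfl, ?_, ?_, ?_⟩
      · show s₃.int 7 0 = K
        rw [q₃.2 7 (by simp)]
      · simp [hs₄, initShape, Program.exec, State.setReal_real, hreal, ha, hσ]
      · simp [hs₄, initShape, Program.exec, State.setReal_real, hreal, hb, hσ]
    refine (h₄ S K a b s₄ hctx hK3 hSccw hper hbpos (by rw [hr 5 (by simp), h5])).mono
      (Nat.mul_le_mul_left _ (Nat.pow_le_pow_left (by omega) 2)) ?_
    rintro s' ⟨g1, g2, g3, g4, g5, g6⟩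
    have hsub : hull S K ⊆ hull (vert s) n :=
      hull_subset (convex_hull' _ _) fun i hi => mem_hull (hlt i hi)
    refine ⟨hsub g1, hsub g2, hsub g3, g4, g5, fun p w m1 m2 m3 => ?_⟩
    -- The image of an inscribed triangle under the homothety has the same shape with `w` scaled by
    -- 1 - ε/2, and lies in the sparse polygon where the search is exact.
    have hom := fun x (hx : x ∈ hull (vert s) n) =>
      hccw.homothety_mem (m := s₁.int 2 0) (by have := anc.m_lt; omega) hK3
        (fun i j => ker'.lt) ker'.zero last' (e := ε / 2) (by linarith) (by linarith)
        ker'.chord hx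
    set c : Plane := (ε / 2) • ((1 / 2 : ℝ) • vert s 0 + (1 / 2 : ℝ) • vert s (s₁.int 2 0)) with hc
    have e1 : (1 - ε / 2) • (p + w) + c = ((1 - ε / 2) • p + c) + (1 - ε / 2) • w := by
      rw [smul_add]; abel
    have e2 : (1 - ε / 2) • (p + cmul a b w) + c =
        ((1 - ε / 2) • p + c) + cmul a b ((1 - ε / 2) • w) := by
      apply plane_ext <;> simp <;> ring
    have := g6 ((1 - ε / 2) • p + c) ((1 - ε / 2) • w) (hom p m1)
      (by rw [← e1]; exact hom _ m2) (by rw [← e2]; exact hom _ m3)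
    refine le_trans ?_ this
    have e3 : nsq ((1 - ε / 2) • w) = (1 - ε / 2) ^ 2 * nsq w := by
      simp [nsq]; ring
    rw [e3]
    have : 0 ≤ b * nsq w := mul_nonneg hbpos.le (nsq_nonneg w)
    nlinarith [sq_nonneg ε]
  refine key.mono ?_ fun _ h => h
  set A := Nat.clog 2 n + 1 with hA
  set M := N + 1 with hM
  have hM1 : 1 ≤ M := by omega
  have hMM : M ≤ M ^ 2 := by nlinarith
  calc C₁ * A + (C₂ * (M * A) + (C₃ * (5 * M + 1) + (initShape.bound + C₄ * (5 * M + 1) ^ 2)))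
      ≤ C₁ * (M * A) + (C₂ * (M * A) + (C₃ * (6 * M ^ 2) +
          (initShape.bound * M ^ 2 + C₄ * (6 * M) ^ 2))) := by
        refine Nat.add_le_add (Nat.mul_le_mul_left _ (Nat.le_mul_of_pos_left _ hM1))
          (Nat.add_le_add le_rfl (Nat.add_le_add (Nat.mul_le_mul_left _ (by omega))
            (Nat.add_le_add (Nat.le_mul_of_pos_right _ (by positivity))
              (Nat.mul_le_mul_left _ (Nat.pow_le_pow_left (by omega) 2)))))
    _ = (C₁ + C₂) * (M * A) + (6 * C₃ + initShape.bound + 36 * C₄) * M ^ 2 := by ring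
    _ ≤ (C₁ + C₂ + (6 * C₃ + initShape.bound + 36 * C₄)) * (M * A) +
        (C₁ + C₂ + (6 * C₃ + initShape.bound + 36 * C₄)) * M ^ 2 := by
        exact Nat.add_le_add (Nat.mul_le_mul_right _ (by omega)) (Nat.mul_le_mul_right _ (by omega))
    _ = _ := by ring

/-! ### The input polygon -/

theorem hull_eq_polygonRegion {n : ℕ} {v : Fin n → Plane} {V : ℕ → Plane} (e : Equiv.Perm (Fin n))
    (h : ∀ i : Fin n, V i = v (e i)) : hull V n = polygonRegion v := by
  have : V '' Set.Iio n = Set.range v := by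
    ext x
    constructor
    · rintro ⟨i, hi, rfl⟩
      exact ⟨e ⟨i, hi⟩, (h ⟨i, hi⟩).symm⟩
    · rintro ⟨i, rfl⟩
      exact ⟨e.symm i, (e.symm i).2, by rw [h, e.apply_symm_apply]⟩
  rw [hull, this, polygonRegion]

/-- The first three vertices already reveal the orientation. A clockwise list is read in reverse,
which permutes the vertices and so leaves the region unchanged. -/
theorem orient_halts {n : ℕ} {v : Fin n → Plane} (hv : IsConvexPolygon v) (α β ε : ℝ) :
    Halts orient (inputState v α β ε) orient.bound (fun s => s.int 0 0 = n ∧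
      s.real = (inputState v α β ε).real ∧ CCW (vert s) n ∧ hull (vert s) n = polygonRegion v) := by
  obtain ⟨hn, hor⟩ := hv
  set s₀ := inputState v α β ε with hs₀
  have hfree : orient.LoopFree := ⟨trivial, trivial⟩
  have h0 : ∀ i (h : i < n), s₀.real 0 i = v ⟨i, h⟩ 0 := fun i h => by simp [hs₀, inputState, h]
  have h1 : ∀ i (h : i < n), s₀.real 1 i = v ⟨i, h⟩ 1 := fun i h => by simp [hs₀, inputState, h]
  have hz : s₀.int 1 0 = 0 := rfl
  have hv₀ : ∀ i (h : i < n), vert s₀ i = v ⟨i, h⟩ := by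
    intro i h
    apply plane_ext <;> simp [vert, hz, h0 i h, h1 i h]
  have htest : (BExp.rlt (crossExp (vtx (.const 0)) (vtx (.const 1)) (vtx (.const 2)))
      (.const 0)).holds s₀ ↔ cross (v ⟨0, by omega⟩) (v ⟨1, by omega⟩) (v ⟨2, by omega⟩) < 0 := by
    simp [hv₀ 0 (by omega), hv₀ 1 (by omega), hv₀ 2 (by omega)]
  refine hfree.halts ?_
  have hlt01 : (⟨0, by omega⟩ : Fin n) < ⟨1, by omega⟩ := by simp [Fin.lt_def]
  have hlt12 : (⟨1, by omega⟩ : Fin n) < ⟨2, by omega⟩ := by simp [Fin.lt_def]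
  rcases hor with hor | hor
  · have hex : orient.exec s₀ = s₀ := by
      simp only [orient, Program.exec, htest, if_neg (hor _ _ _ hlt01 hlt12).not_gt]
    rw [hex]
    refine ⟨rfl, rfl, fun i j k hij hjk hk => ?_,
      hull_eq_polygonRegion (Equiv.refl _) fun i => hv₀ i i.2⟩
    rw [hv₀ i (by omega), hv₀ j (by omega), hv₀ k hk]
    exact hor _ _ _ hij hjk
  · have hex : orient.exec s₀ = s₀.setInt 1 0 (n - 1) := by
      simp only [orient, Program.exec, htest, if_pos (hor _ _ _ hlt01 hlt12)]
      rfl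
    rw [hex]
    set s₁ := s₀.setInt 1 0 (n - 1) with hs₁
    have hz₁ : s₁.int 1 0 = n - 1 := by simp [hs₁, State.setInt_int]
    have hv₁ : ∀ i (h : i < n), vert s₁ i = v ⟨n - 1 - i, by omega⟩ := by
      intro i h
      have e : n - 1 - i + (i - (n - 1)) = n - 1 - i := by omega
      rw [vert, hz₁, e]
      apply plane_ext
      · exact h0 _ (by omega)
      · exact h1 _ (by omega)
    refine ⟨rfl, rfl, fun i j k hij hjk hk => ?_,
      hull_eq_polygonRegion Fin.revPerm fun i => ?_⟩
    · rw [hv₁ i (by omega), hv₁ j (by omega), hv₁ k hk, ← cross_rotate, cross_swap]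
      have := hor ⟨n - 1 - k, by omega⟩ ⟨n - 1 - j, by omega⟩ ⟨n - 1 - i, by omega⟩
        (by simp only [Fin.lt_def]; omega) (by simp only [Fin.lt_def]; omega)
      linarith
    · rw [hv₁ i i.2, Fin.revPerm_apply]
      congr 1
      ext
      simp [Fin.rev]
      omega

theorem time_bound {n N : ℕ} {ε : ℝ} (hn : 3 ≤ n) (hε : 0 < ε) (hε1 : ε < 1)
    (hN : N = ⌈12 / Real.sqrt ε⌉₊) :
    ((N : ℝ) + 1) * (Nat.clog 2 n + 1) + ((N : ℝ) + 1) ^ 2 + 1 ≤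
      300 * (ε ^ (-(1 / 2) : ℝ) * Real.log n + ε⁻¹) := by
  have hr0 : 0 < Real.sqrt ε := Real.sqrt_pos.2 hε
  have hr1 : Real.sqrt ε ≤ 1 := Real.sqrt_le_one.2 hε1.le
  set y := (Real.sqrt ε)⁻¹ with hy
  have hy1 : 1 ≤ y := (one_le_inv₀ hr0).2 hr1
  have hyy : ε⁻¹ = y ^ 2 := by rw [hy, inv_pow, Real.sq_sqrt hε.le]
  have hpow : ε ^ (-(1 / 2) : ℝ) = y := by rw [Real.rpow_neg hε.le, ← Real.sqrt_eq_rpow]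
  have hNle : (N : ℝ) + 1 ≤ 14 * y := by
    have := Nat.ceil_lt_add_one (a := 12 / Real.sqrt ε) (by positivity)
    rw [← hN, div_eq_mul_inv, ← hy] at this
    linarith
  have hn3 : (3 : ℝ) ≤ n := by exact_mod_cast hn
  have hlog1 : 1 ≤ Real.log n := by
    rw [Real.le_log_iff_exp_le (by linarith)]
    linarith [Real.exp_one_lt_d9]
  -- From 2^(clog n - 1) < n and log 2 ≥ 1/2 one gets clog n + 1 ≤ 2 log n + 2, and log n ≥ 1 for n
  -- ≥ 3.
  have hclog : (Nat.clog 2 n : ℝ) + 1 ≤ 4 * Real.log n := by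
    have h := Nat.pow_pred_clog_lt_self (b := 2) (by norm_num) (x := n) (by omega)
    have hl : Real.log ((2 : ℝ) ^ (Nat.clog 2 n).pred) < Real.log n :=
      Real.log_lt_log (by positivity) (by exact_mod_cast h)
    rw [Real.log_pow] at hl
    have hp : (Nat.clog 2 n : ℝ) ≤ (Nat.clog 2 n).pred + 1 := by
      exact_mod_cast (show Nat.clog 2 n ≤ (Nat.clog 2 n).pred + 1 by
        simp only [Nat.pred_eq_sub_one]; omega)
    have h2 := Real.log_two_gt_d9
    have : ((Nat.clog 2 n).pred : ℝ) * (1 / 2) ≤ ((Nat.clog 2 n).pred : ℝ) * Real.log 2 := by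
      gcongr; linarith
    linarith
  rw [hpow, hyy]
  have e1 : ((N : ℝ) + 1) * (Nat.clog 2 n + 1) ≤ (14 * y) * (4 * Real.log n) := by gcongr
  have e2 : ((N : ℝ) + 1) ^ 2 ≤ (14 * y) ^ 2 := by gcongr
  -- The coefficients are 14 · 4 = 56 and 14² + 1 = 197, both below 300.
  nlinarith [mul_pos (lt_of_lt_of_le one_pos hy1) (lt_of_lt_of_le one_pos hlog1)]

end RealRAM

/-! ### Return to inscribed triangles with given angles, and the main theorem -/

theorem isInscribedABTriangle_iff {V : ℕ → Plane} {n : ℕ} {α β : ℝ} (hα : 0 < α) (hβ : 0 < β)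
    (hαβ : α + β < Real.pi) {p q r : Plane} {σ a b : ℝ}
    (hσ : σ = Real.sin α * Real.cos β + Real.cos α * Real.sin β)
    (ha : a = Real.cos α * Real.sin β / σ) (hb : b = Real.sin α * Real.sin β / σ) :
    IsInscribedABTriangle (hull V n) α β p q r ↔ 0 < cross p q r ∧ r = p + cmul a b (q - p) ∧
      p ∈ hull V n ∧ q ∈ hull V n ∧ r ∈ hull V n := by
  rw [IsInscribedABTriangle, isABTriangle_iff hα hβ hαβ hσ ha hb,
    (convex_hull' V n).convexHull_subset_iff]
  simp [Set.insert_subset_iff, and_assoc]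

theorem isGreatest_inscribedAreas {V : ℕ → Plane} {n : ℕ} (hV : CCW V n) (hn : 3 ≤ n)
    {α β : ℝ} (hα : 0 < α) (hβ : 0 < β)
    (hαβ : α + β < Real.pi) {σ a b : ℝ}
    (hσ : σ = Real.sin α * Real.cos β + Real.cos α * Real.sin β)
    (ha : a = Real.cos α * Real.sin β / σ) (hb : b = Real.sin α * Real.sin β / σ) (hb0 : 0 < b) :
    ∃ p w, p ∈ hull V n ∧ p + w ∈ hull V n ∧ p + cmul a b w ∈ hull V n ∧
      IsGreatest (inscribedAreas (hull V n) α β) (b * nsq w / 2) := by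
  obtain ⟨p, w, hp, hq, hr, -, hmax⟩ := exists_max_triangle V (by omega : 0 < n) a b
  obtain ⟨p', w', hw', g1, g2, g3⟩ := hV.exists_triangle hn a b
  have hw : 0 < nsq w := (nsq_pos hw').trans_le (hmax p' w' g1 g2 g3)
  have hpos := mul_pos hb0 hw
  refine ⟨p, w, hp, hq, hr, ⟨p, p + w, p + cmul a b w, ?_, ?_⟩, ?_⟩
  · rw [isInscribedABTriangle_iff hα hβ hαβ hσ ha hb, cross_cmul, add_sub_cancel_left]
    exact ⟨hpos, rfl, hp, hq, hr⟩
  · rw [triangleArea, cross_cmul, abs_of_pos hpos]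
  · rintro A ⟨p₁, q₁, r₁, h, rfl⟩
    rw [isInscribedABTriangle_iff hα hβ hαβ hσ ha hb] at h
    obtain ⟨h0, h1, h2, h3, h4⟩ := h
    obtain ⟨w₁, rfl⟩ : ∃ w₁, q₁ = p₁ + w₁ := ⟨q₁ - p₁, by rw [add_sub_cancel]⟩
    rw [add_sub_cancel_left] at h1
    subst h1
    rw [triangleArea, abs_of_pos h0, cross_cmul]
    have := hmax p₁ w₁ h2 h3 h4
    gcongr

theorem theorem4 :
    ∃ (prog : RealRAM.Program) (C : ℝ),
      ∀ (n : ℕ) (v : Fin n → Plane) (α β ε : ℝ),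
        IsConvexPolygon v → 0 < α → 0 < β → α + β < Real.pi → 0 < ε → ε < 1 →
        ∃ (s : RealRAM.State) (t : ℕ),
          RealRAM.Runs prog (inputState v α β ε) s t ∧
          (t : ℝ) ≤ C * (ε ^ (-(1 / 2) : ℝ) * Real.log n + ε⁻¹) ∧
          IsInscribedABTriangle (polygonRegion v) α β
            (outputCorner s 0) (outputCorner s 1) (outputCorner s 2) ∧
          ∃ M : ℝ, IsGreatest (inscribedAreas (polygonRegion v) α β) M ∧
            (1 - ε) * M ≤
              triangleArea (outputCorner s 0) (outputCorner s 1) (outputCorner s 2) := by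
  obtain ⟨C, hC⟩ := RealRAM.exists_approximate_halts
  refine ⟨.seq RealRAM.orient RealRAM.approximate, (RealRAM.orient.bound + C : ℕ) * 300,
    fun n v α β ε hv hα hβ hαβ hε hε1 => ?_⟩
  set σ := Real.sin α * Real.cos β + Real.cos α * Real.sin β with hσ
  set a := Real.cos α * Real.sin β / σ with ha
  set b := Real.sin α * Real.sin β / σ with hb
  have hσ0 : 0 < σ := by
    rw [hσ, ← Real.sin_add]
    exact Real.sin_pos_of_pos_of_lt_pi (by linarith) hαβ
  have hb0 : 0 < b := div_pos (mul_pos (Real.sin_pos_of_pos_of_lt_pi hα (by linarith))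
    (Real.sin_pos_of_pos_of_lt_pi hβ (by linarith))) hσ0
  set N := ⌈12 / Real.sqrt ε⌉₊ with hN
  have hn := hv.1
  obtain ⟨s, t, hrun, ht, hs⟩ := RealRAM.Halts.seq ((RealRAM.orient_halts hv α β ε).mono le_rfl
    (R := fun s₁ => RealRAM.Halts RealRAM.approximate s₁
      (C * ((N + 1) * (Nat.clog 2 n + 1) + (N + 1) ^ 2)) (fun s =>
        IsInscribedABTriangle (polygonRegion v) α β
            (outputCorner s 0) (outputCorner s 1) (outputCorner s 2) ∧
          ∃ M : ℝ, IsGreatest (inscribedAreas (polygonRegion v) α β) M ∧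
            (1 - ε) * M ≤
              triangleArea (outputCorner s 0) (outputCorner s 1) (outputCorner s 2))) (by
    rintro s₁ ⟨h1, h2, h3, h4⟩
    refine (hC s₁ n N ε σ a b h1 hn h3 (by rw [h2]; rfl) hε hε1 (Nat.le_ceil _)
      (by rw [h2]; rfl) (by rw [h2]; rfl) (by rw [h2]; rfl) (by rw [h2]; rfl) hb0).mono le_rfl ?_
    rintro s ⟨g1, g2, g3, g4, g5, g6⟩
    rw [← h4]
    refine ⟨(isInscribedABTriangle_iff hα hβ hαβ hσ ha hb).2 ⟨g5, g4, g1, g2, g3⟩, ?_⟩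
    obtain ⟨p, w, m1, m2, m3, hM⟩ := isGreatest_inscribedAreas h3 hn hα hβ hαβ hσ ha hb hb0
    refine ⟨_, hM, ?_⟩
    rw [triangleArea, abs_of_pos g5]
    linarith [g6 p w m1 m2 m3]))
  refine ⟨s, t, hrun, ?_, hs⟩
  -- The summand 1 absorbs the constant time of the orientation test, so that a single factor bounds
  -- both phases.
  have hT : (t : ℝ) ≤ (RealRAM.orient.bound + C : ℕ) *
      (((N : ℝ) + 1) * (Nat.clog 2 n + 1) + ((N : ℝ) + 1) ^ 2 + 1) := by
    refine (Nat.cast_le.2 ht).trans ?_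
    push_cast
    have hX : 0 ≤ ((N : ℝ) + 1) * (Nat.clog 2 n + 1) + ((N : ℝ) + 1) ^ 2 := by positivity
    have := mul_nonneg (Nat.cast_nonneg (α := ℝ) RealRAM.orient.bound) hX
    have := Nat.cast_nonneg (α := ℝ) C
    linarith
  rw [mul_assoc]
  exact hT.trans (mul_le_mul_of_nonneg_left (RealRAM.time_bound hn hε hε1 hN) (by positivity))

end
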